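/- Let $\sigma=\mathrm{diag}(-1,1,1)$ and $e^{i\lambda x\,\mathrm{ad}\,\sigma}B=e^{i\lambda x\sigma}Be^{-i\lambda x\sigma}$ for $3\times3$ matrices $B$. Let $x\in\mathbb R$, let $\rho_1,\rho_2\in H^{1,1}(\mathbb R)=\{f: f'\in L^2(\mathbb R),\ \lambda f(\lambda)\in L^2(\mathbb R)\}$ (continuous representatives), let $n\ge 0$, $z_1,\dots,z_n\in\mathbb C^+$ and $\mathbf C_1,\dots,\mathbf C_n\in\mathbb C^2$ (column vectors). Let $\gamma_i$ be the circle of radius $r_i>0$ around $z_i$, where the $r_i$ are so small that the closed discs bounded by the $\gamma_i$ lie in the open upper half-plane and are pairwise disjoint; let $\gamma_i^*$ be the complex conjugate circle, around $\overline{z_i}$. Put $\Gamma=\mathbb R\cup\bigcup_i(\gamma_i\cup\gamma_i^*)$, with $\mathbb R$ oriented from left to right, $\gamma_i$ clockwise and $\gamma_i^*$ counterclockwise, so that the positive (left) side of $\Gamma$ is the upper half-plane near $\mathbb R$, the exterior of $\gamma_i$ and the interior of $\gamma_i^*$. Define on $\Gamma$ $$V(\lambda)=\begin{pmatrix}1+|\rho_1(\lambda)|^2+|\rho_2(\lambda)|^2&\overline{\rho_1(\lambda)}&\overline{\rho_2(\lambda)}\\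 \rho_1(\lambda)&1&0\\ \rho_2(\lambda)&0&1\end{pmatrix}\ (\lambda\in\mathbb R),$$ $$V(\lambda)=\begin{pmatrix}1&0\\ \frac{\mathbf C_i}{\lambda-z_i}&I_2\end{pmatrix}\ (\lambda\in\gamma_i),\qquad V(\lambda)=\begin{pmatrix}1&\frac{\overline{\mathbf C_i}^{\,T}}{\lambda-\overline{z_i}}\\ 0&I_2\end{pmatrix}\ (\lambda\in\gamma_i^*).$$ Then there is exactly one $3\times3$ matrix-valued function $M(x,\cdot)$ on $\mathbb C\setminus\Gamma$ such that (i) $M(x,z)$ is analytic in $z\in\mathbb C\setminus\Gamma$; (ii) $M(x,z)\to I$ as $z\to\infty$ in $\mathbb C\setminus\Gamma$, and, for every $\delta>0$, $M(x,z)=I+\mathcal O(z^{-1})$ as $z\to\infty$ in $\{|\operatorname{Im}z|\ge\delta\}$; (iii) at each $\lambda\in\Gamma$, $M(x,\cdot)$ has boundary values $M_+(x,\lambda)$ and $M_-(x,\lambda)$ (limits as $z\to\lambda$ from the positive and from the negative side of $\Gamma$), which are continuous on $\Gamma$ and satisfy $$M_+(x,\lambda)=M_-(x,\lambda)\,e^{i\lambda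 x\,\mathrm{ad}\,\sigma}V(\lambda).$$ -/

import Mathlib

open Complex Filter Topology MeasureTheory Bornology Asymptotics Set
open scoped ComplexConjugate

namespace ManakovRHP

/-- The weighted Sobolev space `H^{1,1}(ℝ) = {f : f' ∈ L², λ f ∈ L²}`, in terms of the (absolutely)
continuous representative `f`: the function `f` is a primitive of some `g ∈ L²(ℝ)`, its weak
derivative, and `λ ↦ λ f(λ)` is in `L²(ℝ)`. Both together give `f ∈ L²(ℝ)`. -/
def MemH11 (f : ℝ → ℂ) : Prop :=
  (∃ g : ℝ → ℂ, MemLp g 2 volume ∧ ∀ a b : ℝ, f b - f a = ∫ t in a..b, g t) ∧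
    MemLp (fun t : ℝ => (t : ℂ) * f t) 2 volume

/-- The diagonal entries of `σ = diag(-1, 1, 1)`. -/
def sig : Fin 3 → ℂ := ![-1, 1, 1]

/-- The diagonal matrix `e^{i λ x σ}`. -/
noncomputable def expSig (x : ℝ) (l : ℂ) : Matrix (Fin 3) (Fin 3) ℂ :=
  Matrix.diagonal fun j => Complex.exp (I * l * x * sig j)

/-- `e^{i λ x ad σ} B = e^{i λ x σ} B e^{-i λ x σ}`, where `ad σ (B) = σ B - B σ`. -/
noncomputable def expAd (x : ℝ) (l : ℂ) (B : Matrix (Fin 3) (Fin 3) ℂ) :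
    Matrix (Fin 3) (Fin 3) ℂ :=
  expSig x l * B * expSig x (-l)

/-- The jump matrix on the real line, in terms of the values `a = ρ₁(λ)` and `b = ρ₂(λ)`. -/
noncomputable def jumpReal (a b : ℂ) : Matrix (Fin 3) (Fin 3) ℂ :=
  !![1 + ((‖a‖ ^ 2 : ℝ) : ℂ) + ((‖b‖ ^ 2 : ℝ) : ℂ), conj a, conj b;
     a, 1, 0;
     b, 0, 1]

/-- The jump matrix on the circle `γ` around `w` in the upper half plane, with constant vector
`c`. -/
noncomputable def jumpUp (w : ℂ) (c : Fin 2 → ℂ) (l : ℂ) : Matrix (Fin 3) (Fin 3) ℂ :=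
  !![1, 0, 0;
     c 0 / (l - w), 1, 0;
     c 1 / (l - w), 0, 1]

/-- The jump matrix on the reflected circle `γ*` around `w*`. -/
noncomputable def jumpDown (w : ℂ) (c : Fin 2 → ℂ) (l : ℂ) : Matrix (Fin 3) (Fin 3) ℂ :=
  !![1, conj (c 0) / (l - conj w), conj (c 1) / (l - conj w);
     0, 1, 0;
     0, 0, 1]

/-- The contour `Γ`: the real line, the circles `|λ - z_i| = r_i` and their conjugates. -/
def contour {n : ℕ} (z : Fin n → ℂ) (r : Fin n → ℝ) : Set ℂ :=
  {l | l.im = 0} ∪ (⋃ i, Metric.sphere (z i) (r i)) ∪ ⋃ i, Metric.sphere (conj (z i)) (r i)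

/-- The positive side of `Γ`. The real line is oriented from left to right, the circles in the
upper half plane are oriented clockwise, those in the lower half plane counterclockwise; the
positive side lies to the left. -/
def plusSide {n : ℕ} (z : Fin n → ℂ) (r : Fin n → ℝ) : Set ℂ :=
  {w | 0 < w.im ∧ ∀ i, r i < dist w (z i)} ∪ ⋃ i, Metric.ball (conj (z i)) (r i)

/-- The negative side of `Γ`, to the right of the oriented contour. -/
def minusSide {n : ℕ} (z : Fin n → ℂ) (r : Fin n → ℝ) : Set ℂ :=
  {w | w.im < 0 ∧ ∀ i, r i < dist w (conj (z i))} ∪ ⋃ i, Metric.ball (z i) (r i)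

/-- `M` (of which only the values off the contour `Γ` matter) solves the Riemann–Hilbert problem
with parameter `x`, reflection coefficients `ρ₁, ρ₂`, poles `z_i`, radii `r_i` and constants
`C_i ∈ ℂ²`. -/
structure IsSolution {n : ℕ} (x : ℝ) (ρ₁ ρ₂ : ℝ → ℂ) (z : Fin n → ℂ) (r : Fin n → ℝ)
    (C : Fin n → Fin 2 → ℂ) (M : ℂ → Matrix (Fin 3) (Fin 3) ℂ) : Prop where
  /-- `M` is analytic off `Γ`. -/
  analytic : ∀ i j, DifferentiableOn ℂ (fun w => M w i j) (contour z r)ᶜ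
  /-- `M → I` as `z → ∞` in the complement of `Γ`, uniformly up to the contour. -/
  tendsto_one : Tendsto M (cobounded ℂ ⊓ 𝓟 (contour z r)ᶜ) (𝓝 1)
  /-- `M = I + O(1/z)` as `z → ∞`, uniformly in `|Im z| ≥ δ`, for every `δ > 0`. -/
  isBigO : ∀ δ : ℝ, 0 < δ → ∀ i j,
    (fun w => M w i j - (1 : Matrix (Fin 3) (Fin 3) ℂ) i j)
      =O[cobounded ℂ ⊓ 𝓟 {w | δ ≤ |w.im|}] fun w => w⁻¹
  /-- `M` has continuous boundary values on `Γ` from both sides, related by the jump matrix. -/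
  jump : ∃ Mp Mm : ℂ → Matrix (Fin 3) (Fin 3) ℂ,
    ContinuousOn Mp (contour z r) ∧ ContinuousOn Mm (contour z r) ∧
    (∀ l ∈ contour z r, Tendsto M (𝓝[plusSide z r] l) (𝓝 (Mp l))) ∧
    (∀ l ∈ contour z r, Tendsto M (𝓝[minusSide z r] l) (𝓝 (Mm l))) ∧
    (∀ t : ℝ, Mp t = Mm t * expAd x t (jumpReal (ρ₁ t) (ρ₂ t))) ∧
    (∀ i, ∀ l ∈ Metric.sphere (z i) (r i), Mp l = Mm l * expAd x l (jumpUp (z i) (C i) l)) ∧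
    (∀ i, ∀ l ∈ Metric.sphere (conj (z i)) (r i),
      Mp l = Mm l * expAd x l (jumpDown (z i) (C i) l))

end ManakovRHP

/-! Uniqueness is Liouville's theorem. Every jump matrix has determinant one, so `det M` has no jump
across Γ. A function that is analytic off Γ and continuous across it is entire, by Morera's theorem
for the line and a Cauchy integral argument for the circles; hence `det M = 1`. For two solutions
the common jump cancels in `M' * adjugate M`, so this product is entire and tends to `I`, and
therefore equals `I` (`eq_const_of_no_jump`, `IsSolution.unique`).

Existence first removes the circles. On the line, the conjugated jump is the product of an upper
unipotent matrix with entries `conj ρ` and a lower unipotent one with entries `ρ`, where `ρ` carries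
the phase `e^{2ixλ}`. Multiplying `M` from the right by lower unipotent matrices above the line and
by their reflected upper unipotent counterparts below only adds a function to `ρ`. That function is
a combination of differences of simple poles at `z_i` and at `conj z_i`; inside each disc it is
corrected by `e^{2ixv}/(v - z_i)`, which produces exactly the prescribed jump on the circle. The
paired poles decay like `λ⁻²` on the line, so the new reflection coefficient is as regular as the
old one (`jump_real`, `isRegular_dressedReflection`).

The problem on the line decouples into rows. With a boundary row `(m₀, m₁, m₂)` from below and `(p₀,
p₁, p₂)` from above, the jump reads `p_k - m_k = conj ρ_k m₀` for `k = 1, 2` and `p₀ - m₀ = ρ₁ p₁ +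
ρ₂ p₂`. Splitting the right sides into positive and negative frequencies, and writing `m₀, p₁, p₂`
as constants plus Fourier–Laplace transforms of densities `u, v₁, v₂` on the half line, turns this
into a Marchenko system of Hankel operators. Eliminating `v₁, v₂` leaves `(1 + H₁H₁* + H₂H₂*) u =
R`, which is uniquely solvable in `L²` because the operator is at least `1`; no smallness is needed
(`isUnit_one_add_hankel`). The weight `(1 + |s|)` on the Fourier side, which encodes `ρ' ∈ L²`,
upgrades the densities to `L¹`, so that their transforms extend continuously to the line and vanish
at infinity; the weight on the function side gives `O(1/z)` away from the line. -/

namespace ManakovRHP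

/-! ### Fourier transforms of `H^{1,1}` functions -/

open scoped FourierTransform

/-- The Fourier transform of an `L¹ ∩ L²` function agrees almost everywhere with its
`L²` Fourier transform. -/
lemma fourier_toLp_ae_eq {f : ℝ → ℂ} (hf : Integrable f) (hf2 : MemLp f 2 volume) :
    (𝓕 (hf2.toLp f) : Lp ℂ 2 (volume : Measure ℝ)) =ᵐ[volume] 𝓕 f := by
  have hcont : Continuous (𝓕 f) :=
    VectorFourier.fourierIntegral_continuous Real.continuous_fourierChar
      (by exact continuous_inner) hf
  -- Both transforms are tested against a smooth compactly supported `g`. Each pairing equals `∫ (𝓕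
  -- G) f`: one by duality of tempered distributions, the other by the multiplication formula for
  -- `L¹`.
  refine ae_eq_of_integral_contDiff_smul_eq ?_ hcont.locallyIntegrable ?_
  · exact (Lp.memLp _).locallyIntegrable (by norm_num)
  intro g hg hgc
  let G : SchwartzMap ℝ ℂ := HasCompactSupport.toSchwartzMap (f := fun t => (g t : ℂ))
    (hgc.comp_left (g := fun r : ℝ => (r : ℂ)) (by simp)) (by
      exact Complex.ofRealCLM.contDiff.comp hg)
  have hG : ∀ t, G t = (g t : ℂ) := fun t => rfl
  have h1 := congrArg (fun T => T G) (Lp.fourier_toTemperedDistribution_eq (hf2.toLp f))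
  simp only [TemperedDistribution.fourier_apply, Lp.toTemperedDistribution_apply] at h1
  have h2 : ∫ t, (𝓕 (G : ℝ → ℂ)) t • f t = ∫ t, G t • 𝓕 f t := by
    have := VectorFourier.integral_fourierIntegral_smul_eq_flip (e := Real.fourierChar)
      (L := innerₗ ℝ) (μ := (volume : Measure ℝ)) (ν := (volume : Measure ℝ)) (f := G) (g := f)
      Real.continuous_fourierChar (by exact continuous_inner) G.integrable hf
    rw [show (innerₗ ℝ).flip = innerₗ ℝ from by ext; simp] at this
    exact this
  have h3 : ∫ t, (𝓕 G) t • (hf2.toLp f) t = ∫ t, (𝓕 (G : ℝ → ℂ)) t • f t := by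
    apply integral_congr_ae
    filter_upwards [hf2.coeFn_toLp] with t ht
    rw [ht, SchwartzMap.fourier_coe]
  calc ∫ t, g t • (𝓕 (hf2.toLp f) : Lp ℂ 2 (volume : Measure ℝ)) t
      = ∫ t, G t • (𝓕 (hf2.toLp f) : Lp ℂ 2 (volume : Measure ℝ)) t := by
        simp [hG]
    _ = ∫ t, G t • 𝓕 f t := by rw [← h1, h3, h2]
    _ = ∫ t, g t • 𝓕 f t := by simp [hG]

/-- Plancherel's theorem for `L¹ ∩ L²` functions. -/
lemma eLpNorm_fourier {f : ℝ → ℂ} (hf : Integrable f) (hf2 : MemLp f 2 volume) :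
    eLpNorm (𝓕 f) 2 volume = eLpNorm f 2 volume := by
  rw [← eLpNorm_congr_ae (fourier_toLp_ae_eq hf hf2), ← eLpNorm_congr_ae hf2.coeFn_toLp]
  have := Lp.norm_fourier_eq (hf2.toLp f)
  rw [Lp.norm_def, Lp.norm_def] at this
  exact (ENNReal.toReal_eq_toReal_iff' (Lp.memLp _).eLpNorm_ne_top
    (Lp.memLp _).eLpNorm_ne_top).1 this

lemma continuous_fourier {f : ℝ → ℂ} (hf : Integrable f) : Continuous (𝓕 f) :=
  VectorFourier.fourierIntegral_continuous Real.continuous_fourierChar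
      (by exact continuous_inner) hf

lemma memLp_one_add_abs_inv : MemLp (fun t : ℝ => (1 + |t|)⁻¹) 2 volume := by
  have hc : Continuous fun t : ℝ => (1 + |t|)⁻¹ :=
    (continuous_const.add continuous_abs).inv₀ fun t => (by positivity : (0 : ℝ) < 1 + |t|).ne'
  rw [memLp_two_iff_integrable_sq hc.aestronglyMeasurable]
  refine Integrable.mono' integrable_inv_one_add_sq (hc.pow 2).aestronglyMeasurable
    (ae_of_all _ fun t => ?_)
  rw [Real.norm_of_nonneg (by positivity), inv_pow]
  apply inv_anti₀ (by positivity)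
  nlinarith [abs_nonneg t, sq_abs t]

/-- Continuous functions with `λ f ∈ L²` satisfy `(1 + |λ|) f ∈ L²`. -/
lemma memLp_one_add_abs_mul {f : ℝ → ℂ} (hc : Continuous f)
    (h : MemLp (fun t : ℝ => (t : ℂ) * f t) 2 volume) :
    MemLp (fun t : ℝ => ((1 + |t| : ℝ) : ℂ) * f t) 2 volume := by
  have hm : Continuous fun t : ℝ => ((1 + |t| : ℝ) : ℂ) * f t :=
    (continuous_ofReal.comp (continuous_const.add continuous_abs)).mul hc
  have h1 : MemLp ((Icc (-1 : ℝ) 1).indicator fun t : ℝ => ((1 + |t| : ℝ) : ℂ) * f t) 2 volume := by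
    obtain ⟨c, hcb⟩ := isCompact_Icc.exists_bound_of_continuousOn (hm.continuousOn (s := Icc (-1) 1))
    rw [memLp_indicator_iff_restrict measurableSet_Icc]
    exact MemLp.of_bound hm.aestronglyMeasurable c
      ((ae_restrict_iff' measurableSet_Icc).2 (ae_of_all _ hcb))
  have h2 : MemLp ((Icc (-1 : ℝ) 1)ᶜ.indicator fun t : ℝ => ((1 + |t| : ℝ) : ℂ) * f t) 2 volume := by
    refine (h.const_mul 2).mono
      (hm.aestronglyMeasurable.indicator measurableSet_Icc.compl) (ae_of_all _ fun t => ?_)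
    by_cases ht : t ∈ (Icc (-1 : ℝ) 1)ᶜ
    · rw [indicator_of_mem ht]
      have : 1 ≤ |t| := by
        by_contra hlt
        exact ht (abs_le.1 (not_le.1 hlt).le)
      simp only [norm_mul, norm_real, Real.norm_eq_abs]
      rw [abs_of_nonneg (by positivity), ← mul_assoc]
      gcongr
      norm_num
      linarith
    · rw [indicator_of_notMem ht, norm_zero]; positivity
  have := h1.add h2
  rwa [indicator_self_add_compl] at this

lemma integrable_of_one_add_abs {f : ℝ → ℂ}
    (h : MemLp (fun t : ℝ => ((1 + |t| : ℝ) : ℂ) * f t) 2 volume) : Integrable f := by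
  have := h.integrable_mul memLp_one_add_abs_inv.ofReal (𝕜 := ℂ)
  refine this.congr (ae_of_all _ fun t => ?_)
  have : ((1 + |t| : ℝ) : ℂ) ≠ 0 := by
    have : (1 + |t| : ℝ) ≠ 0 := by positivity
    exact_mod_cast this
  simp only [Pi.mul_apply, Complex.coe_algebraMap, ofReal_inv]
  field_simp

lemma memLp_of_one_add_abs {f : ℝ → ℂ} (hm : AEStronglyMeasurable f volume)
    (h : MemLp (fun t : ℝ => ((1 + |t| : ℝ) : ℂ) * f t) 2 volume) : MemLp f 2 volume := by
  refine h.mono hm (ae_of_all _ fun t => ?_)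
  rw [norm_mul, norm_real, Real.norm_of_nonneg (by positivity)]
  nlinarith [norm_nonneg (f t), abs_nonneg t]

lemma _root_.MeasureTheory.MemLp.intervalIntegrable_two {g : ℝ → ℂ} (hg : MemLp g 2 volume)
    (a b : ℝ) : IntervalIntegrable g volume a b := by
  have h1 : LocallyIntegrable g volume := hg.locallyIntegrable (by norm_num)
  exact (h1.integrableOn_isCompact isCompact_uIcc).intervalIntegrable

lemma MemH11.continuous {f : ℝ → ℂ} (h : MemH11 f) : Continuous f := by
  obtain ⟨⟨g, hg, hfg⟩, -⟩ := h
  have h1 : Continuous fun b => f 0 + ∫ t in (0 : ℝ)..b, g t :=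
    continuous_const.add (intervalIntegral.continuous_primitive hg.intervalIntegrable_two 0)
  refine h1.congr fun b => ?_
  rw [← hfg 0 b]; ring

/-- The `L²` modulus of continuity of a primitive of an `L²` function is linear. -/
lemma eLpNorm_shift_sub_le {f g : ℝ → ℂ} (hg : MemLp g 2 volume)
    (hfg : ∀ a b : ℝ, f b - f a = ∫ t in a..b, g t) {h : ℝ} (hh : 0 < h) :
    ∫⁻ t, ‖f (t + h) - f t‖ₑ ^ 2 ≤ ENNReal.ofReal h ^ 2 * ∫⁻ t, ‖g t‖ₑ ^ 2 := by
  have hgm : AEMeasurable (fun t => ‖g t‖ₑ) volume := hg.aestronglyMeasurable.enorm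
  have key : ∀ t, ‖f (t + h) - f t‖ₑ ^ 2 ≤
      ENNReal.ofReal h * ∫⁻ u in Ioc 0 h, ‖g (t + u)‖ₑ ^ 2 := by
    intro t
    have hm : AEMeasurable (fun u => ‖g (t + u)‖ₑ) (volume.restrict (Ioc 0 h)) :=
      (hgm.comp_quasiMeasurePreserving
        (measurePreserving_add_left volume t).quasiMeasurePreserving).restrict
    have h1 : ‖f (t + h) - f t‖ₑ ≤ ∫⁻ u in Ioc 0 h, ‖g (t + u)‖ₑ := by
      rw [hfg]
      have := intervalIntegral.integral_comp_add_left (a := 0) (b := h) g t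
      rw [add_zero] at this
      rw [← this, intervalIntegral.integral_of_le hh.le]
      exact enorm_integral_le_lintegral_enorm _
    -- Cauchy–Schwarz against the constant `1` gives one factor `h`; the second comes from
    -- integrating over `u ∈ (0, h]` after Tonelli.
    have h2 := ENNReal.lintegral_mul_le_Lp_mul_Lq (volume.restrict (Ioc 0 h))
      Real.HolderConjugate.two_two hm (aemeasurable_const (b := (1 : ENNReal)))
    simp only [Pi.mul_apply, mul_one, lintegral_const, Measure.restrict_apply,
      MeasurableSet.univ, univ_inter, Real.volume_Ioc, sub_zero, ENNReal.rpow_two, one_pow, one_mul] at h2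
    calc ‖f (t + h) - f t‖ₑ ^ 2 ≤ (∫⁻ u in Ioc 0 h, ‖g (t + u)‖ₑ) ^ 2 := by gcongr
      _ ≤ ((∫⁻ u in Ioc 0 h, ‖g (t + u)‖ₑ ^ 2) ^ (1 / 2 : ℝ) *
          ENNReal.ofReal h ^ (1 / 2 : ℝ)) ^ 2 := by gcongr
      _ = _ := by
        rw [mul_pow, ← ENNReal.rpow_two, ← ENNReal.rpow_two, ← ENNReal.rpow_mul,
          ← ENNReal.rpow_mul]
        norm_num
        rw [mul_comm]
  calc ∫⁻ t, ‖f (t + h) - f t‖ₑ ^ 2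
      ≤ ∫⁻ t, ENNReal.ofReal h * ∫⁻ u in Ioc 0 h, ‖g (t + u)‖ₑ ^ 2 := lintegral_mono key
    _ = ENNReal.ofReal h * ∫⁻ t, ∫⁻ u in Ioc 0 h, ‖g (t + u)‖ₑ ^ 2 := by
        rw [lintegral_const_mul' _ _ ENNReal.ofReal_ne_top]
    _ = ENNReal.ofReal h * ∫⁻ u in Ioc 0 h, ∫⁻ t, ‖g (t + u)‖ₑ ^ 2 := by
        rw [lintegral_lintegral_swap]
        have : AEMeasurable (fun p : ℝ × ℝ => ‖g (p.1 + p.2)‖ₑ ^ 2) (volume.prod volume) :=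
          (hgm.comp_quasiMeasurePreserving
            (quasiMeasurePreserving_add volume volume)).pow_const 2
        exact this.mono_measure (Measure.prod_mono le_rfl Measure.restrict_le_self)
    _ = _ := by
        simp_rw [lintegral_add_right_eq_self (fun t => ‖g t‖ₑ ^ 2)]
        simp only [lintegral_const, Measure.restrict_apply,
          MeasurableSet.univ, univ_inter, Real.volume_Ioc, sub_zero]
        ring

lemma integrable_exp_smul {f : ℝ → ℂ} (hf : Integrable f) (s : ℝ) :
    Integrable fun t : ℝ => Complex.exp (↑(-2 * Real.pi * t * s) * I) • f t := by
  have hc : Continuous fun t : ℝ => Complex.exp (↑(-2 * Real.pi * t * s) * I) := by fun_prop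
  refine hf.congr' (hc.aestronglyMeasurable.smul hf.1) (ae_of_all _ fun t => ?_)
  rw [norm_smul, Complex.norm_exp_ofReal_mul_I, one_mul]

lemma fourier_sub_apply {f g : ℝ → ℂ} (hf : Integrable f) (hg : Integrable g) (s : ℝ) :
    𝓕 (fun t => f t - g t) s = 𝓕 f s - 𝓕 g s := by
  simp only [Real.fourier_real_eq_integral_exp_smul]
  rw [← integral_sub (integrable_exp_smul hf s) (integrable_exp_smul hg s)]
  simp only [smul_sub]

lemma fourier_comp_add {f : ℝ → ℂ} (h s : ℝ) :
    𝓕 (fun t => f (t + h)) s = Complex.exp (2 * Real.pi * I * h * s) * 𝓕 f s := by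
  simp only [Real.fourier_real_eq_integral_exp_smul]
  rw [← integral_add_right_eq_self (fun t => Complex.exp _ • f t) h, ← integral_const_mul]
  congr 1
  ext t
  simp only [smul_eq_mul, ← mul_assoc, ← Complex.exp_add]
  congr 2
  push_cast
  ring

lemma lintegral_sq_fourier {f : ℝ → ℂ} (hf : Integrable f) (hf2 : MemLp f 2 volume) :
    ∫⁻ s, ‖𝓕 f s‖ₑ ^ 2 = ∫⁻ t, ‖f t‖ₑ ^ 2 := by
  have := congrArg (· ^ 2) (eLpNorm_fourier hf hf2)
  have e : ∀ φ : ℝ → ℂ, eLpNorm φ 2 volume ^ 2 = ∫⁻ s, ‖φ s‖ₑ ^ 2 := by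
    intro φ
    rw [eLpNorm_eq_lintegral_rpow_enorm_toReal (by norm_num) (by norm_num), ← ENNReal.rpow_two,
      ← ENNReal.rpow_mul]
    norm_num
  simpa only [e] using this

/-- The Fourier transform of a Sobolev function is square integrable with weight `s`. -/
lemma memLp_mul_fourier {f g : ℝ → ℂ} (hf : Integrable f) (hf2 : MemLp f 2 volume)
    (hg : MemLp g 2 volume) (hfg : ∀ a b : ℝ, f b - f a = ∫ t in a..b, g t) :
    MemLp (fun s : ℝ => (s : ℂ) * 𝓕 f s) 2 volume := by
  have hcF := continuous_fourier hf
  -- By Plancherel the difference quotients of step `1/(n+1)` have squared norm at most `‖g‖²`.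
  -- Their transforms converge pointwise to `2πis 𝓕 f s`, so Fatou's lemma suffices and `𝓕 g` need
  -- not be identified.
  have bound : ∀ n : ℕ, ∫⁻ s : ℝ, ‖(n + 1 : ℂ) * (Complex.exp (2 * Real.pi * I * (n + 1 : ℂ)⁻¹ * s) - 1)
      * 𝓕 f s‖ₑ ^ 2 ≤ ∫⁻ t, ‖g t‖ₑ ^ 2 := by
    intro n
    set h : ℝ := ((n : ℝ) + 1)⁻¹ with hdef
    have hh : 0 < h := by positivity
    have e1 : ∀ s, 𝓕 (fun t => f (t + h) - f t) s
        = (Complex.exp (2 * Real.pi * I * h * s) - 1) * 𝓕 f s := by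
      intro s
      rw [sub_mul, one_mul, ← fourier_comp_add]
      exact fourier_sub_apply (hf.comp_add_right h) hf s
    have e2 := lintegral_sq_fourier ((hf.comp_add_right h).sub hf)
      ((hf2.comp_measurePreserving (measurePreserving_add_right volume h)).sub hf2)
    have e3 := eLpNorm_shift_sub_le hg hfg hh
    have e4 : ∫⁻ s : ℝ, ‖(Complex.exp (2 * Real.pi * I * h * s) - 1) * 𝓕 f s‖ₑ ^ 2 ≤
        ENNReal.ofReal h ^ 2 * ∫⁻ t, ‖g t‖ₑ ^ 2 := by
      refine le_trans (le_of_eq ?_) e3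
      rw [← show _ = ∫⁻ t, ‖f (t + h) - f t‖ₑ ^ 2 from e2]
      exact lintegral_congr fun s => by rw [← e1]; rfl
    have hn : ‖(n + 1 : ℂ)‖ₑ = ENNReal.ofReal (n + 1) := by
      rw [← ofReal_norm]
      congr 1
      have : ((n : ℂ) + 1) = ((n + 1 : ℝ) : ℂ) := by push_cast; rfl
      rw [this, norm_real, Real.norm_of_nonneg (by positivity)]
    have e5 : ENNReal.ofReal (n + 1) * ENNReal.ofReal h = 1 := by
      rw [← ENNReal.ofReal_mul (by positivity), hdef, mul_inv_cancel₀ (by positivity),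
        ENNReal.ofReal_one]
    have e6 : (n + 1 : ℂ)⁻¹ = (h : ℂ) := by rw [hdef]; push_cast; rfl
    simp only [mul_assoc ((n : ℂ) + 1), e6]
    simp only [enorm_mul (n + 1 : ℂ), hn, mul_pow]
    rw [lintegral_const_mul' _ _ (by finiteness)]
    calc _ ≤ ENNReal.ofReal (n + 1) ^ 2 * (ENNReal.ofReal h ^ 2 * ∫⁻ t, ‖g t‖ₑ ^ 2) := by gcongr
      _ = _ := by rw [← mul_assoc, ← mul_pow, e5, one_pow, one_mul]
  have lim : ∀ s : ℝ, Tendsto (fun n : ℕ => ‖(n + 1 : ℂ) *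
      (Complex.exp (2 * Real.pi * I * (n + 1 : ℂ)⁻¹ * s) - 1) * 𝓕 f s‖ₑ ^ 2) atTop
      (𝓝 (‖(2 * Real.pi * I * s) * 𝓕 f s‖ₑ ^ 2)) := by
    intro s
    have hd : HasDerivAt (fun h : ℂ => Complex.exp (2 * Real.pi * I * s * h))
        (2 * Real.pi * I * s) 0 := by
      have := ((hasDerivAt_id (0 : ℂ)).const_mul (2 * Real.pi * I * s)).cexp
      simpa using this
    rw [hasDerivAt_iff_tendsto_slope] at hd
    have hs : Tendsto (fun n : ℕ => ((n : ℂ) + 1)⁻¹) atTop (𝓝[≠] 0) := by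
      refine tendsto_nhdsWithin_iff.2 ⟨?_, Eventually.of_forall fun n => ?_⟩
      · have := tendsto_one_div_add_atTop_nhds_zero_nat (𝕜 := ℂ)
        simpa using this
      · exact inv_ne_zero (by exact_mod_cast Nat.succ_ne_zero n)
    have h1 := hd.comp hs
    have h2 : Tendsto (fun n : ℕ => (n + 1 : ℂ) *
        (Complex.exp (2 * Real.pi * I * (n + 1 : ℂ)⁻¹ * s) - 1)) atTop
        (𝓝 (2 * Real.pi * I * s)) := by
      refine h1.congr fun n => ?_
      simp only [Function.comp, slope_def_field, mul_zero, Complex.exp_zero, sub_zero]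
      rw [div_inv_eq_mul, mul_comm]
      ring_nf
    exact ENNReal.Tendsto.pow ((h2.mul_const _).enorm)
  have fatou : ∫⁻ s : ℝ, ‖(2 * Real.pi * I * s) * 𝓕 f s‖ₑ ^ 2 ≤ ∫⁻ t, ‖g t‖ₑ ^ 2 := by
    calc _ = ∫⁻ s : ℝ, liminf (fun n : ℕ => ‖(n + 1 : ℂ) *
      (Complex.exp (2 * Real.pi * I * (n + 1 : ℂ)⁻¹ * s) - 1) * 𝓕 f s‖ₑ ^ 2) atTop :=
          lintegral_congr fun s => (lim s).liminf_eq.symm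
      _ ≤ liminf (fun n : ℕ => ∫⁻ s : ℝ, ‖(n + 1 : ℂ) *
      (Complex.exp (2 * Real.pi * I * (n + 1 : ℂ)⁻¹ * s) - 1) * 𝓕 f s‖ₑ ^ 2) atTop := by
          apply lintegral_liminf_le
          intro n
          have : Continuous fun s : ℝ => (n + 1 : ℂ) *
            (Complex.exp (2 * Real.pi * I * (n + 1 : ℂ)⁻¹ * s) - 1) * 𝓕 f s := by fun_prop
          exact this.measurable.enorm.pow_const 2
      _ ≤ _ := liminf_le_of_le (by isBoundedDefault) fun b hb => by
          obtain ⟨n, hn⟩ := hb.exists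
          exact hn.trans (bound n)
  have hfin : MemLp (fun s : ℝ => (2 * Real.pi * I * s) * 𝓕 f s) 2 volume := by
    have hc : Continuous (fun s : ℝ => (2 * Real.pi * I * s) * 𝓕 f s) := by fun_prop
    refine ⟨hc.aestronglyMeasurable, ?_⟩
    rw [eLpNorm_lt_top_iff_lintegral_rpow_enorm_lt_top (by norm_num) (by norm_num)]
    have := hg.2
    rw [eLpNorm_lt_top_iff_lintegral_rpow_enorm_lt_top (by norm_num) (by norm_num)] at this
    simp only [ENNReal.toReal_ofNat, ENNReal.rpow_two] at this ⊢
    exact fatou.trans_lt this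
  refine (hfin.const_mul (2 * Real.pi * I : ℂ)⁻¹).ae_eq (ae_of_all _ fun s => ?_)
  have : (2 * Real.pi * I : ℂ) ≠ 0 := two_pi_I_ne_zero
  simp only
  rw [mul_assoc (2 * Real.pi * I : ℂ), inv_mul_cancel_left₀ this]

/-- The properties of a reflection coefficient that are used in the construction. -/
structure IsRegular (f : ℝ → ℂ) : Prop where
  continuous : Continuous f
  memLp : MemLp (fun t : ℝ => ((1 + |t| : ℝ) : ℂ) * f t) 2 volume
  memLp_fourier : MemLp (fun s : ℝ => ((1 + |s| : ℝ) : ℂ) * 𝓕 f s) 2 volume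

lemma IsRegular.integrable {f : ℝ → ℂ} (h : IsRegular f) : Integrable f :=
  integrable_of_one_add_abs h.memLp

lemma IsRegular.integrable_fourier {f : ℝ → ℂ} (h : IsRegular f) : Integrable (𝓕 f) :=
  integrable_of_one_add_abs h.memLp_fourier

/-- From here on the weak derivative survives only as the decay of `𝓕 f`, the form in which it is
needed for Hankel symbols. -/
lemma MemH11.isRegular {f : ℝ → ℂ} (h : MemH11 f) : IsRegular f := by
  have hc := h.continuous
  have h1 := memLp_one_add_abs_mul hc h.2
  have hi := integrable_of_one_add_abs h1
  obtain ⟨⟨g, hg, hfg⟩, -⟩ := h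
  exact ⟨hc, h1, memLp_one_add_abs_mul (continuous_fourier hi)
    (memLp_mul_fourier hi (memLp_of_one_add_abs hc.aestronglyMeasurable h1) hg hfg)⟩

lemma fourier_add_apply {f g : ℝ → ℂ} (hf : Integrable f) (hg : Integrable g) (s : ℝ) :
    𝓕 (fun t => f t + g t) s = 𝓕 f s + 𝓕 g s := by
  simp only [Real.fourier_real_eq_integral_exp_smul]
  rw [← integral_add (integrable_exp_smul hf s) (integrable_exp_smul hg s)]
  simp only [smul_add]

lemma fourier_const_mul_apply {f : ℝ → ℂ} (c : ℂ) (s : ℝ) :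
    𝓕 (fun t => c * f t) s = c * 𝓕 f s := by
  simp only [Real.fourier_real_eq_integral_exp_smul, smul_eq_mul]
  rw [← integral_const_mul]
  congr 1
  ext t
  ring

lemma fourier_modulate (f : ℝ → ℂ) (x s : ℝ) :
    𝓕 (fun t : ℝ => Complex.exp (2 * I * x * t) * f t) s = 𝓕 f (s - x / Real.pi) := by
  simp only [Real.fourier_real_eq_integral_exp_smul, smul_eq_mul]
  congr 1
  ext t
  rw [← mul_assoc, ← Complex.exp_add]
  congr 2
  have : (Real.pi : ℂ) ≠ 0 := by exact_mod_cast Real.pi_ne_zero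
  push_cast
  field_simp
  ring

lemma fourier_conj (f : ℝ → ℂ) (s : ℝ) :
    𝓕 (fun t => conj (f t)) s = conj (𝓕 f (-s)) := by
  simp only [Real.fourier_real_eq_integral_exp_smul, smul_eq_mul]
  rw [← integral_conj]
  congr 1
  ext t
  rw [map_mul, ← Complex.exp_conj, map_mul, conj_I, conj_ofReal]
  congr 2
  push_cast
  ring

lemma IsRegular.add {f g : ℝ → ℂ} (hf : IsRegular f) (hg : IsRegular g) :
    IsRegular fun t => f t + g t := by
  refine ⟨hf.continuous.add hg.continuous, (hf.memLp.add hg.memLp).ae_eq ?_,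
    (hf.memLp_fourier.add hg.memLp_fourier).ae_eq ?_⟩
  · exact ae_of_all _ fun t => by simp only [Pi.add_apply, mul_add]
  · exact ae_of_all _ fun t => by
      simp only [Pi.add_apply, mul_add, fourier_add_apply hf.integrable hg.integrable]

lemma IsRegular.const_mul {f : ℝ → ℂ} (hf : IsRegular f) (c : ℂ) :
    IsRegular fun t => c * f t := by
  refine ⟨continuous_const.mul hf.continuous, (hf.memLp.const_mul c).ae_eq ?_,
    (hf.memLp_fourier.const_mul c).ae_eq ?_⟩
  · exact ae_of_all _ fun t => by ring
  · exact ae_of_all _ fun t => by simp only [fourier_const_mul_apply]; ring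

lemma isRegular_zero : IsRegular fun _ => 0 := by
  have h : 𝓕 (fun _ : ℝ => (0 : ℂ)) = fun _ => 0 := by
    ext s; simp [Real.fourier_real_eq_integral_exp_smul]
  refine ⟨continuous_const, ?_, ?_⟩ <;> simp [h]

lemma IsRegular.sum {ι : Type*} (S : Finset ι) {f : ι → ℝ → ℂ} (hf : ∀ i ∈ S, IsRegular (f i)) :
    IsRegular fun t => ∑ i ∈ S, f i t := by
  classical
  induction S using Finset.induction_on with
  | empty => simpa using isRegular_zero
  | insert a S ha ih =>
    simp only [Finset.sum_insert ha]
    exact (hf a (by simp)).add (ih fun i hi => hf i (by simp [hi]))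

/-- The phase `e^{2ixt}` translates the transform by `a = x/π`, and the weight tolerates
translations: `1 + |s| ≤ (1 + |a|)(1 + |s - a|)`. -/
lemma IsRegular.modulate {f : ℝ → ℂ} (hf : IsRegular f) (x : ℝ) :
    IsRegular fun t : ℝ => Complex.exp (2 * I * x * t) * f t := by
  have hcf := continuous_fourier hf.integrable
  have hn : ∀ t : ℝ, ‖Complex.exp (2 * I * x * t)‖ = 1 := fun t => by
    rw [show 2 * I * x * t = ((2 * x * t : ℝ) : ℂ) * I by push_cast; ring]
    exact Complex.norm_exp_ofReal_mul_I _
  have hc : Continuous fun t : ℝ => Complex.exp (2 * I * x * t) * f t :=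
    Continuous.mul (by fun_prop) hf.continuous
  refine ⟨hc, hf.memLp.mono ?_ (ae_of_all _ fun t => ?_), ?_⟩
  · exact ((continuous_ofReal.comp (continuous_const.add continuous_abs)).mul hc).aestronglyMeasurable
  · rw [norm_mul, norm_mul, hn, one_mul, norm_mul]
  · simp only [fourier_modulate]
    have h1 := (hf.memLp_fourier.comp_measurePreserving
      (measurePreserving_sub_right volume (x / Real.pi))).const_mul ((1 + |x / Real.pi| : ℝ) : ℂ)
    refine h1.mono ?_ (ae_of_all _ fun s => ?_)
    · exact Continuous.aestronglyMeasurable (by fun_prop)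
    · simp only [Function.comp, norm_mul, norm_real, ← mul_assoc]
      gcongr
      rw [Real.norm_of_nonneg (by positivity), Real.norm_of_nonneg (by positivity),
        Real.norm_of_nonneg (by positivity)]
      have : |s| ≤ |x / Real.pi| + |s - x / Real.pi| := by
        have := abs_add_le (x / Real.pi) (s - x / Real.pi); simpa using this
      nlinarith [abs_nonneg (x / Real.pi), abs_nonneg (s - x / Real.pi)]

lemma memLp_of_norm_le_one_add_abs_inv {f : ℝ → ℂ} (hf : Continuous f) (c : ℝ)
    (h : ∀ t, ‖f t‖ ≤ c * (1 + |t|)⁻¹) : MemLp f 2 volume :=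
  (memLp_one_add_abs_inv.const_mul c).mono hf.aestronglyMeasurable
    (ae_of_all _ fun t => (h t).trans (le_abs_self _))

/-- The difference of the Cauchy kernels at a nonreal point and its conjugate is regular. -/
lemma isRegular_pole {w : ℂ} (hw : 0 < w.im) :
    IsRegular fun t : ℝ => ((t : ℂ) - w)⁻¹ - ((t : ℂ) - conj w)⁻¹ := by
  have h1 : ∀ t : ℝ, (t : ℂ) - w ≠ 0 := fun t h => by
    have := congrArg Complex.im h; simp at this; exact hw.ne' this
  have h2 : ∀ t : ℝ, (t : ℂ) - conj w ≠ 0 := fun t h => by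
    have := congrArg Complex.im h; simp at this; exact hw.ne' this
  have hn : ∀ t : ℝ, ‖(t : ℂ) - conj w‖ = ‖(t : ℂ) - w‖ := fun t => by
    rw [← Complex.norm_conj, map_sub, conj_conj, conj_ofReal]
  have hb : ∀ t : ℝ, w.im ≤ ‖(t : ℂ) - w‖ := fun t => by
    have := Complex.abs_im_le_norm ((t : ℂ) - w)
    simp only [sub_im, ofReal_im, zero_sub, abs_neg] at this
    exact (le_abs_self _).trans this
  -- Chosen so that `1 + |t| ≤ c |t - w|`, from `|t| ≤ |t - w| + |w|` and `Im w ≤ |t - w|`.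
  set c : ℝ := 1 + (1 + ‖w‖) / w.im with hc
  have hc0 : 0 < c := by positivity
  have hbd : ∀ t : ℝ, 1 + |t| ≤ c * ‖(t : ℂ) - w‖ := fun t => by
    have e1 : |t| ≤ ‖(t : ℂ) - w‖ + ‖w‖ := by
      have := norm_add_le ((t : ℂ) - w) w; simpa using this
    have e2 : 1 + ‖w‖ ≤ (1 + ‖w‖) / w.im * ‖(t : ℂ) - w‖ := by
      rw [div_mul_eq_mul_div, le_div_iff₀ hw]
      exact mul_le_mul_of_nonneg_left (hb t) (by positivity)
    rw [hc, add_mul, one_mul]; linarith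
  have hinv : ∀ t : ℝ, ‖(t : ℂ) - w‖⁻¹ ≤ c * (1 + |t|)⁻¹ := fun t => by
    rw [inv_le_iff_one_le_mul₀ (lt_of_lt_of_le hw (hb t)), mul_right_comm, ← div_eq_mul_inv,
      le_div_iff₀ (by positivity), one_mul]
    exact hbd t
  have hinvb : ∀ t : ℝ, ‖(t : ℂ) - w‖⁻¹ ≤ w.im⁻¹ := fun t => inv_anti₀ hw (hb t)
  have hcts : Continuous fun t : ℝ => ((t : ℂ) - w)⁻¹ - ((t : ℂ) - conj w)⁻¹ :=
    ((continuous_ofReal.sub continuous_const).inv₀ h1).sub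
      ((continuous_ofReal.sub continuous_const).inv₀ h2)
  have hcts' : Continuous fun t : ℝ => -((t : ℂ) - w)⁻¹ ^ 2 + ((t : ℂ) - conj w)⁻¹ ^ 2 :=
    ((((continuous_ofReal.sub continuous_const).inv₀ h1).pow 2).neg).add
      (((continuous_ofReal.sub continuous_const).inv₀ h2).pow 2)
  refine MemH11.isRegular ⟨⟨fun t : ℝ => -((t : ℂ) - w)⁻¹ ^ 2 + ((t : ℂ) - conj w)⁻¹ ^ 2,
    ?_, fun a b => ?_⟩, ?_⟩
  · refine memLp_of_norm_le_one_add_abs_inv hcts' (2 * w.im⁻¹ * c) fun t => ?_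
    refine (norm_add_le _ _).trans ?_
    simp only [norm_neg, norm_pow, norm_inv, hn]
    have := mul_le_mul (hinvb t) (hinv t) (by positivity) (by positivity)
    nlinarith
  · refine (intervalIntegral.integral_eq_sub_of_hasDerivAt
      (f := fun t : ℝ => ((t : ℂ) - w)⁻¹ - ((t : ℂ) - conj w)⁻¹) (fun t _ => ?_)
      (hcts'.intervalIntegrable _ _)).symm
    have e1 := (((hasDerivAt_id (t : ℂ)).sub_const w).inv (h1 t)).sub
      (((hasDerivAt_id (t : ℂ)).sub_const (conj w)).inv (h2 t))
    refine HasDerivAt.congr_deriv (f := fun t : ℝ => ((t : ℂ) - w)⁻¹ - ((t : ℂ) - conj w)⁻¹)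
      e1.comp_ofReal ?_
    simp only [id, inv_pow, neg_div, one_div, sub_neg_eq_add]
  -- The product form exhibits decay of order `t⁻²`. A single pole decays like `t⁻¹` and would fail
  -- the condition `t f ∈ L²`; this is why the conjugate pole is subtracted.
  · have e : ∀ t : ℝ, ((t : ℂ) - w)⁻¹ - ((t : ℂ) - conj w)⁻¹
        = (w - conj w) * ((t : ℂ) - w)⁻¹ * ((t : ℂ) - conj w)⁻¹ := fun t => by
      field_simp [h1 t, h2 t]
      ring
    refine memLp_of_norm_le_one_add_abs_inv (continuous_ofReal.mul hcts)
      (‖w - conj w‖ * c ^ 2) fun t => ?_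
    simp only [e, norm_mul, norm_inv, hn, norm_real, Real.norm_eq_abs]
    have h3 := mul_le_mul (hinv t) (hinv t) (by positivity) (by positivity)
    calc |t| * (‖w - conj w‖ * ‖(t : ℂ) - w‖⁻¹ * ‖(t : ℂ) - w‖⁻¹)
        = ‖w - conj w‖ * (|t| * (‖(t : ℂ) - w‖⁻¹ * ‖(t : ℂ) - w‖⁻¹)) := by ring
      _ ≤ ‖w - conj w‖ * ((1 + |t|) * (c * (1 + |t|)⁻¹ * (c * (1 + |t|)⁻¹))) := by
        gcongr; linarith
      _ = _ := by
        have : (1 + |t|) ≠ 0 := by positivity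
        field_simp

end ManakovRHP

/-! ### Fourier–Laplace transforms in the upper half plane -/

namespace ManakovRHP

open scoped FourierTransform

/-- The Fourier–Laplace transform `z ↦ ∫₀^∞ a(s) e^{2πisz} ds`. -/
noncomputable def laplaceUp (a : ℝ → ℂ) (z : ℂ) : ℂ :=
  ∫ s in Ioi (0 : ℝ), a s * Complex.exp (2 * Real.pi * I * s * z)

lemma norm_exp_two_pi (s : ℝ) (z : ℂ) :
    ‖Complex.exp (2 * Real.pi * I * s * z)‖ = Real.exp (-(2 * Real.pi * s * z.im)) := by
  rw [Complex.norm_exp]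
  congr 1
  have : 2 * Real.pi * I * s * z = ((2 * Real.pi * s : ℝ) : ℂ) * (I * z) := by push_cast; ring
  rw [this, re_ofReal_mul]
  simp

lemma norm_exp_two_pi_le {s : ℝ} (hs : 0 < s) {z : ℂ} (hz : 0 ≤ z.im) :
    ‖Complex.exp (2 * Real.pi * I * s * z)‖ ≤ 1 := by
  rw [norm_exp_two_pi, Real.exp_le_one_iff]
  have := Real.pi_pos
  have : 0 ≤ 2 * Real.pi * s * z.im := by positivity
  linarith

lemma aestronglyMeasurable_mul_exp {a : ℝ → ℂ} (ha : IntegrableOn a (Ioi 0)) (z : ℂ) :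
    AEStronglyMeasurable (fun s : ℝ => a s * Complex.exp (2 * Real.pi * I * s * z))
      (volume.restrict (Ioi 0)) := by
  have hc : Continuous fun s : ℝ => Complex.exp (2 * Real.pi * I * s * z) := by fun_prop
  exact ha.1.mul hc.aestronglyMeasurable

lemma norm_mul_exp_le (a : ℝ → ℂ) {z : ℂ} (hz : 0 ≤ z.im) :
    ∀ᵐ s : ℝ ∂(volume.restrict (Ioi 0)), ‖a s * Complex.exp (2 * Real.pi * I * s * z)‖ ≤ ‖a s‖ := by
  refine (ae_restrict_iff' measurableSet_Ioi).2 (ae_of_all _ fun s hs => ?_)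
  rw [norm_mul]
  exact mul_le_of_le_one_right (norm_nonneg _) (norm_exp_two_pi_le hs hz)

lemma integrableOn_mul_exp {a : ℝ → ℂ} (ha : IntegrableOn a (Ioi 0)) {z : ℂ} (hz : 0 ≤ z.im) :
    IntegrableOn (fun s : ℝ => a s * Complex.exp (2 * Real.pi * I * s * z)) (Ioi 0) :=
  Integrable.mono ha (aestronglyMeasurable_mul_exp ha z) (norm_mul_exp_le a hz)

lemma norm_laplaceUp_le {a : ℝ → ℂ} (ha : IntegrableOn a (Ioi 0)) {z : ℂ} (hz : 0 ≤ z.im) :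
    ‖laplaceUp a z‖ ≤ ∫ s in Ioi (0 : ℝ), ‖a s‖ :=
  norm_integral_le_of_norm_le ha.norm (norm_mul_exp_le a hz)

lemma laplaceUp_sub {a b : ℝ → ℂ} (ha : IntegrableOn a (Ioi 0)) (hb : IntegrableOn b (Ioi 0))
    {z : ℂ} (hz : 0 ≤ z.im) :
    laplaceUp (fun s => a s - b s) z = laplaceUp a z - laplaceUp b z := by
  rw [laplaceUp, laplaceUp, laplaceUp,
    ← integral_sub (integrableOn_mul_exp ha hz) (integrableOn_mul_exp hb hz)]
  simp only [sub_mul]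

lemma continuousOn_laplaceUp {a : ℝ → ℂ} (ha : IntegrableOn a (Ioi 0)) :
    ContinuousOn (laplaceUp a) {z | 0 ≤ z.im} := by
  refine continuousOn_of_dominated (bound := fun s => ‖a s‖)
    (fun z _ => aestronglyMeasurable_mul_exp ha z) (fun z hz => norm_mul_exp_le a hz) ha.norm ?_
  refine ae_of_all _ fun s => Continuous.continuousOn ?_
  fun_prop

lemma differentiableOn_laplaceUp {a : ℝ → ℂ} (ha : IntegrableOn a (Ioi 0)) :
    DifferentiableOn ℂ (laplaceUp a) {z | 0 < z.im} := by
  intro z hz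
  have hz' : 0 < z.im := hz
  have hpi := Real.pi_pos
  have hball : ∀ w ∈ Metric.ball z (z.im / 2), z.im / 2 < w.im := fun w hw => by
    have h1 := Complex.abs_im_le_norm (z - w)
    rw [Metric.mem_ball, dist_comm, dist_eq_norm] at hw
    have h2 := (le_abs_self _).trans h1
    rw [sub_im] at h2
    linarith
  -- The factor `2πs` from differentiation is absorbed by the exponential: on this ball `Im w > Im z
  -- / 2`, and `y ≤ e^y` gives `2πs e^{-2πs Im w} ≤ 2 / Im z`. No moment of `a` is required.
  have key := hasDerivAt_integral_of_dominated_loc_of_deriv_le (μ := volume.restrict (Ioi (0 : ℝ)))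
    (F := fun w s => a s * Complex.exp (2 * Real.pi * I * s * w))
    (F' := fun w s => a s * (Complex.exp (2 * Real.pi * I * s * w) * (2 * Real.pi * I * s)))
    (x₀ := z) (s := Metric.ball z (z.im / 2)) (bound := fun s => ‖a s‖ * (2 / z.im))
    (Metric.ball_mem_nhds z (by positivity))
    (Eventually.of_forall fun w => aestronglyMeasurable_mul_exp ha w)
    (integrableOn_mul_exp ha hz'.le) ?_ ?_ (ha.norm.mul_const _) ?_
  · exact key.2.differentiableAt.differentiableWithinAt
  · have hc : Continuous fun s : ℝ => Complex.exp (2 * Real.pi * I * s * z) * (2 * Real.pi * I * s) := by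
      fun_prop
    exact ha.1.mul hc.aestronglyMeasurable
  · refine (ae_restrict_iff' measurableSet_Ioi).2 (ae_of_all _ fun s hs w hw => ?_)
    have hs' : 0 < s := hs
    rw [norm_mul, norm_mul, norm_exp_two_pi]
    refine mul_le_mul_of_nonneg_left ?_ (norm_nonneg _)
    have e1 : ‖(2 * Real.pi * I * s : ℂ)‖ = 2 * Real.pi * s := by
      simp [abs_of_pos hs', abs_of_pos hpi]
    rw [e1, Real.exp_neg, inv_mul_le_iff₀ (Real.exp_pos _)]
    have h3 := hball w hw
    have h4 := Real.add_one_le_exp (2 * Real.pi * s * w.im)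
    have h5 : 2 * Real.pi * s * (z.im / 2) ≤ Real.exp (2 * Real.pi * s * w.im) := by
      have := mul_le_mul_of_nonneg_left h3.le (by positivity : 0 ≤ 2 * Real.pi * s)
      linarith
    calc 2 * Real.pi * s = 2 * Real.pi * s * (z.im / 2) * (2 / z.im) := by field_simp
      _ ≤ _ := by gcongr
  · refine ae_of_all _ fun s w _ => ?_
    have := (((hasDerivAt_id w).const_mul (2 * Real.pi * I * s : ℂ)).cexp).const_mul (a s)
    simpa using this

/-- The Fourier–Laplace transform of a smooth compactly supported function is `O(1/z)`. -/
lemma norm_mul_laplaceUp_le {g : ℝ → ℂ} (hg : ContDiff ℝ 1 g) (hgc : HasCompactSupport g)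
    {z : ℂ} (hz : 0 ≤ z.im) :
    2 * Real.pi * ‖z‖ * ‖laplaceUp g z‖ ≤ ‖g 0‖ + ∫ s in Ioi (0 : ℝ), ‖deriv g s‖ := by
  have hgi : IntegrableOn g (Ioi 0) := (hg.continuous.integrable_of_hasCompactSupport hgc).integrableOn
  have hg'c : Continuous (deriv g) := hg.continuous_deriv le_rfl
  have hg'i : IntegrableOn (deriv g) (Ioi 0) :=
    (hg'c.integrable_of_hasCompactSupport hgc.deriv).integrableOn
  have e : Continuous fun s : ℝ => Complex.exp (2 * Real.pi * I * s * z) := by fun_prop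
  have hd : ∀ s ∈ Ici (0 : ℝ), HasDerivAt (fun s : ℝ => g s * Complex.exp (2 * Real.pi * I * s * z))
      (deriv g s * Complex.exp (2 * Real.pi * I * s * z)
        + 2 * Real.pi * I * z * (g s * Complex.exp (2 * Real.pi * I * s * z))) s := by
    intro s _
    have h1 := ((hg.differentiable one_ne_zero) s).hasDerivAt
    have h2 : HasDerivAt (fun s : ℝ => Complex.exp (2 * Real.pi * I * s * z))
        (Complex.exp (2 * Real.pi * I * s * z) * (2 * Real.pi * I * z)) s := by
      have := (((hasDerivAt_id (s : ℂ)).const_mul (2 * Real.pi * I : ℂ)).mul_const z).cexp.comp_ofReal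
      simpa using this
    refine (h1.mul h2).congr_deriv ?_
    ring
  have h0 : Tendsto (fun s : ℝ => g s * Complex.exp (2 * Real.pi * I * s * z)) atTop (𝓝 0) := by
    have hcs : HasCompactSupport fun s : ℝ => g s * Complex.exp (2 * Real.pi * I * s * z) :=
      hgc.mul_right
    exact (hcs.is_zero_at_infty).mono_left atTop_le_cocompact
  have h1 := integrableOn_mul_exp hg'i hz
  have h2 := (integrableOn_mul_exp hgi hz).const_mul (2 * Real.pi * I * z)
  -- Integration by parts on the half line, with boundary term `-g 0`.
  have h3 := integral_Ioi_of_hasDerivAt_of_tendsto' hd (h1.add h2) h0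
  rw [integral_add h1 h2, integral_const_mul] at h3
  have h4 : 2 * Real.pi * I * z * laplaceUp g z = -g 0 - laplaceUp (deriv g) z := by
    rw [laplaceUp, laplaceUp, eq_sub_iff_add_eq', h3]
    simp
  have h5 : ‖2 * Real.pi * I * z * laplaceUp g z‖ = 2 * Real.pi * ‖z‖ * ‖laplaceUp g z‖ := by
    simp [abs_of_pos Real.pi_pos]
  rw [← h5, h4]
  refine (norm_sub_le _ _).trans ?_
  rw [norm_neg]
  gcongr
  exact norm_laplaceUp_le hg'i hz

/-- A Riemann–Lebesgue lemma, uniform in the closed upper half plane. -/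
lemma tendsto_laplaceUp {a : ℝ → ℂ} (ha : IntegrableOn a (Ioi 0)) :
    Tendsto (laplaceUp a) (cobounded ℂ ⊓ 𝓟 {z | 0 ≤ z.im}) (𝓝 0) := by
  rw [Metric.tendsto_nhds]
  intro ε hε
  have hm : MemLp ((Ioi (0 : ℝ)).indicator a) 1 volume :=
    memLp_one_iff_integrable.2 (ha.integrable_indicator measurableSet_Ioi)
  -- The transform is bounded by the `L¹` norm uniformly in the closed half plane, so it suffices to
  -- approximate by test functions. These need not vanish at `0`: the boundary term is still
  -- `O(1/z)`.
  obtain ⟨g, hgc, hg, hgε⟩ := hm.exist_eLpNorm_sub_le (by norm_num) le_rfl (half_pos hε)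
  have hgi : Integrable g := hg.continuous.integrable_of_hasCompactSupport hgc
  have hclose : ∫ s in Ioi (0 : ℝ), ‖a s - g s‖ ≤ ε / 2 := by
    have h1 : Integrable ((Ioi (0 : ℝ)).indicator a - g) :=
      (ha.integrable_indicator measurableSet_Ioi).sub hgi
    have h2 : ∫ s, ‖((Ioi (0 : ℝ)).indicator a - g) s‖ ≤ ε / 2 := by
      rw [integral_norm_eq_lintegral_enorm h1.1, ← eLpNorm_one_eq_lintegral_enorm]
      exact ENNReal.toReal_le_of_le_ofReal (by positivity) hgε
    calc ∫ s in Ioi (0 : ℝ), ‖a s - g s‖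
        = ∫ s in Ioi (0 : ℝ), ‖((Ioi (0 : ℝ)).indicator a - g) s‖ := by
          refine setIntegral_congr_fun measurableSet_Ioi fun s hs => ?_
          simp only [Pi.sub_apply, indicator_of_mem hs]
      _ ≤ ∫ s, ‖((Ioi (0 : ℝ)).indicator a - g) s‖ :=
          setIntegral_le_integral h1.norm (ae_of_all _ fun s => norm_nonneg _)
      _ ≤ _ := h2
  set C := ‖g 0‖ + ∫ s in Ioi (0 : ℝ), ‖deriv g s‖
  have hlarge : ∀ᶠ z : ℂ in cobounded ℂ, C / (ε / 2) + 1 ≤ ‖z‖ :=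
    tendsto_norm_cobounded_atTop.eventually_ge_atTop _
  filter_upwards [mem_inf_of_left hlarge, mem_inf_of_right (mem_principal_self _)] with z hz1 hz2
  have hC : 0 ≤ C := by positivity
  have hz0 : 0 < ‖z‖ := lt_of_lt_of_le (by positivity) hz1
  have h1 := norm_mul_laplaceUp_le (hg.of_le (by exact_mod_cast le_top)) hgc hz2
  have h2 : ‖laplaceUp g z‖ < ε / 2 := by
    by_contra hcon
    rw [not_lt] at hcon
    have hpi := Real.two_le_pi
    have h3 : C < ‖z‖ * (ε / 2) := by
      have : C / (ε / 2) < ‖z‖ := by linarith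
      rwa [div_lt_iff₀ (by positivity)] at this
    have h4 : ‖z‖ * (ε / 2) ≤ 2 * Real.pi * ‖z‖ * ‖laplaceUp g z‖ := by
      have h6 : ‖z‖ * (ε / 2) ≤ ‖z‖ * ‖laplaceUp g z‖ := by gcongr
      have h7 : 0 ≤ ‖z‖ * ‖laplaceUp g z‖ := by positivity
      nlinarith
    linarith
  have h3 := norm_laplaceUp_le (ha.sub hgi.integrableOn) hz2
  have h4 := laplaceUp_sub ha hgi.integrableOn hz2
  rw [dist_zero_right]
  have h5 : laplaceUp a z = laplaceUp (fun s => a s - g s) z + laplaceUp g z := by rw [h4]; ring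
  calc ‖laplaceUp a z‖ ≤ ‖laplaceUp (fun s => a s - g s) z‖ + ‖laplaceUp g z‖ := by
        rw [h5]; exact norm_add_le _ _
    _ ≤ ε / 2 + ‖laplaceUp g z‖ := by
        gcongr
        exact h3.trans hclose
    _ < ε := by linarith

lemma integral_exp_Ioi {w : ℂ} (hw : 0 < w.im) :
    ∫ s in Ioi (0 : ℝ), Complex.exp (2 * Real.pi * I * s * w) = -(2 * Real.pi * I * w)⁻¹ := by
  have h := integral_exp_mul_complex_Ioi (a := 2 * Real.pi * I * w) (by
    have : 2 * Real.pi * I * w = ((2 * Real.pi : ℝ) : ℂ) * (I * w) := by push_cast; ring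
    rw [this, re_ofReal_mul]
    have := Real.pi_pos
    simp
    positivity) 0
  simp only [ofReal_zero, mul_zero, Complex.exp_zero] at h
  rw [← one_div, ← neg_div, ← h]
  congr 1
  ext s
  ring_nf

/-- The Fourier–Laplace transform of a Fourier transform is a Cauchy integral. -/
lemma laplaceUp_fourier {φ : ℝ → ℂ} (hφ : Integrable φ) {z : ℂ} (hz : 0 < z.im) :
    laplaceUp (𝓕 φ) z = ∫ t, φ t * -(2 * Real.pi * I * (z - t))⁻¹ := by
  have hexp : IntegrableOn (fun s : ℝ => Complex.exp (2 * Real.pi * I * s * z)) (Ioi 0) := by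
    have := integrableOn_exp_mul_complex_Ioi (a := 2 * Real.pi * I * z) (by
      have : 2 * Real.pi * I * z = ((2 * Real.pi : ℝ) : ℂ) * (I * z) := by push_cast; ring
      rw [this, re_ofReal_mul]
      have := Real.pi_pos
      simp
      positivity) 0
    refine this.congr_fun (fun s _ => ?_) measurableSet_Ioi
    ring_nf
  have hint : Integrable (fun p : ℝ × ℝ => φ p.2 * (Complex.exp (2 * Real.pi * I * p.1 * (z - p.2))))
      ((volume.restrict (Ioi 0)).prod volume) := by
    have h1 := hexp.mul_prod hφ
    have hc : Continuous fun p : ℝ × ℝ => Complex.exp (↑(-2 * Real.pi * p.1 * p.2) * I) := by fun_prop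
    refine h1.congr' (((hφ.1.comp_snd).mul
      (Continuous.aestronglyMeasurable (by fun_prop)))) (ae_of_all _ fun p => ?_)
    rw [norm_mul, norm_mul, mul_comm, norm_exp_two_pi, norm_exp_two_pi]
    simp
  rw [laplaceUp]
  calc ∫ s in Ioi (0 : ℝ), 𝓕 φ s * Complex.exp (2 * Real.pi * I * s * z)
      = ∫ s in Ioi (0 : ℝ), ∫ t, φ t * Complex.exp (2 * Real.pi * I * s * (z - t)) := by
        refine integral_congr_ae (ae_of_all _ fun s => ?_)
        simp only [Real.fourier_real_eq_integral_exp_smul]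
        rw [← integral_mul_const]
        congr 1
        ext t
        rw [smul_eq_mul, mul_comm (Complex.exp _), mul_assoc, ← Complex.exp_add]
        congr 2
        push_cast
        ring
    _ = ∫ t, ∫ s in Ioi (0 : ℝ), φ t * Complex.exp (2 * Real.pi * I * s * (z - t)) :=
        integral_integral_swap hint
    _ = _ := by
        congr 1
        ext t
        rw [integral_const_mul, integral_exp_Ioi (by simpa using hz)]

/-- The Cauchy integral of a function with `(1 + |λ|) φ ∈ L²` is `O(1/z)` away from the line. -/
lemma isBigO_laplaceUp_fourier {φ : ℝ → ℂ} (hφ : Integrable φ)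
    (hφ2 : MemLp (fun t : ℝ => (t : ℂ) * φ t) 2 volume) {δ : ℝ} (hδ : 0 < δ) :
    laplaceUp (𝓕 φ) =O[cobounded ℂ ⊓ 𝓟 {w | δ ≤ w.im}] fun w => w⁻¹ := by
  have hcδ : Integrable fun t : ℝ => (t ^ 2 + δ ^ 2)⁻¹ := by
    have h1 := (integrable_inv_one_add_sq.comp_div hδ.ne').const_mul ((δ ^ 2)⁻¹)
    refine h1.congr (ae_of_all _ fun t => ?_)
    simp only
    rw [← mul_inv]
    congr 1
    field_simp
    ring
  set A := ∫ t, ‖φ t‖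
  set B := ∫ t : ℝ, ‖(t : ℂ) * φ t‖ ^ 2
  set D := ∫ t : ℝ, (t ^ 2 + δ ^ 2)⁻¹
  have hB : Integrable fun t : ℝ => ‖(t : ℂ) * φ t‖ ^ 2 := hφ2.integrable_norm_pow (by norm_num)
  refine IsBigO.of_bound (A + (B + D)) ?_
  filter_upwards [mem_inf_of_right (mem_principal_self _)] with z hz
  have hz' : δ ≤ z.im := hz
  have hz0 : 0 < z.im := hδ.trans_le hz'
  have hzn : 0 < ‖z‖ := hz0.trans_le ((le_abs_self _).trans (abs_im_le_norm z))
  rw [norm_inv, ← div_eq_mul_inv, le_div_iff₀ hzn, laplaceUp_fourier hφ hz0, ← norm_mul,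
    ← integral_mul_const]
  have hne : ∀ t : ℝ, z - t ≠ 0 := fun t h => by
    have := congrArg Complex.im h; simp at this; exact hz0.ne' this
  have hlow : ∀ t : ℝ, (t - z.re) ^ 2 + δ ^ 2 ≤ ‖z - t‖ ^ 2 := fun t => by
    rw [← normSq_eq_norm_sq, normSq_apply]
    simp
    nlinarith
  have hD : Integrable fun t : ℝ => ((t - z.re) ^ 2 + δ ^ 2)⁻¹ := hcδ.comp_sub_right z.re
  have hDe : ∫ t : ℝ, ((t - z.re) ^ 2 + δ ^ 2)⁻¹ = D :=
    integral_sub_right_eq_self (fun t : ℝ => (t ^ 2 + δ ^ 2)⁻¹) z.re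
  have hBD : Integrable fun t : ℝ => ‖(t : ℂ) * φ t‖ ^ 2 + ((t - z.re) ^ 2 + δ ^ 2)⁻¹ := hB.add hD
  have hsum : A + (B + D) = ∫ t : ℝ, (‖φ t‖ + (‖(t : ℂ) * φ t‖ ^ 2 + ((t - z.re) ^ 2 + δ ^ 2)⁻¹)) := by
    rw [integral_add hφ.norm hBD, integral_add hB hD, hDe]
  rw [hsum]
  refine norm_integral_le_of_norm_le (hφ.norm.add hBD) (ae_of_all _ fun t => ?_)
  have hpi : (1 : ℝ) ≤ 2 * Real.pi := by linarith [Real.two_le_pi]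
  -- Writing `z/(z - t) = 1 + t/(z - t)` moves the growth of `z` onto `φ`. The product of `tφ` and
  -- `(z - t)⁻¹` is then at most the sum of the two squares, and the integral of the second is
  -- bounded uniformly in `Re z`.
  have e1 : φ t * -(2 * Real.pi * I * (z - t))⁻¹ * z
      = -(2 * Real.pi * I)⁻¹ * (φ t + (t * φ t) * (z - t)⁻¹) := by
    have := hne t
    have hpi0 : (Real.pi : ℂ) ≠ 0 := by exact_mod_cast Real.pi_ne_zero
    field_simp
    ring
  have e2 : ‖-(2 * Real.pi * I : ℂ)⁻¹‖ ≤ 1 := by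
    rw [norm_neg, norm_inv]
    apply inv_le_one_of_one_le₀
    simpa [abs_of_pos Real.pi_pos] using hpi
  have e3 : ‖(z - t)⁻¹‖ ^ 2 ≤ ((t - z.re) ^ 2 + δ ^ 2)⁻¹ := by
    rw [norm_inv, inv_pow]
    exact inv_anti₀ (by positivity) (hlow t)
  rw [e1, norm_mul]
  calc _ ≤ 1 * ‖φ t + (t * φ t) * (z - t)⁻¹‖ := by gcongr
    _ ≤ ‖φ t‖ + ‖(t : ℂ) * φ t‖ * ‖(z - t)⁻¹‖ := by
      rw [one_mul, ← norm_mul]; exact norm_add_le _ _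
    _ ≤ _ := by
      gcongr
      nlinarith [sq_nonneg (‖(t : ℂ) * φ t‖ - ‖(z - t)⁻¹‖), sq_nonneg ‖(z - t)⁻¹‖,
        sq_nonneg ‖(t : ℂ) * φ t‖]

/-- Functions analytic in the upper half plane and continuous up to the boundary, with the decay
required of the entries of `M - I`. -/
structure IsDecaying (f : ℂ → ℂ) : Prop where
  continuousOn : ContinuousOn f {z | 0 ≤ z.im}
  differentiableOn : DifferentiableOn ℂ f {z | 0 < z.im}
  tendsto : Tendsto f (cobounded ℂ ⊓ 𝓟 {z | 0 ≤ z.im}) (𝓝 0)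
  isBigO : ∀ δ : ℝ, 0 < δ → f =O[cobounded ℂ ⊓ 𝓟 {w | δ ≤ w.im}] fun w => w⁻¹

lemma isDecaying_laplaceUp {φ : ℝ → ℂ} (hφ : Integrable φ) (hF : Integrable (𝓕 φ))
    (hφ2 : MemLp (fun t : ℝ => (t : ℂ) * φ t) 2 volume) : IsDecaying (laplaceUp (𝓕 φ)) :=
  ⟨continuousOn_laplaceUp hF.integrableOn, differentiableOn_laplaceUp hF.integrableOn,
    tendsto_laplaceUp hF.integrableOn, fun _ hδ => isBigO_laplaceUp_fourier hφ hφ2 hδ⟩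

lemma fourier_comp_neg (φ : ℝ → ℂ) : 𝓕 (fun t => φ (-t)) = fun s => 𝓕 φ (-s) := by
  ext s
  simp only [Real.fourier_real_eq_integral_exp_smul]
  rw [← integral_neg_eq_self]
  congr 1
  ext t
  simp

lemma IsDecaying.neg {f : ℂ → ℂ} (h : IsDecaying f) : IsDecaying fun z => -f z :=
  ⟨h.continuousOn.neg, h.differentiableOn.neg, by simpa using h.tendsto.neg,
    fun δ hδ => (h.isBigO δ hδ).neg_left⟩

lemma isDecaying_laplaceUp_neg {φ : ℝ → ℂ} (hφ : Integrable φ) (hF : Integrable (𝓕 φ))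
    (hφ2 : MemLp (fun t : ℝ => (t : ℂ) * φ t) 2 volume) :
    IsDecaying (laplaceUp fun s => 𝓕 φ (-s)) := by
  rw [← fourier_comp_neg]
  refine isDecaying_laplaceUp hφ.comp_neg (by rw [fourier_comp_neg]; exact hF.comp_neg) ?_
  have := (hφ2.comp_measurePreserving (Measure.measurePreserving_neg volume)).neg
  refine this.ae_eq (ae_of_all _ fun t => ?_)
  simp

/-- The additive jump problem on the real line. -/
lemma laplaceUp_add_laplaceUp_neg {φ : ℝ → ℂ} (hc : Continuous φ) (hφ : Integrable φ)
    (hF : Integrable (𝓕 φ)) (t : ℝ) :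
    laplaceUp (𝓕 φ) t + laplaceUp (fun s => 𝓕 φ (-s)) (-t) = φ t := by
  -- Fourier inversion, cut at frequency `0`: positive frequencies extend analytically to the upper
  -- half plane, negative ones to the lower.
  have h1 := congrFun (hc.fourierInv_fourier_eq hφ hF) t
  have hi : Integrable fun s : ℝ => 𝓕 φ s * Complex.exp (2 * Real.pi * I * s * t) := by
    refine hF.congr' (hF.1.mul (Continuous.aestronglyMeasurable (by fun_prop)))
      (ae_of_all _ fun s => ?_)
    rw [norm_mul, norm_exp_two_pi]
    simp
  have h2 : 𝓕⁻ (𝓕 φ) t = ∫ s : ℝ, 𝓕 φ s * Complex.exp (2 * Real.pi * I * s * t) := by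
    rw [Real.fourierInv_eq']
    congr 1
    ext s
    rw [smul_eq_mul, mul_comm]
    congr 2
    simp
    ring
  rw [← h1, h2, ← intervalIntegral.integral_Iic_add_Ioi hi.integrableOn hi.integrableOn (b := 0),
    add_comm]
  congr 1
  have := integral_comp_neg_Ioi (0 : ℝ) (fun s : ℝ => 𝓕 φ s * Complex.exp (2 * Real.pi * I * s * t))
  rw [neg_zero] at this
  rw [← this, laplaceUp]
  congr 1
  ext s
  congr 2
  push_cast
  ring

end ManakovRHP

/-! ### Hankel operators and the Marchenko system -/

namespace ManakovRHP

open scoped FourierTransform InnerProductSpace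

/-- Lebesgue measure on the half line `(0, ∞)`. -/
noncomputable abbrev halfLine : Measure ℝ := volume.restrict (Ioi 0)

/-- Admissible symbols of Hankel operators. -/
structure IsSymbol (f : ℝ → ℂ) : Prop where
  continuous : Continuous f
  memLp : MemLp (fun s : ℝ => ((1 + |s| : ℝ) : ℂ) * f s) 2 volume

lemma IsSymbol.conj {f : ℝ → ℂ} (h : IsSymbol f) : IsSymbol fun s => conj (f s) := by
  have hc : Continuous fun s => conj (f s) := continuous_conj.comp h.continuous
  refine ⟨hc, h.memLp.mono ?_ (ae_of_all _ fun s => ?_)⟩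
  · exact Continuous.aestronglyMeasurable (by fun_prop)
  · simp

lemma IsSymbol.memLp_self {f : ℝ → ℂ} (h : IsSymbol f) : MemLp f 2 halfLine :=
  (memLp_of_one_add_abs h.continuous.aestronglyMeasurable h.memLp).restrict _

lemma IsSymbol.integrable {f : ℝ → ℂ} (h : IsSymbol f) : Integrable f :=
  integrable_of_one_add_abs h.memLp

/-- The Hankel operator `v ↦ ∫₀^∞ f(s + t) v(t) dt`. -/
noncomputable def hankel (f v : ℝ → ℂ) (s : ℝ) : ℂ := ∫ t in Ioi (0 : ℝ), f (s + t) * v t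

/-- The weighted norm of a Hankel symbol. -/
noncomputable def symbolNorm (f : ℝ → ℂ) : ℝ :=
  (eLpNorm (fun s : ℝ => ((1 + |s| : ℝ) : ℂ) * f s) 2 volume).toReal

lemma hankel_congr {f v w : ℝ → ℂ} (h : v =ᵐ[halfLine] w) : hankel f v = hankel f w := by
  ext s
  refine integral_congr_ae ?_
  filter_upwards [h] with t ht
  rw [ht]

section
variable {f v : ℝ → ℂ}

lemma IsSymbol.memLp_shift (hf : IsSymbol f) (s : ℝ) : MemLp (fun t => f (s + t)) 2 halfLine :=
  ((memLp_of_one_add_abs hf.continuous.aestronglyMeasurable hf.memLp).comp_measurePreserving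
    (measurePreserving_add_left volume s)).restrict _

/-- For positive `s, t` the weight at `s + t` is at least `1 + s` and can be pulled out. The
resulting bound `O(1/(1 + s))` for `hankel f v` yields boundedness on `L²`, Fubini and the later
`L¹` estimates. -/
lemma IsSymbol.eLpNorm_shift_le (hf : IsSymbol f) {s : ℝ} (hs : 0 < s) :
    (eLpNorm (fun t => f (s + t)) 2 halfLine).toReal ≤ (1 + s)⁻¹ * symbolNorm f := by
  have h1 : eLpNorm (fun t => f (s + t)) 2 halfLine ≤ ENNReal.ofReal (1 + s)⁻¹ *
      eLpNorm (fun t : ℝ => ((1 + |s + t| : ℝ) : ℂ) * f (s + t)) 2 halfLine := by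
    refine eLpNorm_le_mul_eLpNorm_of_ae_le_mul
      ((ae_restrict_iff' measurableSet_Ioi).2 (ae_of_all _ fun t ht => ?_)) 2
    have ht' : 0 < t := ht
    rw [norm_mul, norm_real, Real.norm_of_nonneg (by positivity), ← mul_assoc]
    refine le_mul_of_one_le_left (norm_nonneg _) ?_
    rw [le_inv_mul_iff₀ (by positivity), mul_one, abs_of_pos (by positivity)]
    linarith
  have h2 : eLpNorm (fun t : ℝ => ((1 + |s + t| : ℝ) : ℂ) * f (s + t)) 2 halfLine ≤
      eLpNorm (fun s : ℝ => ((1 + |s| : ℝ) : ℂ) * f s) 2 volume := by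
    refine (eLpNorm_mono_measure _ Measure.restrict_le_self).trans (le_of_eq ?_)
    exact eLpNorm_comp_measurePreserving (g := fun s : ℝ => ((1 + |s| : ℝ) : ℂ) * f s)
      hf.memLp.1 (measurePreserving_add_left volume s)
  have h3 := ENNReal.toReal_mono (by
    have := hf.memLp.eLpNorm_ne_top
    finiteness) (h1.trans (mul_le_mul_right h2 _))
  rwa [ENNReal.toReal_mul, ENNReal.toReal_ofReal (by positivity)] at h3

lemma IsSymbol.integrable_shift_mul (hf : IsSymbol f) (hv : MemLp v 2 halfLine) (s : ℝ) :
    Integrable (fun t => f (s + t) * v t) halfLine :=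
  (hf.memLp_shift s).integrable_mul hv

lemma IsSymbol.integral_norm_le (hf : IsSymbol f) (hv : MemLp v 2 halfLine) {s : ℝ} (hs : 0 < s) :
    ∫ t in Ioi (0 : ℝ), ‖f (s + t) * v t‖ ≤
      (1 + s)⁻¹ * symbolNorm f * (eLpNorm v 2 halfLine).toReal := by
  rw [integral_norm_eq_lintegral_enorm (hf.integrable_shift_mul hv s).1,
    ← eLpNorm_one_eq_lintegral_enorm]
  have h1 := eLpNorm_smul_le_mul_eLpNorm (p := 2) (q := 2) (r := 1) hv.1 (hf.memLp_shift s).1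
  have h2 := ENNReal.toReal_mono (by
    have := hv.eLpNorm_ne_top
    have := (hf.memLp_shift s).eLpNorm_ne_top
    finiteness) h1
  rw [ENNReal.toReal_mul] at h2
  refine h2.trans ?_
  gcongr
  exact hf.eLpNorm_shift_le hs

lemma IsSymbol.norm_hankel_le (hf : IsSymbol f) (hv : MemLp v 2 halfLine) {s : ℝ} (hs : 0 < s) :
    ‖hankel f v s‖ ≤ symbolNorm f * (eLpNorm v 2 halfLine).toReal * (1 + s)⁻¹ := by
  refine (norm_integral_le_integral_norm _).trans ((hf.integral_norm_le hv hs).trans (le_of_eq ?_))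
  ring

lemma IsSymbol.aestronglyMeasurable_prod (hf : IsSymbol f) (hv : AEStronglyMeasurable v halfLine) :
    AEStronglyMeasurable (fun p : ℝ × ℝ => f (p.1 + p.2) * v p.2) (halfLine.prod halfLine) := by
  have hc : Continuous fun p : ℝ × ℝ => f (p.1 + p.2) :=
    hf.continuous.comp (continuous_fst.add continuous_snd)
  exact hc.aestronglyMeasurable.mul hv.comp_snd

lemma IsSymbol.aestronglyMeasurable_hankel (hf : IsSymbol f) (hv : MemLp v 2 halfLine) :
    AEStronglyMeasurable (hankel f v) halfLine :=
  (hf.aestronglyMeasurable_prod hv.1).integral_prod_right'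

lemma IsSymbol.memLp_hankel (hf : IsSymbol f) (hv : MemLp v 2 halfLine) :
    MemLp (hankel f v) 2 halfLine := by
  refine ((memLp_one_add_abs_inv.restrict (Ioi 0)).const_mul
    (symbolNorm f * (eLpNorm v 2 halfLine).toReal)).mono (hf.aestronglyMeasurable_hankel hv)
    ((ae_restrict_iff' measurableSet_Ioi).2 (ae_of_all _ fun s hs => ?_))
  refine (hf.norm_hankel_le hv hs).trans ((le_abs_self _).trans (le_of_eq ?_))
  rw [abs_of_pos (mem_Ioi.1 hs), Real.norm_eq_abs]

/-- The Hankel operator on `L²(0, ∞)`. -/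
noncomputable def hankelCLM (hf : IsSymbol f) : Lp ℂ 2 halfLine →L[ℂ] Lp ℂ 2 halfLine :=
  LinearMap.mkContinuous
    { toFun := fun v => (hf.memLp_hankel (Lp.memLp v)).toLp _
      map_add' := fun v w => by
        rw [← MemLp.toLp_add]
        refine MemLp.toLp_congr _ _ (ae_of_all _ fun s => ?_)
        rw [hankel_congr (Lp.coeFn_add v w), Pi.add_apply, hankel, hankel, hankel,
          ← integral_add (hf.integrable_shift_mul (Lp.memLp v) s)
            (hf.integrable_shift_mul (Lp.memLp w) s)]
        simp only [Pi.add_apply, mul_add]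
      map_smul' := fun c v => by
        rw [RingHom.id_apply, ← MemLp.toLp_const_smul]
        refine MemLp.toLp_congr _ _ (ae_of_all _ fun s => ?_)
        rw [hankel_congr (Lp.coeFn_smul c v), Pi.smul_apply, hankel, hankel, smul_eq_mul,
          ← integral_const_mul]
        simp only [Pi.smul_apply, smul_eq_mul]
        congr 1
        ext t
        ring }
    (symbolNorm f * (eLpNorm (fun s : ℝ => (1 + |s|)⁻¹) 2 halfLine).toReal) fun v => by
      have h1 : eLpNorm (hankel f v) 2 halfLine ≤
          ENNReal.ofReal (symbolNorm f * (eLpNorm v 2 halfLine).toReal) *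
            eLpNorm (fun s : ℝ => (1 + |s|)⁻¹) 2 halfLine := by
        refine eLpNorm_le_mul_eLpNorm_of_ae_le_mul
          ((ae_restrict_iff' measurableSet_Ioi).2 (ae_of_all _ fun s hs => ?_)) 2
        refine (hf.norm_hankel_le (Lp.memLp v) hs).trans (le_of_eq ?_)
        have hs' : 0 < s := hs
        rw [abs_of_pos hs', Real.norm_of_nonneg (by positivity)]
      have h2 := (memLp_one_add_abs_inv.restrict (Ioi 0)).eLpNorm_ne_top
      have h3 := ENNReal.toReal_mono (by finiteness) h1
      have h4 : 0 ≤ symbolNorm f := ENNReal.toReal_nonneg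
      rw [ENNReal.toReal_mul, ENNReal.toReal_ofReal (by positivity)] at h3
      simp only [LinearMap.coe_mk, AddHom.coe_mk, Lp.norm_toLp, Lp.norm_def v]
      refine h3.trans (le_of_eq ?_)
      ring

lemma hankelCLM_coeFn (hf : IsSymbol f) (v : Lp ℂ 2 halfLine) :
    hankelCLM hf v =ᵐ[halfLine] hankel f v :=
  MemLp.coeFn_toLp (hf.memLp_hankel (Lp.memLp v))

/-- The kernel `f(s + t)` is symmetric, so passing to the adjoint only conjugates the symbol. The
pointwise `1/(1 + s)` bound provides the integrability for Fubini. -/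
lemma inner_hankelCLM (hf : IsSymbol f) (v u : Lp ℂ 2 halfLine) :
    ⟪hankelCLM hf.conj v, u⟫_ℂ = ⟪v, hankelCLM hf u⟫_ℂ := by
  rw [L2.inner_def, L2.inner_def]
  have hu := Lp.memLp u
  have hv := Lp.memLp v
  have hint : Integrable (fun p : ℝ × ℝ => u p.1 * (f (p.1 + p.2) * conj (v p.2)))
      (halfLine.prod halfLine) := by
    have hv' : MemLp (fun t => conj (v t)) 2 halfLine := hv.star
    have hm : AEStronglyMeasurable (fun p : ℝ × ℝ => u p.1 * (f (p.1 + p.2) * conj (v p.2)))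
      (halfLine.prod halfLine) := hu.1.comp_fst.mul (hf.aestronglyMeasurable_prod hv'.1)
    rw [integrable_prod_iff hm]
    refine ⟨ae_of_all _ fun s => (hf.integrable_shift_mul hv' s).const_mul (u s), ?_⟩
    have hb := ((hu.norm).integrable_mul (memLp_one_add_abs_inv.restrict (Ioi 0))).mul_const
      (symbolNorm f * (eLpNorm (fun t => conj (v t)) 2 halfLine).toReal)
    refine hb.mono hm.norm.integral_prod_right'
      ((ae_restrict_iff' measurableSet_Ioi).2 (ae_of_all _ fun s hs => ?_))
    have hs' : 0 < s := hs
    simp only [norm_mul (u s), Pi.mul_apply]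
    rw [integral_const_mul, norm_mul, norm_mul, norm_mul, mul_assoc, norm_norm]
    refine mul_le_mul_of_nonneg_left ?_ (norm_nonneg _)
    rw [Real.norm_of_nonneg (by positivity)]
    refine (hf.integral_norm_le hv' hs).trans (le_trans (le_of_eq ?_)
      (mul_le_mul_of_nonneg_left (le_abs_self _) (norm_nonneg _)))
    rw [Real.norm_of_nonneg (by positivity), abs_of_pos hs', mul_assoc]
  calc ∫ s, ⟪(hankelCLM hf.conj v) s, u s⟫_ℂ ∂halfLine
      = ∫ s, ∫ t, u s * (f (s + t) * conj (v t)) ∂halfLine ∂halfLine := by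
        refine integral_congr_ae ?_
        filter_upwards [hankelCLM_coeFn hf.conj v] with s hs
        rw [hs, integral_const_mul, RCLike.inner_apply, hankel, ← integral_conj]
        simp
    _ = ∫ t, ∫ s, u s * (f (s + t) * conj (v t)) ∂halfLine ∂halfLine :=
        integral_integral_swap hint
    _ = _ := by
        refine integral_congr_ae ?_
        filter_upwards [hankelCLM_coeFn hf u] with t ht
        rw [ht, RCLike.inner_apply, hankel, ← integral_mul_const]
        congr 1
        ext s
        rw [add_comm t s]
        ring

end

/-- Each product is `H H*`, hence nonnegative; the quadratic form is at least `‖u‖²`, and coercivity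
gives invertibility. -/
lemma isUnit_one_add_hankel {f₁ f₂ : ℝ → ℂ} (h₁ : IsSymbol f₁) (h₂ : IsSymbol f₂) :
    IsUnit (1 + hankelCLM h₁ ∘L hankelCLM h₁.conj + hankelCLM h₂ ∘L hankelCLM h₂.conj) := by
  refine ContinuousLinearMap.isUnit_of_forall_le_norm_inner_map _ (c := 1) one_pos fun u => ?_
  have key : ∀ {f : ℝ → ℂ} (h : IsSymbol f),
      ⟪hankelCLM h (hankelCLM h.conj u), u⟫_ℂ = ((‖hankelCLM h.conj u‖ ^ 2 : ℝ) : ℂ) := by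
    intro f h
    rw [← inner_conj_symm, ← inner_hankelCLM h, inner_self_eq_norm_sq_to_K]
    simp
  simp only [add_apply, one_apply_eq_self, ContinuousLinearMap.comp_apply, inner_add_left, key, inner_self_eq_norm_sq_to_K]
  have : (((‖u‖ : ℝ) : ℂ) ^ 2 + ((‖hankelCLM h₁.conj u‖ ^ 2 : ℝ) : ℂ)
      + ((‖hankelCLM h₂.conj u‖ ^ 2 : ℝ) : ℂ)) = ((‖u‖ ^ 2 + ‖hankelCLM h₁.conj u‖ ^ 2
        + ‖hankelCLM h₂.conj u‖ ^ 2 : ℝ) : ℂ) := by push_cast; ring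
  simp only [coe_algebraMap]
  rw [this, norm_real, Real.norm_of_nonneg (by positivity)]
  simp only [NNReal.coe_one, mul_one]
  nlinarith [sq_nonneg ‖hankelCLM h₁.conj u‖, sq_nonneg ‖hankelCLM h₂.conj u‖]

/-- The exponents sum to one. The share `3/4 > 1/2` makes the factor in `s` square integrable on the
half line; the remaining `1/4 > 0` improves `1/(1 + t)` to an integrable power. -/
lemma rpow_split {s t : ℝ} (hs : 0 < s) (ht : 0 < t) :
    (1 + |s + t|)⁻¹ ≤ (s + 1) ^ (-(3 / 4) : ℝ) * (t + 1) ^ (-(1 / 4) : ℝ) := by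
  have h0 : 0 < 1 + |s + t| := by positivity
  have e : (1 + |s + t|)⁻¹ = (1 + |s + t|) ^ (-(3 / 4) : ℝ) * (1 + |s + t|) ^ (-(1 / 4) : ℝ) := by
    rw [← Real.rpow_add h0, ← Real.rpow_neg_one]
    norm_num
  rw [e, abs_of_pos (by positivity)]
  gcongr ?_ * ?_
  · exact Real.rpow_le_rpow_of_nonpos (by positivity) (by linarith) (by norm_num)
  · exact Real.rpow_le_rpow_of_nonpos (by positivity) (by linarith) (by norm_num)

/-- A Hankel operator with admissible symbol maps functions bounded by `|g| + C/(1 + t)` with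
`g` integrable to integrable functions. -/
lemma IsSymbol.integrable_hankel {f v g : ℝ → ℂ} (hf : IsSymbol f)
    (hv : AEStronglyMeasurable v halfLine) (hg : Integrable g halfLine) (C : ℝ)
    (hb : ∀ t, 0 < t → ‖v t‖ ≤ ‖g t‖ + C * (1 + t)⁻¹) :
    Integrable (hankel f v) halfLine := by
  have hshift : ∀ t, Integrable (fun s => f (s + t)) halfLine := fun t =>
    (hf.integrable.comp_add_right t).restrict
  have hT1 : ∀ t, ∫ s, ‖f (s + t)‖ ∂halfLine ≤ ∫ s, ‖f s‖ := fun t => by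
    rw [← integral_add_right_eq_self (fun s => ‖f s‖) t]
    exact setIntegral_le_integral (hf.integrable.comp_add_right t).norm
      (ae_of_all _ fun s => norm_nonneg _)
  have hr2 : MemLp (fun s : ℝ => (s + 1) ^ (-(3 / 4) : ℝ)) 2 halfLine := by
    have hm : AEStronglyMeasurable (fun s : ℝ => (s + 1) ^ (-(3 / 4) : ℝ)) halfLine :=
      Measurable.aestronglyMeasurable (by fun_prop)
    rw [memLp_two_iff_integrable_sq hm]
    refine IntegrableOn.congr_fun (integrableOn_add_rpow_Ioi_of_lt (a := -(3 / 2)) (c := 0) (m := 1)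
      (by norm_num) (by norm_num)) (fun s hs => ?_) measurableSet_Ioi
    have hs' : 0 < s + 1 := by have : 0 < s := hs; linarith
    rw [← Real.rpow_natCast, ← Real.rpow_mul hs'.le]
    norm_num
  -- The weighted symbol `G(s + t)` times `(s + 1)^{-3/4}` is bounded by the sum of their squares,
  -- each integrable in `s` uniformly in `t`.
  obtain ⟨D, hD⟩ : ∃ D, ∀ t, 0 < t →
      ∫ s, ‖f (s + t)‖ ∂halfLine ≤ D * (t + 1) ^ (-(1 / 4) : ℝ) := by
    set G : ℝ → ℝ := fun s => ‖((1 + |s| : ℝ) : ℂ) * f s‖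
    have hG : MemLp G 2 volume := hf.memLp.norm
    have hGi : Integrable (fun s => (s + 1) ^ (-(3 / 2) : ℝ)) halfLine :=
      integrableOn_add_rpow_Ioi_of_lt (by norm_num) (by norm_num)
    refine ⟨(∫ s, G s ^ 2) + ∫ s, (s + 1) ^ (-(3 / 2) : ℝ) ∂halfLine, fun t ht => ?_⟩
    have hGt : Integrable (fun s => G (s + t) ^ 2) := hG.integrable_sq.comp_add_right t
    have e1 : ∫ s, G (s + t) ^ 2 ∂halfLine ≤ ∫ s, G s ^ 2 := by
      rw [← integral_add_right_eq_self (fun s => G s ^ 2) t]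
      exact setIntegral_le_integral hGt (ae_of_all _ fun s => sq_nonneg _)
    have e2 : Integrable (fun s => (G (s + t) ^ 2 + (s + 1) ^ (-(3 / 2) : ℝ)) *
        (t + 1) ^ (-(1 / 4) : ℝ)) halfLine := (hGt.restrict.add hGi).mul_const _
    calc ∫ s, ‖f (s + t)‖ ∂halfLine
        ≤ ∫ s, (G (s + t) ^ 2 + (s + 1) ^ (-(3 / 2) : ℝ)) * (t + 1) ^ (-(1 / 4) : ℝ) ∂halfLine := by
          refine setIntegral_mono_on (hshift t).norm e2 measurableSet_Ioi fun s hs => ?_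
          have hs' : 0 < s := hs
          have h1 : ‖f (s + t)‖ = G (s + t) * (1 + |s + t|)⁻¹ := by
            simp only [G, norm_mul, norm_real]
            rw [Real.norm_of_nonneg (by positivity)]
            have : 1 + |s + t| ≠ 0 := by positivity
            field_simp
          have h2 : (s + 1) ^ (-(3 / 2) : ℝ) = ((s + 1) ^ (-(3 / 4) : ℝ)) ^ 2 := by
            rw [← Real.rpow_natCast, ← Real.rpow_mul (by positivity)]
            norm_num
          have h3 : 0 ≤ G (s + t) := norm_nonneg _
          rw [h1, h2]
          refine (mul_le_mul_of_nonneg_left (rpow_split hs' ht) h3).trans ?_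
          rw [← mul_assoc]
          have h4 : 0 ≤ (s + 1) ^ (-(3 / 4) : ℝ) := by positivity
          gcongr
          nlinarith [sq_nonneg (G (s + t) - (s + 1) ^ (-(3 / 4) : ℝ)), sq_nonneg (G (s + t)),
            sq_nonneg ((s + 1) ^ (-(3 / 4) : ℝ))]
      _ = ((∫ s, G (s + t) ^ 2 ∂halfLine) + ∫ s, (s + 1) ^ (-(3 / 2) : ℝ) ∂halfLine) *
          (t + 1) ^ (-(1 / 4) : ℝ) := by
          rw [integral_mul_const, integral_add hGt.restrict hGi]
      _ ≤ _ := by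
          have : 0 ≤ (t + 1) ^ (-(1 / 4) : ℝ) := by positivity
          gcongr
  have hC0 : 0 ≤ |C| := abs_nonneg C
  have hm := hf.aestronglyMeasurable_prod hv
  suffices h : Integrable (fun p : ℝ × ℝ => f (p.1 + p.2) * v p.2) (halfLine.prod halfLine) from
    h.integral_prod_left
  rw [integrable_prod_iff' hm]
  refine ⟨ae_of_all _ fun t => (hshift t).mul_const (v t), ?_⟩
  have hi5 : Integrable (fun s : ℝ => (s + 1) ^ (-(5 / 4) : ℝ)) halfLine :=
    integrableOn_add_rpow_Ioi_of_lt (by norm_num) (by norm_num)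
  -- The integrable part `g` only needs the `L¹` norm of the shifted symbol; the tail `C/(1 + t)`
  -- uses its decay `(t + 1)^{-1/4}`, giving the exponent `-5/4`.
  refine Integrable.mono' ((hg.norm.const_mul (∫ s, ‖f s‖)).add (hi5.const_mul (D * |C|)))
    hm.norm.prod_swap.integral_prod_right'
    ((ae_restrict_iff' measurableSet_Ioi).2 (ae_of_all _ fun t ht => ?_))
  have ht' : 0 < t := ht
  simp only [norm_mul, Pi.add_apply]
  rw [integral_mul_const, Real.norm_of_nonneg (by positivity)]
  have h0 : 0 ≤ ∫ s, ‖f (s + t)‖ ∂halfLine := integral_nonneg fun _ => norm_nonneg _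
  have h5 : (t + 1) ^ (-(5 / 4) : ℝ) = (t + 1) ^ (-(1 / 4) : ℝ) * (1 + t)⁻¹ := by
    rw [add_comm 1 t, ← Real.rpow_neg_one, ← Real.rpow_add (by positivity)]
    norm_num
  calc (∫ s, ‖f (s + t)‖ ∂halfLine) * ‖v t‖
      ≤ (∫ s, ‖f (s + t)‖ ∂halfLine) * (‖g t‖ + |C| * (1 + t)⁻¹) := by
        refine mul_le_mul_of_nonneg_left ((hb t ht').trans ?_) h0
        gcongr
        exact le_abs_self C
    _ = (∫ s, ‖f (s + t)‖ ∂halfLine) * ‖g t‖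
        + (∫ s, ‖f (s + t)‖ ∂halfLine) * (|C| * (1 + t)⁻¹) := by ring
    _ ≤ (∫ s, ‖f s‖) * ‖g t‖ + D * (t + 1) ^ (-(1 / 4) : ℝ) * (|C| * (1 + t)⁻¹) := by
        gcongr
        · exact hT1 t
        · exact hD t ht'
    _ = _ := by rw [h5]; ring

/-- The Marchenko system is solvable in `L¹(0, ∞)`. -/
theorem exists_marchenko {f₁ f₂ : ℝ → ℂ} (h₁ : IsSymbol f₁) (h₂ : IsSymbol f₂) (e c₁ c₂ : ℂ) :
    ∃ u v₁ v₂ : ℝ → ℂ, Integrable u halfLine ∧ Integrable v₁ halfLine ∧ Integrable v₂ halfLine ∧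
      (∀ s, v₁ s = e * conj (f₁ s) + hankel (fun s => conj (f₁ s)) u s) ∧
      (∀ s, v₂ s = e * conj (f₂ s) + hankel (fun s => conj (f₂ s)) u s) ∧
      ∀ s, u s = -(c₁ * f₁ s + hankel f₁ v₁ s + (c₂ * f₂ s + hankel f₂ v₂ s)) := by
  have key : ∀ {f : ℝ → ℂ} (h : IsSymbol f) (c : ℂ) {v : ℝ → ℂ}, MemLp v 2 halfLine →
      MemLp (fun s => c * f s + hankel f v s) 2 halfLine ∧
      ∃ C, ∀ t, 0 < t → ‖c * f t + hankel f v t‖ ≤ ‖c * f t‖ + C * (1 + t)⁻¹ := by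
    intro f h c v hv
    refine ⟨(h.memLp_self.const_mul c).add (h.memLp_hankel hv), _, fun t ht =>
      (norm_add_le _ _).trans (add_le_add_right (h.norm_hankel_le hv ht) _)⟩
  obtain ⟨T, hT⟩ := isUnit_one_add_hankel h₁ h₂
  set a₁ : Lp ℂ 2 halfLine := h₁.memLp_self.toLp
  set a₂ : Lp ℂ 2 halfLine := h₂.memLp_self.toLp
  set b₁ : Lp ℂ 2 halfLine := h₁.conj.memLp_self.toLp
  set b₂ : Lp ℂ 2 halfLine := h₂.conj.memLp_self.toLp
  -- Right side left after substituting the formulas for `v₁, v₂` into the equation for `u`.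
  set R : Lp ℂ 2 halfLine := -(c₁ • a₁ + e • hankelCLM h₁ b₁ + (c₂ • a₂ + e • hankelCLM h₂ b₂))
  set U : Lp ℂ 2 halfLine := (↑T⁻¹ : Lp ℂ 2 halfLine →L[ℂ] Lp ℂ 2 halfLine) R
  have hU : U + hankelCLM h₁ (hankelCLM h₁.conj U) + hankelCLM h₂ (hankelCLM h₂.conj U) = R := by
    have h1 : (↑T * ↑T⁻¹ : Lp ℂ 2 halfLine →L[ℂ] Lp ℂ 2 halfLine) R = R := by
      rw [Units.mul_inv]; rfl
    rw [hT] at h1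
    exact h1
  set V₁ : Lp ℂ 2 halfLine := e • b₁ + hankelCLM h₁.conj U with hV₁
  set V₂ : Lp ℂ 2 halfLine := e • b₂ + hankelCLM h₂.conj U with hV₂
  have hU2 : U = -(c₁ • a₁ + hankelCLM h₁ V₁ + (c₂ • a₂ + hankelCLM h₂ V₂)) := by
    have h1 : U = R - hankelCLM h₂ (hankelCLM h₂.conj U) - hankelCLM h₁ (hankelCLM h₁.conj U) :=
      eq_sub_of_add_eq (eq_sub_of_add_eq hU)
    calc U = R - hankelCLM h₂ (hankelCLM h₂.conj U) - hankelCLM h₁ (hankelCLM h₁.conj U) := h1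
      _ = _ := by
        simp only [hV₁, hV₂, map_add, map_smul, R]
        abel
  have coe : ∀ {f : ℝ → ℂ} (h : IsSymbol f) (c : ℂ) (V : Lp ℂ 2 halfLine),
      (c • h.memLp_self.toLp + hankelCLM h V : Lp ℂ 2 halfLine)
        =ᵐ[halfLine] fun s => c * f s + hankel f V s := by
    intro f h c V
    filter_upwards [Lp.coeFn_add (c • h.memLp_self.toLp) (hankelCLM h V),
      Lp.coeFn_smul c h.memLp_self.toLp, h.memLp_self.coeFn_toLp, hankelCLM_coeFn h V]
      with s e1 e2 e3 e4
    rw [e1, Pi.add_apply, e2, Pi.smul_apply, e3, e4, smul_eq_mul]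
  -- The representatives are defined by the right sides of the equations, so that these hold at
  -- every real `s`, not just almost everywhere on the half line.
  set v₁ : ℝ → ℂ := fun s => e * conj (f₁ s) + hankel (fun s => conj (f₁ s)) U s with hv₁
  set v₂ : ℝ → ℂ := fun s => e * conj (f₂ s) + hankel (fun s => conj (f₂ s)) U s with hv₂
  have hVv₁ : V₁ =ᵐ[halfLine] v₁ := coe h₁.conj e U
  have hVv₂ : V₂ =ᵐ[halfLine] v₂ := coe h₂.conj e U
  set u : ℝ → ℂ := fun s => -(c₁ * f₁ s + hankel f₁ v₁ s + (c₂ * f₂ s + hankel f₂ v₂ s)) with hu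
  have hUu : U =ᵐ[halfLine] u := by
    rw [hU2]
    filter_upwards [Lp.coeFn_neg (c₁ • a₁ + hankelCLM h₁ V₁ + (c₂ • a₂ + hankelCLM h₂ V₂)),
      Lp.coeFn_add (c₁ • a₁ + hankelCLM h₁ V₁) (c₂ • a₂ + hankelCLM h₂ V₂), coe h₁ c₁ V₁,
      coe h₂ c₂ V₂] with s e1 e2 e3 e4
    rw [e1, Pi.neg_apply, e2, Pi.add_apply, e3, e4, hankel_congr hVv₁, hankel_congr hVv₂]
  -- Bootstrap from `L²` to `L¹`: each density is an integrable multiple of symbols plus `O(1/(1 +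
  -- t))`, and a Hankel operator sends such functions to `L¹`. The form of `v₁, v₂` makes `u`
  -- integrable; that of `u` then makes `v₁, v₂` integrable.
  obtain ⟨hm₁, C₁, hC₁⟩ := key h₁.conj e (Lp.memLp U)
  obtain ⟨hm₂, C₂, hC₂⟩ := key h₂.conj e (Lp.memLp U)
  have hi₁ := h₁.integrable.restrict (s := Ioi 0)
  have hi₂ := h₂.integrable.restrict (s := Ioi 0)
  have hic₁ := h₁.conj.integrable.restrict (s := Ioi 0)
  have hic₂ := h₂.conj.integrable.restrict (s := Ioi 0)
  have hui : Integrable u halfLine :=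
    (((hi₁.const_mul c₁).add (h₁.integrable_hankel hm₁.1 (hic₁.const_mul e) C₁ hC₁)).add
      ((hi₂.const_mul c₂).add (h₂.integrable_hankel hm₂.1 (hic₂.const_mul e) C₂ hC₂))).neg
  obtain ⟨hn₁, D₁, hD₁⟩ := key h₁ c₁ hm₁
  obtain ⟨hn₂, D₂, hD₂⟩ := key h₂ c₂ hm₂
  have hub : ∀ t, 0 < t → ‖u t‖ ≤ ‖((‖c₁ * f₁ t‖ + ‖c₂ * f₂ t‖ : ℝ) : ℂ)‖
      + (D₁ + D₂) * (1 + t)⁻¹ := fun t ht => by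
    rw [norm_real, Real.norm_of_nonneg (by positivity), hu, norm_neg]
    refine (norm_add_le _ _).trans ((add_le_add (hD₁ t ht) (hD₂ t ht)).trans (le_of_eq ?_))
    ring
  have hgi : Integrable (fun t => ((‖c₁ * f₁ t‖ + ‖c₂ * f₂ t‖ : ℝ) : ℂ)) halfLine :=
    (((hi₁.const_mul c₁).norm).add (hi₂.const_mul c₂).norm).ofReal
  have hUc : ∀ f : ℝ → ℂ, hankel f U = hankel f u := fun f => hankel_congr hUu
  refine ⟨u, v₁, v₂, hui, ?_, ?_, fun s => ?_, fun s => ?_, fun s => rfl⟩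
  · rw [hv₁, hUc]
    exact (hic₁.const_mul e).add (h₁.conj.integrable_hankel hui.1 hgi _ hub)
  · rw [hv₂, hUc]
    exact (hic₂.const_mul e).add (h₂.conj.integrable_hankel hui.1 hgi _ hub)
  · rw [hv₁, hUc]
  · rw [hv₂, hUc]

end ManakovRHP

/-! ### Row problems on the real line -/

namespace ManakovRHP

open scoped FourierTransform

lemma IsRegular.conj {f : ℝ → ℂ} (h : IsRegular f) : IsRegular fun t => conj (f t) := by
  have hcF := continuous_fourier h.integrable
  have hc : Continuous fun s => conj (f s) := continuous_conj.comp h.continuous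
  refine ⟨hc, h.memLp.mono ?_ (ae_of_all _ fun s => ?_), ?_⟩
  · exact Continuous.aestronglyMeasurable (by fun_prop)
  · simp
  · simp only [fourier_conj]
    refine (h.memLp_fourier.comp_measurePreserving (Measure.measurePreserving_neg volume)).mono ?_
      (ae_of_all _ fun s => ?_)
    · have : Continuous fun s : ℝ => conj (𝓕 f (-s)) :=
        continuous_conj.comp (hcF.comp continuous_neg)
      exact Continuous.aestronglyMeasurable (by fun_prop)
    · simp

lemma IsRegular.comp_neg {f : ℝ → ℂ} (h : IsRegular f) : IsRegular fun t => f (-t) := by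
  refine ⟨h.continuous.comp continuous_neg, ?_, ?_⟩
  · have := h.memLp.comp_measurePreserving (Measure.measurePreserving_neg volume)
    simpa [Function.comp_def] using this
  · rw [fourier_comp_neg]
    have := h.memLp_fourier.comp_measurePreserving (Measure.measurePreserving_neg volume)
    simpa [Function.comp_def] using this

lemma IsRegular.isSymbol_fourier {f : ℝ → ℂ} (h : IsRegular f) : IsSymbol (𝓕 f) :=
  ⟨continuous_fourier h.integrable, h.memLp_fourier⟩

lemma continuous_laplaceUp_neg {a : ℝ → ℂ} (ha : Integrable a halfLine) :
    Continuous fun t : ℝ => laplaceUp a (-t) :=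
  (continuousOn_laplaceUp ha).comp_continuous (f := fun t : ℝ => (-t : ℂ)) (by fun_prop)
    (fun t => by simp)

lemma continuous_mul_laplaceUp {σ a : ℝ → ℂ} (hσ : IsRegular σ)
    (ha : Integrable a halfLine) (c : ℂ) :
    Continuous fun t : ℝ => σ t * (c + laplaceUp a (-t)) :=
  hσ.continuous.mul (continuous_const.add (continuous_laplaceUp_neg ha))

lemma norm_mul_laplaceUp_le_mul (σ : ℝ → ℂ) {a : ℝ → ℂ} (ha : Integrable a halfLine) (c : ℂ)
    (t : ℝ) : ‖σ t * (c + laplaceUp a (-t))‖ ≤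
    (‖c‖ + ∫ s in Ioi (0 : ℝ), ‖a s‖) * ‖σ t‖ := by
  rw [norm_mul, mul_comm]
  gcongr
  refine (norm_add_le _ _).trans ?_
  gcongr
  exact norm_laplaceUp_le ha (by simp)

lemma integrable_mul_laplaceUp {σ a : ℝ → ℂ} (hσ : IsRegular σ)
    (ha : Integrable a halfLine) (c : ℂ) :
    Integrable fun t : ℝ => σ t * (c + laplaceUp a (-t)) :=
  (hσ.integrable.norm.const_mul (‖c‖ + ∫ s in Ioi (0 : ℝ), ‖a s‖)).mono'
    (continuous_mul_laplaceUp hσ ha c).aestronglyMeasurable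
    (ae_of_all _ fun t => norm_mul_laplaceUp_le_mul σ ha c t)

lemma memLp_mul_laplaceUp {σ a : ℝ → ℂ} (hσ : IsRegular σ)
    (ha : Integrable a halfLine) (c : ℂ) :
   
    MemLp (fun t : ℝ => (t : ℂ) * (σ t * (c + laplaceUp a (-t)))) 2 volume := by
  refine (hσ.memLp.const_mul ((‖c‖ + ∫ s in Ioi (0 : ℝ), ‖a s‖ : ℝ) : ℂ)).mono
    (continuous_ofReal.mul (continuous_mul_laplaceUp hσ ha c)).aestronglyMeasurable
    (ae_of_all _ fun t => ?_)
  have h1 := norm_mul_laplaceUp_le_mul σ ha c t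
  have h2 : 0 ≤ ∫ s in Ioi (0 : ℝ), ‖a s‖ := integral_nonneg fun _ => norm_nonneg _
  have h3 : 0 ≤ ‖c‖ + ∫ s in Ioi (0 : ℝ), ‖a s‖ := by positivity
  calc ‖(t : ℂ) * (σ t * (c + laplaceUp a (-t)))‖
      ≤ (1 + |t|) * ((‖c‖ + ∫ s in Ioi (0 : ℝ), ‖a s‖) * ‖σ t‖) := by
        rw [norm_mul, norm_real, Real.norm_eq_abs]
        gcongr
        linarith
    _ = _ := by
        rw [norm_mul, norm_mul, norm_real, norm_real, Real.norm_of_nonneg h3,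
          Real.norm_of_nonneg (by positivity)]
        ring

/-- At `-t` the Laplace transform is a superposition of the phases `e^{-2πirt}` with weight `a r`.
Each phase shifts `𝓕 σ` to `𝓕 σ (s + r)`, and summing over `r > 0` is a Hankel operator. -/
lemma fourier_mul_laplaceUp {σ a : ℝ → ℂ} (hσ : IsRegular σ)
    (ha : Integrable a halfLine) (c : ℂ) :
    𝓕 (fun t : ℝ => σ t * (c + laplaceUp a (-t))) =
    fun s => c * 𝓕 σ s + hankel (𝓕 σ) a s := by
  ext s
  have h1 : Integrable fun t => c * σ t := hσ.integrable.const_mul c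
  have h2 : Integrable fun t : ℝ => σ t * laplaceUp a (-t) := by
    simpa using integrable_mul_laplaceUp hσ ha 0
  have h3 : (fun t : ℝ => σ t * (c + laplaceUp a (-t)))
      = fun t : ℝ => c * σ t + σ t * laplaceUp a (-t) := by ext t; ring
  rw [h3, fourier_add_apply h1 h2, fourier_const_mul_apply]
  congr 1
  have hint : Integrable (fun p : ℝ × ℝ => Complex.exp (↑(-2 * Real.pi * p.1 * (s + p.2)) * I)
      * (σ p.1 * a p.2)) (volume.prod halfLine) := by
    have hc : Continuous fun p : ℝ × ℝ => Complex.exp (↑(-2 * Real.pi * p.1 * (s + p.2)) * I) := by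
      fun_prop
    have h4 := hσ.integrable.mul_prod ha
    refine h4.congr' (hc.aestronglyMeasurable.mul h4.1) (ae_of_all _ fun p => ?_)
    simp only [norm_mul, Complex.norm_exp_ofReal_mul_I, one_mul]
  calc 𝓕 (fun t : ℝ => σ t * laplaceUp a (-t)) s
      = ∫ t : ℝ, ∫ r in Ioi (0 : ℝ), Complex.exp (↑(-2 * Real.pi * t * (s + r)) * I)
        * (σ t * a r) := by
        rw [Real.fourier_real_eq_integral_exp_smul]
        congr 1
        ext t
        rw [laplaceUp, smul_eq_mul, ← integral_const_mul, ← integral_const_mul]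
        congr 1
        ext r
        have : Complex.exp (↑(-2 * Real.pi * t * (s + r)) * I) =
            Complex.exp (↑(-2 * Real.pi * t * s) * I) *
              Complex.exp (2 * Real.pi * I * r * -t) := by
          rw [← Complex.exp_add]
          congr 1
          push_cast
          ring
        rw [this]
        ring
    _ = ∫ r in Ioi (0 : ℝ), ∫ t : ℝ, Complex.exp (↑(-2 * Real.pi * t * (s + r)) * I)
        * (σ t * a r) := integral_integral_swap hint
    _ = _ := by
        rw [hankel]
        congr 1
        ext r
        rw [Real.fourier_real_eq_integral_exp_smul, ← integral_mul_const]
        simp only [smul_eq_mul, mul_assoc]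

/-- Fourier inversion also uses the negative frequencies, so `s` ranges over the whole line; Tonelli
gives the bound `‖𝓕 σ‖₁ ‖a‖₁` for the Hankel term. -/
lemma integrable_fourier_mul_laplaceUp {σ a : ℝ → ℂ} (hσ : IsRegular σ)
    (ha : Integrable a halfLine) (c : ℂ) :
   
    Integrable (𝓕 fun t : ℝ => σ t * (c + laplaceUp a (-t))) := by
  rw [fourier_mul_laplaceUp hσ ha c]
  have hF := hσ.integrable_fourier
  refine (hF.const_mul c).add ?_
  suffices h : Integrable (fun p : ℝ × ℝ => 𝓕 σ (p.1 + p.2) * a p.2) (volume.prod halfLine) from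
    h.integral_prod_left
  have hm : AEStronglyMeasurable (fun p : ℝ × ℝ => 𝓕 σ (p.1 + p.2) * a p.2)
      (volume.prod halfLine) := by
    have hc : Continuous fun p : ℝ × ℝ => 𝓕 σ (p.1 + p.2) :=
      (continuous_fourier hσ.integrable).comp (continuous_fst.add continuous_snd)
    exact hc.aestronglyMeasurable.mul ha.1.comp_snd
  rw [integrable_prod_iff' hm]
  refine ⟨ae_of_all _ fun t => (hF.comp_add_right t).mul_const (a t), ?_⟩
  refine (ha.norm.const_mul (∫ s, ‖𝓕 σ s‖)).congr (ae_of_all _ fun t => ?_)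
  simp only [norm_mul]
  rw [integral_mul_const, integral_add_right_eq_self (fun s => ‖𝓕 σ s‖) t]

/-- Solvability of a row of the Riemann–Hilbert problem on the real line. -/
theorem exists_row {ρ₁ ρ₂ : ℝ → ℂ} (h₁ : IsRegular ρ₁) (h₂ : IsRegular ρ₂) (c : Fin 3 → ℂ) :
    ∃ p m : Fin 3 → ℂ → ℂ, (∀ j, IsDecaying (p j)) ∧ (∀ j, IsDecaying (m j)) ∧ ∀ t : ℝ,
      c 1 + p 1 t = c 1 + m 1 (-t) + conj (ρ₁ t) * (c 0 + m 0 (-t)) ∧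
      c 2 + p 2 t = c 2 + m 2 (-t) + conj (ρ₂ t) * (c 0 + m 0 (-t)) ∧
      c 0 + p 0 t = c 0 + m 0 (-t) + ρ₁ t * (c 1 + p 1 t) + ρ₂ t * (c 2 + p 2 t) := by
  have hn₁ := h₁.comp_neg
  have hn₂ := h₂.comp_neg
  -- Here `u` is the density of `m 0`, and `v₁, v₂` are those of `p 1, p 2`. Reflecting `ρ` makes
  -- the product `ρ p` a function of `-t` as in `fourier_mul_laplaceUp`, and makes the conjugate
  -- symbol the transform of `conj ρ`.
  obtain ⟨u, v₁, v₂, hu, hv₁, hv₂, ev₁, ev₂, eu⟩ :=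
    exists_marchenko hn₁.isSymbol_fourier hn₂.isSymbol_fourier (c 0) (c 1) (c 2)
  have conj_eq : ∀ f : ℝ → ℂ, (fun s => conj (𝓕 (fun t => f (-t)) s)) = 𝓕 fun t => conj (f t) := by
    intro f; ext s; rw [fourier_comp_neg, fourier_conj]
  set φ₁ : ℝ → ℂ := fun t => conj (ρ₁ t) * (c 0 + laplaceUp u (-t)) with hφ₁
  set φ₂ : ℝ → ℂ := fun t => conj (ρ₂ t) * (c 0 + laplaceUp u (-t)) with hφ₂
  set ψ₁ : ℝ → ℂ := fun t => ρ₁ (-t) * (c 1 + laplaceUp v₁ (-t)) with hψ₁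
  set ψ₂ : ℝ → ℂ := fun t => ρ₂ (-t) * (c 2 + laplaceUp v₂ (-t)) with hψ₂
  have F₁ : 𝓕 φ₁ = v₁ := by
    ext s
    rw [hφ₁, fourier_mul_laplaceUp h₁.conj hu, ev₁, conj_eq, ← conj_eq]
  have F₂ : 𝓕 φ₂ = v₂ := by
    ext s
    rw [hφ₂, fourier_mul_laplaceUp h₂.conj hu, ev₂, conj_eq, ← conj_eq]
  set ψ : ℝ → ℂ := fun t => ψ₁ t + ψ₂ t with hψ
  have iψ₁ := integrable_mul_laplaceUp hn₁ hv₁ (c 1)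
  have iψ₂ := integrable_mul_laplaceUp hn₂ hv₂ (c 2)
  have iψ : Integrable ψ := iψ₁.add iψ₂
  have cψ : Continuous ψ :=
    (continuous_mul_laplaceUp hn₁ hv₁ (c 1)).add (continuous_mul_laplaceUp hn₂ hv₂ (c 2))
  have mψ : MemLp (fun t : ℝ => (t : ℂ) * ψ t) 2 volume := by
    refine ((memLp_mul_laplaceUp hn₁ hv₁ (c 1)).add (memLp_mul_laplaceUp hn₂ hv₂ (c 2))).ae_eq
      (ae_of_all _ fun t => ?_)
    simp only [Pi.add_apply, hψ, hψ₁, hψ₂]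
    ring
  have eFψ : 𝓕 ψ = fun s => 𝓕 ψ₁ s + 𝓕 ψ₂ s := by
    ext s; exact fourier_add_apply iψ₁ iψ₂ s
  have iFψ : Integrable (𝓕 ψ) := by
    rw [eFψ]
    exact (integrable_fourier_mul_laplaceUp hn₁ hv₁ (c 1)).add
      (integrable_fourier_mul_laplaceUp hn₂ hv₂ (c 2))
  -- This closes the loop: the function `m 0` obtained by splitting `ψ` is the transform of `u` with
  -- which `φ₁, φ₂` were built.
  have Fψ : 𝓕 ψ = fun s => -u s := by
    rw [eFψ]
    ext s
    rw [hψ₁, hψ₂, fourier_mul_laplaceUp hn₁ hv₁, fourier_mul_laplaceUp hn₂ hv₂, eu, neg_neg]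
  have Lu : laplaceUp (𝓕 ψ) = fun z => -laplaceUp u z := by
    ext z
    rw [Fψ, laplaceUp, laplaceUp, ← integral_neg]
    simp only [neg_mul]
  have d₁ := isDecaying_laplaceUp (integrable_mul_laplaceUp h₁.conj hu (c 0))
    (integrable_fourier_mul_laplaceUp h₁.conj hu (c 0)) (memLp_mul_laplaceUp h₁.conj hu (c 0))
  have d₂ := isDecaying_laplaceUp (integrable_mul_laplaceUp h₂.conj hu (c 0))
    (integrable_fourier_mul_laplaceUp h₂.conj hu (c 0)) (memLp_mul_laplaceUp h₂.conj hu (c 0))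
  have d₁' := isDecaying_laplaceUp_neg (integrable_mul_laplaceUp h₁.conj hu (c 0))
    (integrable_fourier_mul_laplaceUp h₁.conj hu (c 0)) (memLp_mul_laplaceUp h₁.conj hu (c 0))
  have d₂' := isDecaying_laplaceUp_neg (integrable_mul_laplaceUp h₂.conj hu (c 0))
    (integrable_fourier_mul_laplaceUp h₂.conj hu (c 0)) (memLp_mul_laplaceUp h₂.conj hu (c 0))
  have d₀ := isDecaying_laplaceUp iψ iFψ mψ
  have d₀' := isDecaying_laplaceUp_neg iψ iFψ mψ
  have j₁ := laplaceUp_add_laplaceUp_neg (continuous_mul_laplaceUp h₁.conj hu (c 0))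
    (integrable_mul_laplaceUp h₁.conj hu (c 0)) (integrable_fourier_mul_laplaceUp h₁.conj hu (c 0))
  have j₂ := laplaceUp_add_laplaceUp_neg (continuous_mul_laplaceUp h₂.conj hu (c 0))
    (integrable_mul_laplaceUp h₂.conj hu (c 0)) (integrable_fourier_mul_laplaceUp h₂.conj hu (c 0))
  have j₀ := laplaceUp_add_laplaceUp_neg cψ iψ iFψ
  -- Since `ψ` is the jump term at `-t`, positive and negative frequencies exchange their roles in
  -- component `0`.
  refine ⟨![laplaceUp fun s => 𝓕 ψ (-s), laplaceUp (𝓕 φ₁), laplaceUp (𝓕 φ₂)],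
    ![fun z => -laplaceUp (𝓕 ψ) z, fun z => -laplaceUp (fun s => 𝓕 φ₁ (-s)) z,
      fun z => -laplaceUp (fun s => 𝓕 φ₂ (-s)) z], fun j => ?_, fun j => ?_, fun t => ⟨?_, ?_, ?_⟩⟩
  · fin_cases j
    · exact d₀'
    · exact d₁
    · exact d₂
  · fin_cases j
    · exact d₀.neg
    · exact d₁'.neg
    · exact d₂'.neg
  · simp only [Matrix.cons_val, Lu, neg_neg]
    linear_combination j₁ t
  · simp only [Matrix.cons_val, Lu, neg_neg]
    linear_combination j₂ t
  · have h3 := j₀ (-t)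
    simp only [ofReal_neg, neg_neg, hψ, hψ₁, hψ₂] at h3
    simp only [Matrix.cons_val, F₁, F₂]
    linear_combination h3

end ManakovRHP

/-! ### Removable contours and Liouville's theorem -/

namespace ManakovRHP

/-- A continuous function that is analytic off the real line is entire. -/
lemma differentiable_of_differentiableOn_im_ne {F : ℂ → ℂ} (hc : Continuous F)
    (hd : ∀ z : ℂ, z.im ≠ 0 → DifferentiableAt ℂ F z) : Differentiable ℂ F := by
  have hcons : ∀ z w : ℂ, wedgeIntegral z w F = -wedgeIntegral w z F := by
    intro z w
    rw [← add_eq_zero_iff_eq_neg, wedgeIntegral_add_wedgeIntegral_eq]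
    -- The real axis cuts the rectangle into two signed rectangles whose open interiors avoid it.
    -- Cauchy–Goursat applies to both, the integrals along the axis cancel, and Morera's theorem
    -- follows.
    have h1 := integral_boundary_rect_eq_zero_of_continuousOn_of_differentiableOn F z w.re
      hc.continuousOn (fun p hp => (hd p fun h0 => by
        have := (mem_reProdIm.1 hp).2
        simp only [ofReal_im, mem_Ioo, h0] at this
        rcases le_total z.im 0 with h | h
        · rw [max_eq_right h] at this; exact lt_irrefl _ this.2
        · rw [min_eq_right h] at this; exact lt_irrefl _ this.1).differentiableWithinAt)
    have h2 := integral_boundary_rect_eq_zero_of_continuousOn_of_differentiableOn F z.re w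
      hc.continuousOn (fun p hp => (hd p fun h0 => by
        have := (mem_reProdIm.1 hp).2
        simp only [ofReal_im, mem_Ioo, h0] at this
        rcases le_total w.im 0 with h | h
        · rw [max_eq_left h] at this; exact lt_irrefl _ this.2
        · rw [min_eq_left h] at this; exact lt_irrefl _ this.1).differentiableWithinAt)
    simp only [ofReal_im, ofReal_re] at h1 h2
    have i1 : ∀ x a b : ℝ, IntervalIntegrable (fun y : ℝ => F (x + y * I)) volume a b :=
      fun x a b => Continuous.intervalIntegrable (by fun_prop) a b
    rw [← intervalIntegral.integral_add_adjacent_intervals (i1 w.re z.im 0) (i1 w.re 0 w.im),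
      ← intervalIntegral.integral_add_adjacent_intervals (i1 z.re z.im 0) (i1 z.re 0 w.im)]
    simp only [smul_eq_mul] at h1 h2 ⊢
    linear_combination h1 + h2
  intro z
  have hex : IsExactOn F (Metric.ball z 1) :=
    IsConservativeOn.isExactOn_ball hc.continuousOn fun z w _ => hcons z w
  exact (hex.differentiableOn Metric.isOpen_ball).differentiableAt
    (Metric.ball_mem_nhds z one_pos)

/-- A function continuous on a disc and analytic off a concentric circle is analytic. -/
lemma differentiableOn_ball_of_sphere {F : ℂ → ℂ} {c : ℂ} {r R : ℝ} (hr : 0 < r) (hrR : r < R)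
    (hc : ContinuousOn F (Metric.closedBall c R))
    (hd : ∀ z ∈ Metric.ball c R, z ∉ Metric.sphere c r → DifferentiableAt ℂ F z) :
    DifferentiableOn ℂ F (Metric.ball c R) := by
  have hR : 0 < R := hr.trans hrR
  lift R to NNReal using hR.le
  set H : ℂ → ℂ := fun w => (2 * Real.pi * I : ℂ)⁻¹ • ∮ z in C(c, R), (z - w)⁻¹ • F z with hH
  have hci : CircleIntegrable F c R :=
    (hc.mono Metric.sphere_subset_closedBall).circleIntegrable hR.le
  have hHd : DifferentiableOn ℂ H (Metric.ball c R) := by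
    have := (hasFPowerSeriesOn_cauchy_integral hci hR).differentiableOn
    rwa [Metric.eball_coe] at this
  have heq : ∀ w ∈ Metric.ball c R, w ∉ Metric.sphere c r → F w = H w := by
    intro w hw hws
    have hnhds : Metric.closedBall c (R : ℝ) ∈ 𝓝 w :=
      mem_of_superset (Metric.isOpen_ball.mem_nhds hw) Metric.ball_subset_closedBall
    have hG : ContinuousOn (dslope F w) (Metric.closedBall c R) :=
      (continuousOn_dslope hnhds).2 ⟨hc, hd w hw hws⟩
    -- The integral of the difference quotient at `w` vanishes over the inner circle by Cauchy on
    -- the disc, and over the outer one by Cauchy on the annulus; `w` itself is an admissible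
    -- exceptional point. This is Cauchy's formula for `F w`, valid off the circle of radius `r` and
    -- then on it by density.
    have e1 := circleIntegral_eq_of_differentiable_on_annulus_off_countable (c := c) hr hrR.le
      (countable_singleton w) (hG.mono sdiff_subset) (fun z hz =>
        (differentiableAt_dslope_of_ne hz.2).2 (hd z hz.1.1 fun h =>
          hz.1.2 (Metric.sphere_subset_closedBall h)))
    have e2 := circleIntegral_eq_zero_of_differentiable_on_off_countable (c := c) hr.le
      (countable_singleton w) (hG.mono (Metric.closedBall_subset_closedBall hrR.le)) (fun z hz =>
        (differentiableAt_dslope_of_ne hz.2).2 (hd z (Metric.ball_subset_ball hrR.le hz.1) fun h =>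
          (Metric.mem_ball.1 hz.1).ne h))
    rw [e2] at e1
    have hne : ∀ z ∈ Metric.sphere c (R : ℝ), z ≠ w := fun z hz h => by
      rw [h] at hz
      exact (Metric.mem_ball.1 hw).ne hz
    have hcinv : ContinuousOn (fun z => (z - w)⁻¹) (Metric.sphere c R) :=
      (continuousOn_id.sub continuousOn_const).inv₀ fun z hz => sub_ne_zero.2 (hne z hz)
    have hcF : ContinuousOn (fun z => (z - w)⁻¹ • F z) (Metric.sphere c R) :=
      hcinv.smul (hc.mono Metric.sphere_subset_closedBall)
    have hcw : ContinuousOn (fun z => (z - w)⁻¹ • F w) (Metric.sphere c R) :=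
      hcinv.smul continuousOn_const
    have e3 : ∮ z in C(c, R), dslope F w z =
        (∮ z in C(c, R), (z - w)⁻¹ • F z) - ∮ z in C(c, R), (z - w)⁻¹ • F w := by
      rw [← circleIntegral.integral_sub (hcF.circleIntegrable hR.le)
        (hcw.circleIntegrable hR.le)]
      refine circleIntegral.integral_congr hR.le fun z hz => ?_
      rw [dslope_of_ne _ (hne z hz), slope_def_module, smul_sub]
    rw [e1, circleIntegral.integral_smul_const, circleIntegral.integral_sub_inv_of_mem_ball hw,
      eq_comm, sub_eq_zero] at e3
    rw [hH]
    simp only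
    rw [e3, smul_eq_mul, smul_eq_mul, inv_mul_cancel_left₀ two_pi_I_ne_zero]
  have hdense : Dense (Metric.sphere c r)ᶜ := by
    rw [← interior_eq_empty_iff_dense_compl]; exact interior_sphere c hr.ne'
  have heq' : EqOn F H (Metric.ball c R) := by
    refine EqOn.of_subset_closure (s := Metric.ball c R ∩ (Metric.sphere c r)ᶜ)
      (fun w hw => heq w hw.1 hw.2) (hc.mono Metric.ball_subset_closedBall) hHd.continuousOn
      inter_subset_left (hdense.open_subset_closure_inter Metric.isOpen_ball)
  exact hHd.congr heq'

lemma differentiableAt_of_sphere {F : ℂ → ℂ} (hcF : Continuous F) {c : ℂ} {r : ℝ} (hr : 0 < r)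
    {V : Set ℂ} (hV : IsOpen V) (hcV : Metric.closedBall c r ⊆ V)
    (hd : ∀ z ∈ V, z ∉ Metric.sphere c r → DifferentiableAt ℂ F z) {w : ℂ}
    (hw : w ∈ Metric.sphere c r) : DifferentiableAt ℂ F w := by
  obtain ⟨δ, hδ, hsub⟩ := (isCompact_closedBall c r).exists_cthickening_subset_open hV hcV
  rw [cthickening_closedBall hδ.le hr.le] at hsub
  refine (differentiableOn_ball_of_sphere hr (by linarith : r < δ + r) hcF.continuousOn
    fun z hz hzs => hd z (hsub (Metric.ball_subset_closedBall hz)) hzs).differentiableAt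
    (Metric.isOpen_ball.mem_nhds ?_)
  rw [Metric.mem_ball, Metric.mem_sphere.1 hw]
  linarith

section Geometry

variable {n : ℕ} {z : Fin n → ℂ} {r : Fin n → ℝ}

lemma mem_contour {l : ℂ} : l ∈ contour z r ↔ l.im = 0 ∨ (∃ i, dist l (z i) = r i) ∨
    ∃ i, dist l (conj (z i)) = r i := by
  simp only [contour, mem_union, mem_ofPred_eq, mem_iUnion, Metric.mem_sphere, or_assoc]

lemma mem_plusSide {l : ℂ} : l ∈ plusSide z r ↔ (0 < l.im ∧ ∀ i, r i < dist l (z i)) ∨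
    ∃ i, dist l (conj (z i)) < r i := by
  simp [plusSide]

lemma mem_minusSide {l : ℂ} : l ∈ minusSide z r ↔
    (l.im < 0 ∧ ∀ i, r i < dist l (conj (z i))) ∨ ∃ i, dist l (z i) < r i := by
  simp [minusSide]

lemma dist_conj_left (a b : ℂ) : dist (conj a) b = dist a (conj b) := by
  rw [dist_eq_norm, dist_eq_norm, ← Complex.norm_conj, map_sub, conj_conj]

lemma conj_mem_contour {l : ℂ} : conj l ∈ contour z r ↔ l ∈ contour z r := by
  simp only [mem_contour, dist_conj_left, conj_conj, conj_im, neg_eq_zero]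
  tauto

lemma conj_mem_plusSide {l : ℂ} : conj l ∈ plusSide z r ↔ l ∈ minusSide z r := by
  simp only [mem_plusSide, mem_minusSide, dist_conj_left, conj_conj, conj_im, Left.neg_pos_iff]

lemma isClosed_contour : IsClosed (contour z r) := by
  refine IsClosed.union (IsClosed.union (isClosed_eq continuous_im continuous_const)
    (isClosed_iUnion_of_finite fun i => Metric.isClosed_sphere))
    (isClosed_iUnion_of_finite fun i => Metric.isClosed_sphere)

lemma im_pos_of_dist_le (hz : ∀ i, r i < (z i).im) {w : ℂ} {i : Fin n}
    (h : dist w (z i) ≤ r i) : 0 < w.im := by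
  have h1 := (le_abs_self _).trans (abs_im_le_norm (z i - w))
  rw [← dist_eq_norm, dist_comm, sub_im] at h1
  linarith [hz i]

lemma im_neg_of_dist_le (hz : ∀ i, r i < (z i).im) {w : ℂ} {i : Fin n}
    (h : dist w (conj (z i)) ≤ r i) : w.im < 0 := by
  rw [← dist_conj_left] at h
  simpa using im_pos_of_dist_le hz h

lemma lt_dist_of_dist_le (hd : ∀ i j, i ≠ j → r i + r j < dist (z i) (z j)) {w : ℂ} {i j : Fin n}
    (hij : j ≠ i) (h : dist w (z i) ≤ r i) : r j < dist w (z j) := by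
  have h1 := hd i j hij.symm
  have h2 := dist_triangle_left (z i) (z j) w
  linarith

lemma mem_side_of_notMem_contour {w : ℂ} (hw : w ∉ contour z r) :
    w ∈ plusSide z r ∪ minusSide z r := by
  rw [mem_contour] at hw
  push Not at hw
  obtain ⟨h0, h1, h2⟩ := hw
  simp only [mem_union, mem_plusSide, mem_minusSide]
  by_cases ha : ∃ i, dist w (z i) < r i
  · exact Or.inr (Or.inr ha)
  by_cases hb : ∃ i, dist w (conj (z i)) < r i
  · exact Or.inl (Or.inr hb)
  push Not at ha hb
  rcases lt_or_gt_of_ne h0 with h | h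
  · exact Or.inr (Or.inl ⟨h, fun i => lt_of_le_of_ne (hb i) (h2 i).symm⟩)
  · exact Or.inl (Or.inl ⟨h, fun i => lt_of_le_of_ne (ha i) (h1 i).symm⟩)

lemma notMem_contour_of_mem_plusSide (hz : ∀ i, r i < (z i).im)
    (hd : ∀ i j, i ≠ j → r i + r j < dist (z i) (z j)) {w : ℂ} (hw : w ∈ plusSide z r) :
    w ∉ contour z r := by
  rw [mem_plusSide] at hw
  rw [mem_contour]
  push Not
  rcases hw with ⟨h1, h2⟩ | ⟨i, hi⟩
  · refine ⟨h1.ne', fun i => (h2 i).ne', fun i h => ?_⟩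
    exact (im_neg_of_dist_le hz h.le).not_gt h1
  · have him := im_neg_of_dist_le hz hi.le
    refine ⟨him.ne, fun i h => (im_pos_of_dist_le hz h.le).not_gt him, fun j h => ?_⟩
    by_cases hji : j = i
    · subst hji; exact hi.ne h
    · rw [← dist_conj_left] at h hi
      exact (lt_dist_of_dist_le hd hji hi.le).ne' h

/-- The predicate `P` selects all circles near a real point, and all but one near a point of a
circle. -/
lemma isOpen_forall_lt_dist (p : Fin n → ℂ) (P : Fin n → Prop) :
    IsOpen {w : ℂ | ∀ i, P i → r i < dist w (p i)} := by
  have : {w : ℂ | ∀ i, P i → r i < dist w (p i)} = ⋂ i, {w | P i → r i < dist w (p i)} := by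
    ext; simp
  rw [this]
  refine isOpen_iInter_of_finite fun i => ?_
  by_cases h : P i
  · simpa [h] using isOpen_lt continuous_const (continuous_id.dist continuous_const)
  · simp [h]

/-- Needed for limits from a side to be meaningful: it makes boundary values unique and the
complement of Γ dense. -/
lemma contour_subset_closure_plusSide (hr : ∀ i, 0 < r i) (hz : ∀ i, r i < (z i).im)
    (hd : ∀ i j, i ≠ j → r i + r j < dist (z i) (z j)) :
    contour z r ⊆ closure (plusSide z r) := by
  intro l hl
  rcases mem_contour.1 hl with h0 | ⟨i, hi⟩ | ⟨i, hi⟩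
  · have hW := isOpen_forall_lt_dist (r := r) z (fun _ => True)
    have h1 : l ∈ closure {w : ℂ | 0 < w.im} := by
      rw [Complex.closure_setOfPred_lt_im]; exact h0.ge
    refine closure_mono ?_ (hW.inter_closure ⟨fun i _ => ?_, h1⟩)
    · exact fun w hw => mem_plusSide.2 (Or.inl ⟨hw.2, fun i => hw.1 i trivial⟩)
    · by_contra h
      exact (im_pos_of_dist_le hz (not_lt.1 h)).ne' h0
  · have hW := (isOpen_lt (continuous_const (y := (0 : ℝ))) continuous_im).inter
      (isOpen_forall_lt_dist (r := r) z (fun j => j ≠ i))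
    have h1 : l ∈ closure (Metric.closedBall (z i) (r i))ᶜ := by
      rw [closure_compl, interior_closedBall _ (hr i).ne']
      exact fun h => (Metric.mem_ball.1 h).ne hi
    refine closure_mono ?_ (hW.inter_closure ⟨⟨im_pos_of_dist_le hz hi.le, fun j hj =>
      lt_dist_of_dist_le hd hj hi.le⟩, h1⟩)
    refine fun w hw => mem_plusSide.2 (Or.inl ⟨hw.1.1, fun j => ?_⟩)
    by_cases hj : j = i
    · subst hj
      exact not_le.1 hw.2
    · exact hw.1.2 j hj
  · have h1 : l ∈ closure (Metric.ball (conj (z i)) (r i)) := by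
      rw [closure_ball _ (hr i).ne']; exact hi.le
    exact closure_mono (fun w hw => mem_plusSide.2 (Or.inr ⟨i, hw⟩)) h1

lemma contour_subset_closure_minusSide (hr : ∀ i, 0 < r i) (hz : ∀ i, r i < (z i).im)
    (hd : ∀ i j, i ≠ j → r i + r j < dist (z i) (z j)) :
    contour z r ⊆ closure (minusSide z r) := by
  intro l hl
  have h1 := contour_subset_closure_plusSide hr hz hd (conj_mem_contour.2 hl)
  have h2 := image_closure_subset_closure_image continuous_conj (mem_image_of_mem _ h1)
  rw [conj_conj] at h2
  refine closure_mono ?_ h2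
  rintro _ ⟨w, hw, rfl⟩
  rw [← conj_mem_plusSide, conj_conj]
  exact hw

lemma dense_compl_contour (hr : ∀ i, 0 < r i) (hz : ∀ i, r i < (z i).im)
    (hd : ∀ i j, i ≠ j → r i + r j < dist (z i) (z j)) : Dense (contour z r)ᶜ := by
  intro l
  by_cases hl : l ∈ contour z r
  · exact closure_mono (fun w hw => notMem_contour_of_mem_plusSide hz hd hw)
      (contour_subset_closure_plusSide hr hz hd hl)
  · exact subset_closure hl

/-- A continuous function that is analytic off `Γ` is entire. -/
lemma differentiable_of_contour (hr : ∀ i, 0 < r i) (hz : ∀ i, r i < (z i).im)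
    (hd : ∀ i j, i ≠ j → r i + r j < dist (z i) (z j)) {F : ℂ → ℂ} (hc : Continuous F)
    (hF : DifferentiableOn ℂ F (contour z r)ᶜ) : Differentiable ℂ F := by
  have hF' : ∀ w, w ∉ contour z r → DifferentiableAt ℂ F w := fun w hw =>
    hF.differentiableAt (isClosed_contour.isOpen_compl.mem_nhds hw)
  refine differentiable_of_differentiableOn_im_ne hc fun w hw => ?_
  by_cases hwc : w ∈ contour z r
  · rcases mem_contour.1 hwc with h0 | ⟨i, hi⟩ | ⟨i, hi⟩
    · exact absurd h0 hw
    · refine differentiableAt_of_sphere hc (hr i) (V := {w | 0 < w.im} ∩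
        {w | ∀ j, j ≠ i → r j < dist w (z j)}) ((isOpen_lt continuous_const continuous_im).inter
        (isOpen_forall_lt_dist z _)) (fun v hv => ⟨im_pos_of_dist_le hz hv, fun j hj =>
        lt_dist_of_dist_le hd hj hv⟩) (fun v hv hvs => hF' v ?_) hi
      rw [mem_contour]
      push Not
      refine ⟨(ne_of_gt hv.1 : v.im ≠ 0), fun j hj => ?_, fun j hj =>
        (im_neg_of_dist_le hz hj.le).not_gt hv.1⟩
      by_cases hji : j = i
      · subst hji; exact hvs hj
      · exact (hv.2 j hji).ne' hj
    · refine differentiableAt_of_sphere hc (hr i) (V := {w | w.im < 0} ∩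
        {w | ∀ j, j ≠ i → r j < dist w (conj (z j))})
        ((isOpen_lt continuous_im continuous_const).inter
        (isOpen_forall_lt_dist _ _)) (fun v hv => ⟨im_neg_of_dist_le hz hv, fun j hj => ?_⟩)
        (fun v hv hvs => hF' v ?_) hi
      · rw [Metric.mem_closedBall, ← dist_conj_left] at hv
        rw [← dist_conj_left]
        exact lt_dist_of_dist_le hd hj hv
      · rw [mem_contour]
        push Not
        refine ⟨(ne_of_lt hv.1 : v.im ≠ 0), fun j hj => (im_pos_of_dist_le hz hj.le).not_gt hv.1,
          fun j hj => ?_⟩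
        by_cases hji : j = i
        · subst hji; exact hvs hj
        · exact (hv.2 j hji).ne' hj
  · exact hF' w hwc

/-- Liouville's theorem for functions without jump across `Γ`. -/
lemma eq_const_of_no_jump (hr : ∀ i, 0 < r i) (hz : ∀ i, r i < (z i).im)
    (hd : ∀ i j, i ≠ j → r i + r j < dist (z i) (z j)) {f g : ℂ → ℂ} {c : ℂ}
    (hf : DifferentiableOn ℂ f (contour z r)ᶜ) (hg : ContinuousOn g (contour z r))
    (hp : ∀ l ∈ contour z r, Tendsto f (𝓝[plusSide z r] l) (𝓝 (g l)))
    (hm : ∀ l ∈ contour z r, Tendsto f (𝓝[minusSide z r] l) (𝓝 (g l)))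
    (hinf : Tendsto f (cobounded ℂ ⊓ 𝓟 (contour z r)ᶜ) (𝓝 c)) {w : ℂ} (hw : w ∉ contour z r) :
    f w = c := by
  classical
  set F : ℂ → ℂ := (contour z r).piecewise g f with hFdef
  have hFf : ∀ v, v ∉ contour z r → F v = f v := fun v hv => piecewise_eq_of_notMem _ _ _ hv
  have hFg : ∀ v, v ∈ contour z r → F v = g v := fun v hv => piecewise_eq_of_mem _ _ _ hv
  have hev : ∀ v, v ∉ contour z r → F =ᶠ[𝓝 v] f := fun v hv =>
    mem_of_superset (isClosed_contour.isOpen_compl.mem_nhds hv) fun u hu => hFf u hu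
  have hFc : Continuous F := by
    rw [continuous_iff_continuousAt]
    intro l
    by_cases hl : l ∈ contour z r
    · have h1 : Tendsto F (𝓝[contour z r] l) (𝓝 (F l)) := by
        rw [hFg l hl]
        exact (hg l hl).congr' (mem_of_superset self_mem_nhdsWithin fun u hu => (hFg u hu).symm)
      have h2 : Tendsto F (𝓝[(contour z r)ᶜ] l) (𝓝 (F l)) := by
        rw [hFg l hl]
        have h3 : Tendsto f (𝓝[plusSide z r ∪ minusSide z r] l) (𝓝 (g l)) := by
          rw [nhdsWithin_union]
          exact (hp l hl).sup (hm l hl)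
        refine (h3.mono_left (nhdsWithin_mono l fun u hu => mem_side_of_notMem_contour hu)).congr'
          (mem_of_superset self_mem_nhdsWithin fun u hu => (hFf u hu).symm)
      have h4 := h1.sup h2
      rwa [← nhdsWithin_union, union_compl_self, nhdsWithin_univ] at h4
    · exact ((hf.differentiableAt (isClosed_contour.isOpen_compl.mem_nhds hl)).continuousAt).congr
        (hev l hl).symm
  have hFd : Differentiable ℂ F := differentiable_of_contour hr hz hd hFc fun v hv =>
    ((hf.differentiableAt (isClosed_contour.isOpen_compl.mem_nhds hv)).congr_of_eventuallyEq
      (hev v hv)).differentiableWithinAt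
  have hlim : Tendsto F (cocompact ℂ) (𝓝 c) := by
    rw [← Metric.cobounded_eq_cocompact, Metric.tendsto_nhds]
    intro ε hε
    have h1 : ∀ᶠ v in cobounded ℂ, v ∈ (contour z r)ᶜ → dist (f v) c < ε / 2 := by
      have := Metric.tendsto_nhds.1 hinf (ε / 2) (half_pos hε)
      rwa [eventually_inf_principal] at this
    obtain ⟨R, -, hR⟩ := (hasBasis_cobounded_norm).eventually_iff.1 h1
    -- The limit at infinity is known only off Γ. Density and continuity carry the non-strict bound
    -- `ε / 2` over to Γ.
    have h2 : {v : ℂ | R < ‖v‖} ⊆ {v | dist (F v) c ≤ ε / 2} := by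
      refine ((dense_compl_contour hr hz hd).open_subset_closure_inter
        (isOpen_lt continuous_const continuous_norm)).trans (closure_minimal ?_
        (isClosed_le (hFc.dist continuous_const) continuous_const))
      intro v hv
      have := hR (show R ≤ ‖v‖ from le_of_lt hv.1) hv.2
      rw [← hFf v hv.2] at this
      exact this.le
    filter_upwards [tendsto_norm_cobounded_atTop.eventually_gt_atTop R] with v hv
    exact lt_of_le_of_lt (h2 hv) (by linarith)
  have := congrFun (hFd.eq_const_of_tendsto_cocompact hlim) w
  rw [← hFf w hw, this]
  rfl

end Geometry

end ManakovRHP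

/-! ### Uniqueness -/

namespace ManakovRHP

lemma expSig_mul_expSig_neg (x : ℝ) (l : ℂ) : expSig x l * expSig x (-l) = 1 := by
  rw [expSig, expSig, Matrix.diagonal_mul_diagonal, ← Matrix.diagonal_one]
  congr 1
  ext j
  rw [← Complex.exp_add, ← Complex.exp_zero]
  congr 1
  ring

lemma det_expAd (x : ℝ) (l : ℂ) (B : Matrix (Fin 3) (Fin 3) ℂ) : (expAd x l B).det = B.det := by
  rw [expAd, Matrix.det_mul, Matrix.det_mul, mul_right_comm, ← Matrix.det_mul,
    expSig_mul_expSig_neg, Matrix.det_one, one_mul]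

lemma det_jumpReal (a b : ℂ) : (jumpReal a b).det = 1 := by
  simp [jumpReal, Matrix.det_fin_three]
  rw [← Complex.conj_mul', ← Complex.conj_mul']
  ring

lemma det_jumpUp (w : ℂ) (c : Fin 2 → ℂ) (l : ℂ) : (jumpUp w c l).det = 1 := by
  simp [jumpUp, Matrix.det_fin_three]

lemma det_jumpDown (w : ℂ) (c : Fin 2 → ℂ) (l : ℂ) : (jumpDown w c l).det = 1 := by
  simp [jumpDown, Matrix.det_fin_three]

lemma differentiableOn_adjugate_apply {M : ℂ → Matrix (Fin 3) (Fin 3) ℂ} {s : Set ℂ}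
    (h : ∀ i j, DifferentiableOn ℂ (fun w => M w i j) s) (i j : Fin 3) :
    DifferentiableOn ℂ (fun w => (M w).adjugate i j) s := by
  simp only [Matrix.adjugate_fin_three]
  fin_cases i <;> fin_cases j <;>
    simp only [Fin.mk_zero, Fin.reduceFinMk, Matrix.of_apply, Matrix.cons_val] <;> fun_prop

lemma tendsto_entry {A : ℂ → Matrix (Fin 3) (Fin 3) ℂ} {a : Matrix (Fin 3) (Fin 3) ℂ}
    {l : Filter ℂ} (hA : Tendsto A l (𝓝 a)) (i j : Fin 3) :
    Tendsto (fun w => A w i j) l (𝓝 (a i j)) :=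
  tendsto_pi_nhds.1 (tendsto_pi_nhds.1 hA i) j

lemma tendsto_mul_adjugate {A B : ℂ → Matrix (Fin 3) (Fin 3) ℂ} {a b : Matrix (Fin 3) (Fin 3) ℂ}
    {l : Filter ℂ} (hA : Tendsto A l (𝓝 a)) (hB : Tendsto B l (𝓝 b)) (i j : Fin 3) :
    Tendsto (fun w => (A w * (B w).adjugate) i j) l (𝓝 ((a * b.adjugate) i j)) := by
  have hadj : Continuous fun X : Matrix (Fin 3) (Fin 3) ℂ => X.adjugate :=
    continuous_id.matrix_adjugate
  have h1 : Tendsto (fun w => (B w).adjugate) l (𝓝 b.adjugate) := (hadj.tendsto b).comp hB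
  simp only [Matrix.mul_apply]
  exact tendsto_finsetSum _ fun k _ => (tendsto_entry hA i k).mul (tendsto_entry h1 k j)

section
variable {n : ℕ} {z : Fin n → ℂ} {r : Fin n → ℝ} {x : ℝ} {ρ₁ ρ₂ : ℝ → ℂ} {C : Fin n → Fin 2 → ℂ}
  {M M' : ℂ → Matrix (Fin 3) (Fin 3) ℂ}

/-- On each point of the contour the boundary values of all solutions are related by the same
unimodular matrix. -/
lemma exists_jump_matrix (x : ℝ) (ρ₁ ρ₂ : ℝ → ℂ) (C : Fin n → Fin 2 → ℂ) {l : ℂ}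
    (hl : l ∈ contour z r) : ∃ V : Matrix (Fin 3) (Fin 3) ℂ, V.det = 1 ∧
      ∀ Mp Mm : ℂ → Matrix (Fin 3) (Fin 3) ℂ,
        (∀ t : ℝ, Mp t = Mm t * expAd x t (jumpReal (ρ₁ t) (ρ₂ t))) →
        (∀ i, ∀ l ∈ Metric.sphere (z i) (r i), Mp l = Mm l * expAd x l (jumpUp (z i) (C i) l)) →
        (∀ i, ∀ l ∈ Metric.sphere (conj (z i)) (r i),
          Mp l = Mm l * expAd x l (jumpDown (z i) (C i) l)) → Mp l = Mm l * V := by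
  rcases mem_contour.1 hl with h0 | ⟨i, hi⟩ | ⟨i, hi⟩
  · refine ⟨expAd x l (jumpReal (ρ₁ l.re) (ρ₂ l.re)), by rw [det_expAd, det_jumpReal],
      fun Mp Mm h _ _ => ?_⟩
    have h1 := h l.re
    rwa [show ((l.re : ℝ) : ℂ) = l from Complex.ext (by simp) (by simp [h0])] at h1
  · exact ⟨_, by rw [det_expAd, det_jumpUp], fun Mp Mm _ h _ => h i l hi⟩
  · exact ⟨_, by rw [det_expAd, det_jumpDown], fun Mp Mm _ _ h => h i l hi⟩

/-- The jumps are unimodular, so both boundary values of `det M` agree, and Liouville's theorem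
applies. -/
lemma IsSolution.det_eq_one (hr : ∀ i, 0 < r i) (hz : ∀ i, r i < (z i).im)
    (hd : ∀ i j, i ≠ j → r i + r j < dist (z i) (z j))
    (h : IsSolution x ρ₁ ρ₂ z r C M) {w : ℂ} (hw : w ∉ contour z r) : (M w).det = 1 := by
  obtain ⟨Mp, Mm, cp, -, lp, lm, j1, j2, j3⟩ := h.jump
  have hdet : Continuous fun A : Matrix (Fin 3) (Fin 3) ℂ => A.det := continuous_id.matrix_det
  refine eq_const_of_no_jump hr hz hd (f := fun w => (M w).det) (g := fun w => (Mp w).det) ?_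
    (hdet.comp_continuousOn cp) (fun l hl => (hdet.tendsto _).comp (lp l hl)) (fun l hl => ?_) ?_ hw
  · have ha := h.analytic
    simp only [Matrix.det_fin_three]
    fun_prop
  · obtain ⟨V, hV, hj⟩ := exists_jump_matrix x ρ₁ ρ₂ C hl
    have := (hdet.tendsto _).comp (lm l hl)
    rwa [show (Mm l).det = (Mp l).det by rw [hj Mp Mm j1 j2 j3, Matrix.det_mul, hV, mul_one]] at this
  · have := (hdet.tendsto 1).comp h.tendsto_one
    rwa [Matrix.det_one] at this

/-- Two solutions of the Riemann–Hilbert problem agree. -/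
theorem IsSolution.unique (hr : ∀ i, 0 < r i) (hz : ∀ i, r i < (z i).im)
    (hd : ∀ i j, i ≠ j → r i + r j < dist (z i) (z j))
    (h : IsSolution x ρ₁ ρ₂ z r C M) (h' : IsSolution x ρ₁ ρ₂ z r C M') :
    EqOn M' M (contour z r)ᶜ := by
  intro w hw
  have hdet := h.det_eq_one hr hz hd hw
  obtain ⟨Mp, Mm, cp, -, lp, lm, j1, j2, j3⟩ := h.jump
  obtain ⟨Mp', Mm', cp', -, lp', lm', j1', j2', j3'⟩ := h'.jump
  -- The adjugate replaces the inverse: it is polynomial in the entries, so it needs no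
  -- invertibility on Γ. With the common jump `V` the factor `V * adjugate V = det V = 1` drops out.
  have key : M' w * (M w).adjugate = 1 := by
    ext i j
    refine eq_const_of_no_jump hr hz hd (f := fun w => (M' w * (M w).adjugate) i j)
      (g := fun w => (Mp' w * (Mp w).adjugate) i j) ?_
      (fun l hl => tendsto_mul_adjugate (cp' l hl) (cp l hl) i j)
      (fun l hl => tendsto_mul_adjugate (lp' l hl) (lp l hl) i j)
      (fun l hl => ?_) ?_ hw
    · have ha := h.analytic
      have ha' := h'.analytic
      simp only [Matrix.mul_apply]
      exact DifferentiableOn.fun_sum fun k _ =>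
        (ha' i k).mul (differentiableOn_adjugate_apply ha k j)
    · obtain ⟨V, hV, hj⟩ := exists_jump_matrix x ρ₁ ρ₂ C hl
      have h1 := tendsto_mul_adjugate (lm' l hl) (lm l hl) i j
      have h2 : Mp' l * (Mp l).adjugate = Mm' l * (Mm l).adjugate := by
        rw [hj Mp Mm j1 j2 j3, hj Mp' Mm' j1' j2' j3', Matrix.adjugate_mul_distrib,
          Matrix.mul_assoc, ← Matrix.mul_assoc V, Matrix.mul_adjugate, hV, one_smul,
          Matrix.one_mul]
      rw [h2]
      exact h1
    · have := tendsto_mul_adjugate h'.tendsto_one h.tendsto_one i j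
      simpa using this
  calc M' w = M' w * ((M w).adjugate * M w) := by
        rw [Matrix.adjugate_mul, hdet, one_smul, Matrix.mul_one]
    _ = M w := by rw [← Matrix.mul_assoc, key, Matrix.one_mul]

end

end ManakovRHP

/-! ### The matrix problem on the line and unipotent factors -/

namespace ManakovRHP

/-- Solvability of the Riemann–Hilbert problem on the real line, without circles. -/
theorem exists_real_line {ρ₁ ρ₂ : ℝ → ℂ} (h₁ : IsRegular ρ₁) (h₂ : IsRegular ρ₂) :
    ∃ A B : ℂ → Matrix (Fin 3) (Fin 3) ℂ,
      (∀ i j, IsDecaying fun z => A z i j - (1 : Matrix (Fin 3) (Fin 3) ℂ) i j) ∧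
      (∀ i j, IsDecaying fun z => B (-z) i j - (1 : Matrix (Fin 3) (Fin 3) ℂ) i j) ∧
      ∀ t : ℝ, A t = B t * jumpReal (ρ₁ t) (ρ₂ t) := by
  -- The jump acts from the right, so the rows are independent; row `i` tends to the `i`-th unit
  -- vector.
  choose p m hp hm h using fun i : Fin 3 =>
    exists_row h₁ h₂ ((1 : Matrix (Fin 3) (Fin 3) ℂ) i)
  refine ⟨fun z => Matrix.of fun i j => (1 : Matrix (Fin 3) (Fin 3) ℂ) i j + p i j z,
    fun z => Matrix.of fun i j => (1 : Matrix (Fin 3) (Fin 3) ℂ) i j + m i j (-z),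
    fun i j => by simpa using hp i j, fun i j => by simpa using hm i j, fun t => ?_⟩
  ext i j
  obtain ⟨e1, e2, e0⟩ := h i t
  rw [e1, e2] at e0
  fin_cases j
  · simp only [Fin.zero_eta, Matrix.of_apply, Matrix.mul_apply, Fin.sum_univ_three, jumpReal,
      Matrix.cons_val]
    rw [e0]
    push_cast
    rw [← Complex.conj_mul', ← Complex.conj_mul']
    ring
  · simp only [Fin.mk_one, Matrix.of_apply, Matrix.mul_apply, Fin.sum_univ_three, jumpReal,
      Matrix.cons_val]
    rw [e1]
    ring
  · simp only [Fin.reduceFinMk, Matrix.of_apply, Matrix.mul_apply, Fin.sum_univ_three, jumpReal,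
      Matrix.cons_val]
    rw [e2]
    ring

/-- Block lower triangular unipotent matrices. -/
def lowerUnip (p : Fin 2 → ℂ) : Matrix (Fin 3) (Fin 3) ℂ := !![1, 0, 0; p 0, 1, 0; p 1, 0, 1]

/-- Block upper triangular unipotent matrices. -/
def upperUnip (p : Fin 2 → ℂ) : Matrix (Fin 3) (Fin 3) ℂ := !![1, p 0, p 1; 0, 1, 0; 0, 0, 1]

lemma lowerUnip_mul (p q : Fin 2 → ℂ) : lowerUnip p * lowerUnip q = lowerUnip (p + q) := by
  ext i j
  fin_cases i <;> fin_cases j <;> simp [lowerUnip, Matrix.mul_apply, Fin.sum_univ_three]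

lemma upperUnip_mul (p q : Fin 2 → ℂ) : upperUnip p * upperUnip q = upperUnip (p + q) := by
  ext i j
  fin_cases i <;> fin_cases j <;> simp [upperUnip, Matrix.mul_apply, Fin.sum_univ_three, add_comm]

lemma expAd_jumpUp (x : ℝ) (w : ℂ) (c : Fin 2 → ℂ) (l : ℂ) :
    expAd x l (jumpUp w c l) = lowerUnip fun k => Complex.exp (2 * I * x * l) * (c k / (l - w)) := by
  have e : Complex.exp (2 * I * x * l) = Complex.exp (I * l * x) * Complex.exp (I * l * x) := by
    rw [← Complex.exp_add]; ring_nf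
  have e' : Complex.exp (-(I * l * x)) * Complex.exp (I * l * x) = 1 := by
    rw [← Complex.exp_add]; simp
  ext i j
  fin_cases i <;> fin_cases j <;>
    simp [expAd, expSig, jumpUp, lowerUnip, Matrix.diagonal_mul, Matrix.mul_diagonal, sig, e, e',
      mul_comm (Complex.exp (I * l * x)) (Complex.exp (-(I * l * x)))]
  all_goals ring

lemma expAd_jumpDown (x : ℝ) (w : ℂ) (c : Fin 2 → ℂ) (l : ℂ) :
    expAd x l (jumpDown w c l) =
      upperUnip fun k => Complex.exp (-(2 * I * x * l)) * (conj (c k) / (l - conj w)) := by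
  have e : Complex.exp (-(2 * I * x * l)) =
      Complex.exp (-(I * l * x)) * Complex.exp (-(I * l * x)) := by
    rw [← Complex.exp_add]; ring_nf
  have e' : Complex.exp (-(I * l * x)) * Complex.exp (I * l * x) = 1 := by
    rw [← Complex.exp_add]; simp
  ext i j
  fin_cases i <;> fin_cases j <;>
    simp [expAd, expSig, jumpDown, upperUnip, Matrix.diagonal_mul, Matrix.mul_diagonal, sig, e, e',
      mul_comm (Complex.exp (I * l * x)) (Complex.exp (-(I * l * x)))]
  all_goals ring

/-- The second factor is the adjoint of the first, so the jump is positive definite. Since unipotent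
factors of one type multiply by adding their entries, outer multiplication by such factors shifts
the reflection coefficient. -/
lemma jumpReal_eq (a b : ℂ) :
    jumpReal a b = upperUnip ![conj a, conj b] * lowerUnip ![a, b] := by
  ext i j
  fin_cases i <;> fin_cases j <;>
    simp [jumpReal, upperUnip, lowerUnip, Matrix.mul_apply, Fin.sum_univ_three, Complex.conj_mul']

/-- On the line the exponentials are unimodular: `x` only changes the phase of the reflection
coefficients. -/
lemma expAd_jumpReal (x t : ℝ) (a b : ℂ) : expAd x t (jumpReal a b) =
    jumpReal (Complex.exp (2 * I * x * t) * a) (Complex.exp (2 * I * x * t) * b) := by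
  have e : Complex.exp (2 * I * x * t) = Complex.exp (I * t * x) * Complex.exp (I * t * x) := by
    rw [← Complex.exp_add]; ring_nf
  have e' : Complex.exp (-(I * t * x)) * Complex.exp (I * t * x) = 1 := by
    rw [← Complex.exp_add]; simp
  have e2 : conj (Complex.exp (I * t * x)) = Complex.exp (-(I * t * x)) := by
    rw [← Complex.exp_conj]; simp
  have e3 : ‖Complex.exp (I * t * x)‖ = 1 := by
    rw [show I * t * x = ((t * x : ℝ) : ℂ) * I by push_cast; ring]
    exact Complex.norm_exp_ofReal_mul_I _
  have e4 := mul_comm (Complex.exp (I * t * x)) (Complex.exp (-(I * t * x)))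
  ext i j
  fin_cases i <;> fin_cases j <;>
    simp [expAd, expSig, jumpReal, Matrix.diagonal_mul, Matrix.mul_diagonal, sig, e, e', e2, e3, e4]
  all_goals first
    | ring1
    | linear_combination e'
    | linear_combination (1 + (‖a‖ : ℂ) ^ 2 + (‖b‖ : ℂ) ^ 2) * e'

end ManakovRHP

/-! ### Dressing functions -/

namespace ManakovRHP

/-- The scalar function with residue `e^{2ixw}` at `w`, used outside the circle around `w`. -/
noncomputable def outerPole (x : ℝ) (w v : ℂ) : ℂ :=
  Complex.exp (2 * I * x * w) * ((v - w)⁻¹ - (v - conj w)⁻¹)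

/-- The function `outerPole x w v - e^{2ixv} / (v - w)`, which is analytic at `w`. -/
noncomputable def innerPole (x : ℝ) (w v : ℂ) : ℂ :=
  -(Complex.exp (2 * I * x * w) * (v - conj w)⁻¹) - dslope (fun u => Complex.exp (2 * I * x * u)) w v

/-- The difference is the scalar entry in `expAd_jumpUp`, so switching between the two functions at
the circle creates exactly the required jump. -/
lemma outerPole_eq_innerPole_add (x : ℝ) {w v : ℂ} (h : v ≠ w) :
    outerPole x w v = innerPole x w v + Complex.exp (2 * I * x * v) / (v - w) := by
  have h' : v - w ≠ 0 := sub_ne_zero.2 h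
  rw [outerPole, innerPole, dslope_of_ne _ h, slope_def_field]
  field_simp
  ring

lemma differentiableAt_outerPole (x : ℝ) {w v : ℂ} (h : v ≠ w) (h' : v ≠ conj w) :
    DifferentiableAt ℂ (outerPole x w) v := by
  have h1 : v - w ≠ 0 := sub_ne_zero.2 h
  have h2 : v - conj w ≠ 0 := sub_ne_zero.2 h'
  unfold outerPole
  fun_prop (disch := assumption)

lemma differentiableAt_innerPole (x : ℝ) {w v : ℂ} (h' : v ≠ conj w) :
    DifferentiableAt ℂ (innerPole x w) v := by
  have h2 : v - conj w ≠ 0 := sub_ne_zero.2 h'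
  have h3 : Differentiable ℂ (dslope (fun u : ℂ => Complex.exp (2 * I * x * u)) w) := by
    rw [← differentiableOn_univ, differentiableOn_dslope univ_mem]
    fun_prop
  have h4 := h3 v
  unfold innerPole
  fun_prop (disch := assumption)

lemma isBigO_sub_inv (a : ℂ) : (fun v : ℂ => (v - a)⁻¹) =O[cobounded ℂ] fun v => v⁻¹ := by
  refine IsBigO.of_bound 2 ?_
  filter_upwards [tendsto_norm_cobounded_atTop.eventually_ge_atTop (2 * ‖a‖ + 1)] with v hv
  have h1 : ‖v‖ ≤ ‖v - a‖ + ‖a‖ := by simpa using norm_add_le (v - a) a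
  have h0 := norm_nonneg a
  have h2 : 0 < ‖v‖ := by linarith
  have h3 : 0 < ‖v - a‖ := by linarith
  rw [norm_inv, norm_inv, inv_eq_one_div, inv_eq_one_div, mul_one_div, div_le_div_iff₀ h3 h2]
  linarith

lemma isBigO_outerPole (x : ℝ) (w : ℂ) : outerPole x w =O[cobounded ℂ] fun v => v⁻¹ :=
  ((isBigO_sub_inv w).sub (isBigO_sub_inv (conj w))).const_mul_left _

open Classical in
/-- The dressing function: `innerPole` in the disc and `outerPole` outside. -/
noncomputable def dressPole (x : ℝ) (w : ℂ) (s : ℝ) (v : ℂ) : ℂ :=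
  if dist v w < s then innerPole x w v else outerPole x w v

lemma dressPole_of_lt (x : ℝ) {w : ℂ} {s : ℝ} {v : ℂ} (h : dist v w < s) :
    dressPole x w s v = innerPole x w v := if_pos h

lemma dressPole_of_le (x : ℝ) {w : ℂ} {s : ℝ} {v : ℂ} (h : s ≤ dist v w) :
    dressPole x w s v = outerPole x w v := if_neg (not_lt.2 h)

lemma ne_conj_of_im_pos {w v : ℂ} (hw : 0 < w.im) (hv : 0 ≤ v.im) : v ≠ conj w := fun h => by
  rw [h, conj_im] at hv; linarith

lemma differentiableAt_dressPole (x : ℝ) {w : ℂ} {s : ℝ} {v : ℂ} (hs : 0 < s) (hw : 0 < w.im)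
    (hv : 0 ≤ v.im) (hvs : dist v w ≠ s) : DifferentiableAt ℂ (dressPole x w s) v := by
  have hc : Continuous fun v => dist v w := continuous_id.dist continuous_const
  have h' := ne_conj_of_im_pos hw hv
  rcases lt_or_gt_of_ne hvs with h | h
  · refine (differentiableAt_innerPole x h').congr_of_eventuallyEq ?_
    filter_upwards [(isOpen_lt hc continuous_const).mem_nhds h] with u hu
    exact dressPole_of_lt x hu
  · have hne : v ≠ w := fun h0 => by rw [h0, dist_self] at h; linarith
    refine (differentiableAt_outerPole x hne h').congr_of_eventuallyEq ?_
    filter_upwards [(isOpen_lt continuous_const hc).mem_nhds h] with u hu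
    exact dressPole_of_le x (le_of_lt hu)

lemma tendsto_dressPole_outer (x : ℝ) {w : ℂ} {s : ℝ} {l : ℂ} {F : Filter ℂ} (hF : F ≤ 𝓝 l)
    (hs : 0 < s) (hw : 0 < w.im) (hl : 0 ≤ l.im) (hls : s ≤ dist l w)
    (h : ∀ᶠ v in F, s < dist v w) : Tendsto (dressPole x w s) F (𝓝 (outerPole x w l)) := by
  have hne : l ≠ w := fun h0 => by rw [h0, dist_self] at hls; linarith
  have h1 := (differentiableAt_outerPole x hne (ne_conj_of_im_pos hw hl)).continuousAt.tendsto
  refine (h1.mono_left hF).congr' ?_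
  filter_upwards [h] with v hv
  exact (dressPole_of_le x hv.le).symm

lemma tendsto_dressPole_inner (x : ℝ) {w : ℂ} {s : ℝ} {l : ℂ} {F : Filter ℂ} (hF : F ≤ 𝓝 l)
    (hw : 0 < w.im) (hl : 0 ≤ l.im) (h : ∀ᶠ v in F, dist v w < s) :
    Tendsto (dressPole x w s) F (𝓝 (innerPole x w l)) := by
  have h1 := (differentiableAt_innerPole x (ne_conj_of_im_pos hw hl)).continuousAt.tendsto
  refine (h1.mono_left hF).congr' ?_
  filter_upwards [h] with v hv
  exact (dressPole_of_lt x hv).symm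

/-- Near infinity only the outer function occurs. Its exponential is frozen at `w`, so it is
rational in `v` and decays for either sign of `x`. -/
lemma dressPole_eventuallyEq (x : ℝ) (w : ℂ) (s : ℝ) :
    dressPole x w s =ᶠ[cobounded ℂ] outerPole x w := by
  filter_upwards [tendsto_norm_cobounded_atTop.eventually_ge_atTop (s + ‖w‖)] with v hv
  refine dressPole_of_le x ?_
  rw [dist_eq_norm]
  have := norm_sub_norm_le v w
  linarith

section
variable {n : ℕ} (x : ℝ) (z : Fin n → ℂ) (r : Fin n → ℝ) (C : Fin n → Fin 2 → ℂ)
  (A B : ℂ → Matrix (Fin 3) (Fin 3) ℂ)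

/-- The linear combination of scalars `p i` with the vectors `C i`. -/
def comb (C : Fin n → Fin 2 → ℂ) (p : Fin n → ℂ) (k : Fin 2) : ℂ := ∑ i, C i k * p i

open Classical in
/-- The solution of the problem with circles, from the solution `A`, `B` of a problem on the
line. -/
noncomputable def dress (v : ℂ) : Matrix (Fin 3) (Fin 3) ℂ :=
  if 0 < v.im then A v * lowerUnip (comb C fun i => dressPole x (z i) (r i) v)
  -- The scalar is reflected by conjugating argument and value, which preserves analyticity. Real
  -- `v` also fall into this branch, but they lie on Γ, where the values are irrelevant.
  else B v * upperUnip fun k => -conj (comb C (fun i => dressPole x (z i) (r i) (conj v)) k)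

lemma dress_of_pos {v : ℂ} (h : 0 < v.im) : dress x z r C A B v =
    A v * lowerUnip (comb C fun i => dressPole x (z i) (r i) v) := if_pos h

lemma dress_of_neg {v : ℂ} (h : v.im < 0) : dress x z r C A B v =
    B v * upperUnip fun k => -conj (comb C (fun i => dressPole x (z i) (r i) (conj v)) k) :=
  if_neg h.not_gt

variable {x z r C A B}

lemma continuous_lowerUnip : Continuous lowerUnip := by
  refine continuous_matrix fun i j => ?_
  fin_cases i <;> fin_cases j <;> simp [lowerUnip] <;> fun_prop

lemma continuous_upperUnip : Continuous upperUnip := by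
  refine continuous_matrix fun i j => ?_
  fin_cases i <;> fin_cases j <;> simp [upperUnip] <;> fun_prop

lemma tendsto_comb {F : Filter ℂ} {q : Fin n → ℂ → ℂ} {p : Fin n → ℂ}
    (h : ∀ i, Tendsto (q i) F (𝓝 (p i))) (k : Fin 2) :
    Tendsto (fun v => comb C (fun i => q i v) k) F (𝓝 (comb C p k)) :=
  tendsto_finsetSum _ fun i _ => (h i).const_mul _

lemma tendsto_matrix_mul {F : Filter ℂ} {P Q : ℂ → Matrix (Fin 3) (Fin 3) ℂ}
    {a b : Matrix (Fin 3) (Fin 3) ℂ} (hP : Tendsto P F (𝓝 a)) (hQ : Tendsto Q F (𝓝 b)) :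
    Tendsto (fun v => P v * Q v) F (𝓝 (a * b)) := by
  refine tendsto_pi_nhds.2 fun i => tendsto_pi_nhds.2 fun j => ?_
  simp only [Matrix.mul_apply]
  exact tendsto_finsetSum _ fun k _ => (tendsto_entry hP i k).mul (tendsto_entry hQ k j)

lemma tendsto_dress_upper {F : Filter ℂ} {a : Matrix (Fin 3) (Fin 3) ℂ} {p : Fin n → ℂ}
    (hF : ∀ᶠ v in F, 0 < v.im) (hA : Tendsto A F (𝓝 a))
    (hp : ∀ i, Tendsto (dressPole x (z i) (r i)) F (𝓝 (p i))) :
    Tendsto (dress x z r C A B) F (𝓝 (a * lowerUnip (comb C p))) := by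
  have h1 : Tendsto (fun v => lowerUnip (comb C fun i => dressPole x (z i) (r i) v)) F
      (𝓝 (lowerUnip (comb C p))) :=
    (continuous_lowerUnip.tendsto _).comp (tendsto_pi_nhds.2 fun k => tendsto_comb hp k)
  refine (tendsto_matrix_mul hA h1).congr' ?_
  filter_upwards [hF] with v hv
  exact (dress_of_pos x z r C A B hv).symm

lemma tendsto_dress_lower {F : Filter ℂ} {b : Matrix (Fin 3) (Fin 3) ℂ} {p : Fin n → ℂ}
    (hF : ∀ᶠ v in F, v.im < 0) (hB : Tendsto B F (𝓝 b))
    (hp : ∀ i, Tendsto (dressPole x (z i) (r i)) (map conj F) (𝓝 (p i))) :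
    Tendsto (dress x z r C A B) F (𝓝 (b * upperUnip fun k => -conj (comb C p k))) := by
  have h1 : Tendsto (fun v => upperUnip fun k =>
      -conj (comb C (fun i => dressPole x (z i) (r i) (conj v)) k)) F
      (𝓝 (upperUnip fun k => -conj (comb C p k))) := by
    refine (continuous_upperUnip.tendsto _).comp (tendsto_pi_nhds.2 fun k => ?_)
    have h2 : Tendsto (fun v => comb C (fun i => dressPole x (z i) (r i) (conj v)) k) F
      (𝓝 (comb C p k)) := tendsto_comb (q := fun i v => dressPole x (z i) (r i) (conj v)) hp k
    exact ((continuous_conj.tendsto _).comp h2).neg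
  refine (tendsto_matrix_mul hB h1).congr' ?_
  filter_upwards [hF] with v hv
  exact (dress_of_neg x z r C A B hv).symm

end

end ManakovRHP

/-! ### Analyticity and asymptotics of the dressed solution -/

namespace ManakovRHP

lemma IsDecaying.tendsto_nhds {f : ℂ → ℂ} (h : IsDecaying f) {F : Filter ℂ} {l : ℂ} (hF : F ≤ 𝓝 l)
    (hl : 0 ≤ l.im) (hF0 : ∀ᶠ v in F, 0 < v.im) : Tendsto f F (𝓝 (f l)) :=
  (h.continuousOn l hl).mono_left
    (le_inf hF (le_principal_iff.2 (hF0.mono fun _ hv => le_of_lt hv)))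

lemma IsDecaying.tendsto_zero {f : ℂ → ℂ} (h : IsDecaying f) {F : Filter ℂ} (hF : F ≤ cobounded ℂ)
    (hF0 : ∀ᶠ v in F, 0 < v.im) : Tendsto f F (𝓝 0) :=
  h.tendsto.mono_left (le_inf hF (le_principal_iff.2 (hF0.mono fun _ hv => le_of_lt hv)))

lemma tendsto_of_sub_one {F : Filter ℂ} {A : ℂ → Matrix (Fin 3) (Fin 3) ℂ}
    {a : Matrix (Fin 3) (Fin 3) ℂ} (h : ∀ i j, Tendsto
      (fun v => A v i j - (1 : Matrix (Fin 3) (Fin 3) ℂ) i j) F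
      (𝓝 (a i j - (1 : Matrix (Fin 3) (Fin 3) ℂ) i j))) : Tendsto A F (𝓝 a) := by
  refine tendsto_pi_nhds.2 fun i => tendsto_pi_nhds.2 fun j => ?_
  simpa using (h i j).add_const ((1 : Matrix (Fin 3) (Fin 3) ℂ) i j)

lemma tendsto_conj_cobounded : Tendsto (fun v : ℂ => conj v) (cobounded ℂ) (cobounded ℂ) := by
  rw [← tendsto_norm_atTop_iff_cobounded]
  simpa using tendsto_norm_cobounded_atTop (E := ℂ)

section
variable {n : ℕ} {x : ℝ} {z : Fin n → ℂ} {r : Fin n → ℝ} {C : Fin n → Fin 2 → ℂ}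
  {A B : ℂ → Matrix (Fin 3) (Fin 3) ℂ}

lemma tendsto_upper (hA : ∀ i j, IsDecaying fun z => A z i j - (1 : Matrix (Fin 3) (Fin 3) ℂ) i j)
    {F : Filter ℂ} {l : ℂ} (hF : F ≤ 𝓝 l) (hl : 0 ≤ l.im) (hF0 : ∀ᶠ v in F, 0 < v.im) :
    Tendsto A F (𝓝 (A l)) :=
  tendsto_of_sub_one fun i j => (hA i j).tendsto_nhds hF hl hF0

lemma tendsto_lower
    (hB : ∀ i j, IsDecaying fun z => B (-z) i j - (1 : Matrix (Fin 3) (Fin 3) ℂ) i j)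
    {F : Filter ℂ} {l : ℂ} (hF : F ≤ 𝓝 l) (hl : l.im ≤ 0) (hF0 : ∀ᶠ v in F, v.im < 0) :
    Tendsto B F (𝓝 (B l)) := by
  have h1 : map (fun v : ℂ => -v) F ≤ 𝓝 (-l) := (map_mono hF).trans (continuous_neg.tendsto l)
  refine tendsto_of_sub_one fun i j => ?_
  have h2 := ((hB i j).tendsto_nhds h1 (by simpa using hl)
    (eventually_map.2 (hF0.mono fun v hv => by simpa using hv)))
  simpa [Function.comp_def] using tendsto_map'_iff.1 h2

lemma tendsto_upper_one
    (hA : ∀ i j, IsDecaying fun z => A z i j - (1 : Matrix (Fin 3) (Fin 3) ℂ) i j)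
    {F : Filter ℂ} (hF : F ≤ cobounded ℂ) (hF0 : ∀ᶠ v in F, 0 < v.im) :
    Tendsto A F (𝓝 1) :=
  tendsto_of_sub_one fun i j => by simpa using (hA i j).tendsto_zero hF hF0

lemma tendsto_lower_one
    (hB : ∀ i j, IsDecaying fun z => B (-z) i j - (1 : Matrix (Fin 3) (Fin 3) ℂ) i j)
    {F : Filter ℂ} (hF : F ≤ cobounded ℂ) (hF0 : ∀ᶠ v in F, v.im < 0) :
    Tendsto B F (𝓝 1) := by
  have h1 : map (fun v : ℂ => -v) F ≤ cobounded ℂ :=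
    (map_mono hF).trans tendsto_neg_cobounded
  refine tendsto_of_sub_one fun i j => ?_
  have h2 := ((hB i j).tendsto_zero h1
    (eventually_map.2 (hF0.mono fun v hv => by simpa using hv)))
  simpa [Function.comp_def] using tendsto_map'_iff.1 h2

lemma mul_lowerUnip_apply (P : Matrix (Fin 3) (Fin 3) ℂ) (p : Fin 2 → ℂ) (i j : Fin 3) :
    (P * lowerUnip p) i j = P i j + if j = 0 then P i 1 * p 0 + P i 2 * p 1 else 0 := by
  fin_cases j <;> simp [lowerUnip, Matrix.mul_apply, Fin.sum_univ_three, add_assoc]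

lemma mul_upperUnip_apply (P : Matrix (Fin 3) (Fin 3) ℂ) (p : Fin 2 → ℂ) (i j : Fin 3) :
    (P * upperUnip p) i j = P i j + P i 0 * (![0, p 0, p 1] : Fin 3 → ℂ) j := by
  fin_cases j <;> simp [upperUnip, Matrix.mul_apply, Fin.sum_univ_three]
  all_goals ring

lemma differentiableOn_dress (hr : ∀ i, 0 < r i) (hz : ∀ i, r i < (z i).im)
    (hA : ∀ i j, IsDecaying fun z => A z i j - (1 : Matrix (Fin 3) (Fin 3) ℂ) i j)
    (hB : ∀ i j, IsDecaying fun z => B (-z) i j - (1 : Matrix (Fin 3) (Fin 3) ℂ) i j)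
    (i j : Fin 3) : DifferentiableOn ℂ (fun w => dress x z r C A B w i j) (contour z r)ᶜ := by
  intro w hw
  refine DifferentiableAt.differentiableWithinAt ?_
  have hw' : w ∉ contour z r := hw
  rw [mem_contour] at hw'
  push Not at hw'
  obtain ⟨h0, h1, h2⟩ := hw'
  have hzi : ∀ i, 0 < (z i).im := fun i => (hr i).trans (hz i)
  have hcomb : ∀ v : ℂ, 0 < v.im → (∀ i, dist v (z i) ≠ r i) → ∀ k, DifferentiableAt ℂ
      (fun v => comb C (fun i => dressPole x (z i) (r i) v) k) v := fun v hv hvs k => by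
    refine DifferentiableAt.fun_sum fun i _ => ?_
    exact (differentiableAt_dressPole x (hr i) (hzi i) hv.le (hvs i)).const_mul _
  rcases lt_or_gt_of_ne h0 with h | h
  · have hopen := (isOpen_lt continuous_im continuous_const).mem_nhds h
    have hBd : ∀ i j, DifferentiableAt ℂ (fun v => B v i j) w := fun i j => by
      have e1 := (hB i j).differentiableOn.differentiableAt (x := -w)
        ((isOpen_lt continuous_const continuous_im).mem_nhds (by simpa using h))
      have e2 := (e1.comp w differentiableAt_id.neg).add_const
        ((1 : Matrix (Fin 3) (Fin 3) ℂ) i j)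
      simpa [Function.comp_def] using e2
    have hq : ∀ k, DifferentiableAt ℂ
        (fun v => -conj (comb C (fun i => dressPole x (z i) (r i) (conj v)) k)) w := fun k => by
      have e1 := hcomb (conj w) (by simpa using h) (fun i => by
        rw [dist_conj_left]; exact h2 i) k
      have e2 := e1.conj_conj
      rw [conj_conj] at e2
      exact e2.neg
    refine DifferentiableAt.congr_of_eventuallyEq (f := fun v => B v i j + B v i 0 *
      (![0, -conj (comb C (fun i => dressPole x (z i) (r i) (conj v)) 0),
        -conj (comb C (fun i => dressPole x (z i) (r i) (conj v)) 1)] : Fin 3 → ℂ) j)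
      ?_ (mem_of_superset hopen fun v hv => by
        simp only [mem_ofPred_eq]
        rw [dress_of_neg x z r C A B hv, mul_upperUnip_apply])
    refine (hBd i j).add ((hBd i 0).mul ?_)
    fin_cases j
    · exact differentiableAt_const 0
    · exact hq 0
    · exact hq 1
  · have hopen := (isOpen_lt continuous_const continuous_im).mem_nhds h
    have hAd : ∀ i j, DifferentiableAt ℂ (fun v => A v i j) w := fun i j => by
      have e1 := (hA i j).differentiableOn.differentiableAt hopen
      simpa using e1.add_const ((1 : Matrix (Fin 3) (Fin 3) ℂ) i j)
    have hq := hcomb w h h1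
    refine DifferentiableAt.congr_of_eventuallyEq (f := fun v => A v i j + if j = 0 then
      A v i 1 * comb C (fun i => dressPole x (z i) (r i) v) 0 +
        A v i 2 * comb C (fun i => dressPole x (z i) (r i) v) 1 else 0)
      ?_ (mem_of_superset hopen fun v hv => by
        simp only [mem_ofPred_eq]
        rw [dress_of_pos x z r C A B hv, mul_lowerUnip_apply])
    refine (hAd i j).add ?_
    split_ifs
    · exact ((hAd i 1).mul (hq 0)).add ((hAd i 2).mul (hq 1))
    · exact differentiableAt_const 0

lemma isBigO_dressPole (x : ℝ) (w : ℂ) (s : ℝ) :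
    dressPole x w s =O[cobounded ℂ] fun v => v⁻¹ :=
  (dressPole_eventuallyEq x w s).trans_isBigO (isBigO_outerPole x w)

lemma isBigO_comb (x : ℝ) (z : Fin n → ℂ) (r : Fin n → ℝ) (C : Fin n → Fin 2 → ℂ) (k : Fin 2) :
    (fun v => comb C (fun i => dressPole x (z i) (r i) v) k) =O[cobounded ℂ] fun v => v⁻¹ :=
  IsBigO.fun_sum fun i _ => (isBigO_dressPole x (z i) (r i)).const_mul_left _

lemma tendsto_dressPole_zero (x : ℝ) (w : ℂ) (s : ℝ) :
    Tendsto (dressPole x w s) (cobounded ℂ) (𝓝 0) :=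
  (isBigO_dressPole x w s).trans_tendsto tendsto_inv₀_cobounded

lemma tendsto_dress_one
    (hA : ∀ i j, IsDecaying fun z => A z i j - (1 : Matrix (Fin 3) (Fin 3) ℂ) i j)
    (hB : ∀ i j, IsDecaying fun z => B (-z) i j - (1 : Matrix (Fin 3) (Fin 3) ℂ) i j) :
    Tendsto (dress x z r C A B) (cobounded ℂ ⊓ 𝓟 (contour z r)ᶜ) (𝓝 1) := by
  have hc0 : comb C (fun _ => 0) = 0 := by ext k; simp [comb]
  have hl0 : lowerUnip 0 = 1 := by
    ext i j; fin_cases i <;> fin_cases j <;> simp [lowerUnip]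
  have hu0 : upperUnip 0 = 1 := by
    ext i j; fin_cases i <;> fin_cases j <;> simp [upperUnip]
  have h1 : Tendsto (dress x z r C A B) (cobounded ℂ ⊓ 𝓟 {v | 0 < v.im}) (𝓝 1) := by
    have hp : ∀ᶠ v in cobounded ℂ ⊓ 𝓟 {v : ℂ | 0 < v.im}, 0 < v.im :=
      mem_inf_of_right (mem_principal_self _)
    have := tendsto_dress_upper (B := B) (C := C) hp (tendsto_upper_one hA inf_le_left hp)
      (fun i => (tendsto_dressPole_zero x (z i) (r i)).mono_left inf_le_left)
    rwa [hc0, hl0, Matrix.one_mul] at this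
  have h2 : Tendsto (dress x z r C A B) (cobounded ℂ ⊓ 𝓟 {v | v.im < 0}) (𝓝 1) := by
    have hp : ∀ᶠ v in cobounded ℂ ⊓ 𝓟 {v : ℂ | v.im < 0}, v.im < 0 :=
      mem_inf_of_right (mem_principal_self _)
    have := tendsto_dress_lower (A := A) (C := C) hp (tendsto_lower_one hB inf_le_left hp)
      (fun i => (tendsto_dressPole_zero x (z i) (r i)).mono_left
        ((map_mono inf_le_left).trans tendsto_conj_cobounded))
    rw [hc0] at this
    simp only [Pi.zero_apply, map_zero, neg_zero] at this
    rwa [show (fun _ : Fin 2 => (0 : ℂ)) = 0 from rfl, hu0, Matrix.one_mul] at this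
  refine (h1.sup h2).mono_left ?_
  rw [← inf_sup_left, sup_principal]
  refine inf_le_inf_left _ (principal_mono.2 fun v hv => ?_)
  have : v.im ≠ 0 := fun h => hv (mem_contour.2 (Or.inl h))
  rcases lt_or_gt_of_ne this with h | h
  · exact Or.inr h
  · exact Or.inl h

lemma isBigO_dress
    (hA : ∀ i j, IsDecaying fun z => A z i j - (1 : Matrix (Fin 3) (Fin 3) ℂ) i j)
    (hB : ∀ i j, IsDecaying fun z => B (-z) i j - (1 : Matrix (Fin 3) (Fin 3) ℂ) i j)
    {δ : ℝ} (hδ : 0 < δ) (i j : Fin 3) :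
    (fun w => dress x z r C A B w i j - (1 : Matrix (Fin 3) (Fin 3) ℂ) i j)
      =O[cobounded ℂ ⊓ 𝓟 {w | δ ≤ |w.im|}] fun w => w⁻¹ := by
  have hsplit : cobounded ℂ ⊓ 𝓟 {w : ℂ | δ ≤ |w.im|} ≤
      (cobounded ℂ ⊓ 𝓟 {w | δ ≤ w.im}) ⊔ (cobounded ℂ ⊓ 𝓟 {w | δ ≤ -w.im}) := by
    rw [← inf_sup_left, sup_principal]
    refine inf_le_inf_left _ (principal_mono.2 fun v hv => ?_)
    exact le_abs.1 (show δ ≤ |v.im| from hv)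
  refine IsBigO.mono (IsBigO.sup ?_ ?_) hsplit
  · have hp : ∀ᶠ v in cobounded ℂ ⊓ 𝓟 {v : ℂ | δ ≤ v.im}, 0 < v.im :=
      mem_inf_of_right (mem_principal.2 fun v hv => hδ.trans_le hv)
    have hA1 := tendsto_upper_one hA inf_le_left hp
    have hb : ∀ k, (fun v => A v i k) =O[cobounded ℂ ⊓ 𝓟 {v : ℂ | δ ≤ v.im}] fun _ => (1 : ℂ) :=
      fun k => (tendsto_entry hA1 i k).isBigO_one ℂ
    have hc : ∀ k, (fun v => comb C (fun i => dressPole x (z i) (r i) v) k)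
        =O[cobounded ℂ ⊓ 𝓟 {v : ℂ | δ ≤ v.im}] fun v => v⁻¹ := fun k =>
      (isBigO_comb x z r C k).mono inf_le_left
    have hm : ∀ k k', (fun v => A v i k * comb C (fun i => dressPole x (z i) (r i) v) k')
        =O[cobounded ℂ ⊓ 𝓟 {v : ℂ | δ ≤ v.im}] fun v => v⁻¹ := fun k k' => by
      simpa using (hb k).mul (hc k')
    have h1 := (hA i j).isBigO δ hδ
    have h2 : (fun v => (A v i j - (1 : Matrix (Fin 3) (Fin 3) ℂ) i j) + if j = 0 then
        A v i 1 * comb C (fun i => dressPole x (z i) (r i) v) 0 +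
        A v i 2 * comb C (fun i => dressPole x (z i) (r i) v) 1 else 0)
        =O[cobounded ℂ ⊓ 𝓟 {v : ℂ | δ ≤ v.im}] fun v => v⁻¹ := by
      refine h1.add ?_
      split_ifs
      · exact (hm 1 0).add (hm 2 1)
      · exact isBigO_zero _ _
    refine h2.congr' (hp.mono fun v hv => ?_) EventuallyEq.rfl
    beta_reduce
    rw [dress_of_pos x z r C A B hv, mul_lowerUnip_apply]
    ring
  · have hp : ∀ᶠ v in cobounded ℂ ⊓ 𝓟 {v : ℂ | δ ≤ -v.im}, v.im < 0 :=
      mem_inf_of_right (mem_principal.2 fun v hv => by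
        have : δ ≤ -v.im := hv
        simp only [mem_ofPred_eq]
        linarith)
    have hB1 := tendsto_lower_one hB inf_le_left hp
    have hb : (fun v => B v i 0) =O[cobounded ℂ ⊓ 𝓟 {v : ℂ | δ ≤ -v.im}] fun _ => (1 : ℂ) :=
      (tendsto_entry hB1 i 0).isBigO_one ℂ
    have hc : ∀ k, (fun v => -conj (comb C (fun i => dressPole x (z i) (r i) (conj v)) k))
        =O[cobounded ℂ ⊓ 𝓟 {v : ℂ | δ ≤ -v.im}] fun v => v⁻¹ := fun k => by
      have e1 := ((isBigO_comb x z r C k).comp_tendsto tendsto_conj_cobounded).mono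
        (inf_le_left (b := 𝓟 {v : ℂ | δ ≤ -v.im}))
      refine IsBigO.neg_left ?_
      rw [← isBigO_norm_norm] at e1 ⊢
      simpa [Function.comp_def] using e1
    have hm : ∀ k, (fun v => B v i 0 *
        -conj (comb C (fun i => dressPole x (z i) (r i) (conj v)) k))
        =O[cobounded ℂ ⊓ 𝓟 {v : ℂ | δ ≤ -v.im}] fun v => v⁻¹ := fun k => by
      simpa using hb.mul (hc k)
    have h1 : (fun v => B v i j - (1 : Matrix (Fin 3) (Fin 3) ℂ) i j)
        =O[cobounded ℂ ⊓ 𝓟 {v : ℂ | δ ≤ -v.im}] fun v => v⁻¹ := by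
      have ht : Tendsto (fun v : ℂ => -v) (cobounded ℂ ⊓ 𝓟 {v : ℂ | δ ≤ -v.im})
          (cobounded ℂ ⊓ 𝓟 {v : ℂ | δ ≤ v.im}) := by
        refine tendsto_inf.2 ⟨tendsto_neg_cobounded.mono_left inf_le_left, tendsto_principal.2 ?_⟩
        exact mem_inf_of_right (mem_principal.2 fun v hv => by simpa using hv)
      have e1 := ((hB i j).isBigO δ hδ).comp_tendsto ht
      rw [← isBigO_norm_norm] at e1 ⊢
      simpa [Function.comp_def] using e1
    have h2 : (fun v => (B v i j - (1 : Matrix (Fin 3) (Fin 3) ℂ) i j) + B v i 0 *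
      (![0, -conj (comb C (fun i => dressPole x (z i) (r i) (conj v)) 0),
        -conj (comb C (fun i => dressPole x (z i) (r i) (conj v)) 1)] : Fin 3 → ℂ) j)
        =O[cobounded ℂ ⊓ 𝓟 {v : ℂ | δ ≤ -v.im}] fun v => v⁻¹ := by
      refine h1.add ?_
      fin_cases j
      · simpa using isBigO_zero (fun v : ℂ => v⁻¹) (cobounded ℂ ⊓ 𝓟 {v : ℂ | δ ≤ -v.im})
      · exact hm 0
      · exact hm 1
    refine h2.congr' (hp.mono fun v hv => ?_) EventuallyEq.rfl
    beta_reduce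
    rw [dress_of_neg x z r C A B hv, mul_upperUnip_apply]
    ring

end

end ManakovRHP

/-! ### Boundary values, jumps and existence -/

namespace ManakovRHP

section
variable {n : ℕ} {x : ℝ} {z : Fin n → ℂ} {r : Fin n → ℝ} {C : Fin n → Fin 2 → ℂ}
  {A B : ℂ → Matrix (Fin 3) (Fin 3) ℂ}

lemma map_conj_le {F : Filter ℂ} {l : ℂ} (hF : F ≤ 𝓝 l) : map (fun v => conj v) F ≤ 𝓝 (conj l) :=
  (map_mono hF).trans (continuous_conj.tendsto l)

lemma eventually_lt_dist {l : ℂ} {p : Fin n → ℂ} {P : Fin n → Prop}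
    (h : ∀ i, P i → r i < dist l (p i)) : ∀ᶠ v in 𝓝 l, ∀ i, P i → r i < dist v (p i) :=
  (isOpen_forall_lt_dist p P).mem_nhds h

lemma lt_dist_conj_of_im_nonneg (hz : ∀ i, r i < (z i).im) {l : ℂ} (hl : 0 ≤ l.im) (i : Fin n) :
    r i < dist l (conj (z i)) := by
  by_contra! h
  exact (im_neg_of_dist_le hz h).not_ge hl

lemma lt_dist_of_im_nonpos (hz : ∀ i, r i < (z i).im) {l : ℂ} (hl : l.im ≤ 0) (i : Fin n) :
    r i < dist l (z i) := by
  by_contra! h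
  exact (im_pos_of_dist_le hz h).not_ge hl

/-- On the real line, the boundary values of `dress` are given by the outer poles. -/
lemma tendsto_dress_real (hr : ∀ i, 0 < r i) (hz : ∀ i, r i < (z i).im)
    (hA : ∀ i j, IsDecaying fun z => A z i j - (1 : Matrix (Fin 3) (Fin 3) ℂ) i j)
    (hB : ∀ i j, IsDecaying fun z => B (-z) i j - (1 : Matrix (Fin 3) (Fin 3) ℂ) i j) (t : ℝ) :
    Tendsto (dress x z r C A B) (𝓝[plusSide z r] t)
      (𝓝 (A t * lowerUnip (comb C fun i => outerPole x (z i) t))) ∧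
    Tendsto (dress x z r C A B) (𝓝[minusSide z r] t)
      (𝓝 (B t * upperUnip fun k => -conj (comb C (fun i => outerPole x (z i) t) k))) := by
  have hzi : ∀ i, 0 < (z i).im := fun i => (hr i).trans (hz i)
  have ht : (t : ℂ).im = 0 := ofReal_im t
  have h1 : ∀ᶠ v in 𝓝 (t : ℂ), ∀ i, True → r i < dist v (z i) :=
    eventually_lt_dist fun i _ => lt_dist_of_im_nonpos hz ht.le i
  have h2 : ∀ᶠ v in 𝓝 (t : ℂ), ∀ i, True → r i < dist v (conj (z i)) :=
    eventually_lt_dist fun i _ => lt_dist_conj_of_im_nonneg hz ht.ge i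
  have hp : ∀ᶠ v in 𝓝[plusSide z r] (t : ℂ), 0 < v.im := by
    filter_upwards [self_mem_nhdsWithin, mem_nhdsWithin_of_mem_nhds h2] with v hv hv2
    rcases mem_plusSide.1 hv with h | ⟨i, hi⟩
    · exact h.1
    · exact absurd hi (hv2 i trivial).not_gt
  have hm : ∀ᶠ v in 𝓝[minusSide z r] (t : ℂ), v.im < 0 := by
    filter_upwards [self_mem_nhdsWithin, mem_nhdsWithin_of_mem_nhds h1] with v hv hv2
    rcases mem_minusSide.1 hv with h | ⟨i, hi⟩
    · exact h.1
    · exact absurd hi (hv2 i trivial).not_gt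
  constructor
  · refine tendsto_dress_upper hp (tendsto_upper hA nhdsWithin_le_nhds ht.ge hp) fun i => ?_
    exact tendsto_dressPole_outer x nhdsWithin_le_nhds (hr i) (hzi i) ht.ge
      (lt_dist_of_im_nonpos hz ht.le i).le
      ((h1.filter_mono nhdsWithin_le_nhds).mono fun v hv => hv i trivial)
  · refine tendsto_dress_lower hm (tendsto_lower hB nhdsWithin_le_nhds ht.le hm) fun i => ?_
    have hF := map_conj_le (nhdsWithin_le_nhds (a := (t : ℂ)) (s := minusSide z r))
    rw [conj_ofReal] at hF
    exact tendsto_dressPole_outer x hF (hr i) (hzi i) ht.ge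
      (lt_dist_of_im_nonpos hz ht.le i).le
      (hF ((h1).mono fun v hv => hv i trivial))

/-- The closed discs are disjoint and lie above the line, so near circle `i` the matrix `A` and all
scalars but the `i`-th are continuous. -/
lemma tendsto_dress_sphere (hr : ∀ i, 0 < r i) (hz : ∀ i, r i < (z i).im)
    (hd : ∀ i j, i ≠ j → r i + r j < dist (z i) (z j))
    (hA : ∀ i j, IsDecaying fun z => A z i j - (1 : Matrix (Fin 3) (Fin 3) ℂ) i j)
    {i : Fin n} {l : ℂ} (hl : dist l (z i) = r i) :
    Tendsto (dress x z r C A B) (𝓝[plusSide z r] l)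
      (𝓝 (A l * lowerUnip (comb C fun i => outerPole x (z i) l))) ∧
    Tendsto (dress x z r C A B) (𝓝[minusSide z r] l)
      (𝓝 (A l * lowerUnip (comb C fun j => if j = i then innerPole x (z j) l
        else outerPole x (z j) l))) := by
  have hzi : ∀ i, 0 < (z i).im := fun i => (hr i).trans (hz i)
  have h0 : 0 < l.im := im_pos_of_dist_le hz hl.le
  have h1 : ∀ᶠ v in 𝓝 l, ∀ j, j ≠ i → r j < dist v (z j) :=
    eventually_lt_dist fun j hj => lt_dist_of_dist_le hd hj hl.le
  have h2 : ∀ᶠ v in 𝓝 l, 0 < v.im := (isOpen_lt continuous_const continuous_im).mem_nhds h0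
  have hp : ∀ᶠ v in 𝓝[plusSide z r] l, ∀ j, r j < dist v (z j) := by
    filter_upwards [self_mem_nhdsWithin, mem_nhdsWithin_of_mem_nhds h2] with v hv hv2
    rcases mem_plusSide.1 hv with h | ⟨i, hi⟩
    · exact h.2
    · exact absurd (im_neg_of_dist_le hz hi.le) hv2.not_gt
  have hm : ∀ᶠ v in 𝓝[minusSide z r] l, dist v (z i) < r i := by
    filter_upwards [self_mem_nhdsWithin, mem_nhdsWithin_of_mem_nhds h1,
      mem_nhdsWithin_of_mem_nhds h2] with v hv hv1 hv2
    rcases mem_minusSide.1 hv with h | ⟨j, hj⟩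
    · exact absurd h.1 hv2.not_gt
    · rcases eq_or_ne j i with rfl | hji
      · exact hj
      · exact absurd hj (hv1 j hji).not_gt
  have hle : ∀ j, r j ≤ dist l (z j) := fun j => by
    rcases eq_or_ne j i with rfl | hji
    · exact hl.ge
    · exact (lt_dist_of_dist_le hd hji hl.le).le
  have key : ∀ S : Set ℂ, ∀ p : Fin n → ℂ,
      (∀ j, Tendsto (dressPole x (z j) (r j)) (𝓝[S] l) (𝓝 (p j))) →
      Tendsto (dress x z r C A B) (𝓝[S] l) (𝓝 (A l * lowerUnip (comb C p))) := fun S p hS => by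
    have h3 := h2.filter_mono (nhdsWithin_le_nhds (s := S))
    exact tendsto_dress_upper h3 (tendsto_upper hA nhdsWithin_le_nhds h0.le h3) hS
  constructor
  · refine key _ _ fun j => ?_
    exact tendsto_dressPole_outer x nhdsWithin_le_nhds (hr j) (hzi j) h0.le (hle j)
      (hp.mono fun v hv => hv j)
  · refine key _ _ fun j => ?_
    split_ifs with hji
    · subst hji
      exact tendsto_dressPole_inner x nhdsWithin_le_nhds (hzi j) h0.le hm
    · exact tendsto_dressPole_outer x nhdsWithin_le_nhds (hr j) (hzi j) h0.le (hle j)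
        (mem_nhdsWithin_of_mem_nhds (h1.mono fun v hv => hv j hji))

lemma tendsto_dress_sphere_conj (hr : ∀ i, 0 < r i) (hz : ∀ i, r i < (z i).im)
    (hd : ∀ i j, i ≠ j → r i + r j < dist (z i) (z j))
    (hB : ∀ i j, IsDecaying fun z => B (-z) i j - (1 : Matrix (Fin 3) (Fin 3) ℂ) i j)
    {i : Fin n} {l : ℂ} (hl : dist l (conj (z i)) = r i) :
    Tendsto (dress x z r C A B) (𝓝[minusSide z r] l)
      (𝓝 (B l * upperUnip fun k => -conj (comb C (fun i => outerPole x (z i) (conj l)) k))) ∧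
    Tendsto (dress x z r C A B) (𝓝[plusSide z r] l)
      (𝓝 (B l * upperUnip fun k => -conj (comb C (fun j => if j = i then
        innerPole x (z j) (conj l) else outerPole x (z j) (conj l)) k))) := by
  have hzi : ∀ i, 0 < (z i).im := fun i => (hr i).trans (hz i)
  have h0 : l.im < 0 := im_neg_of_dist_le hz hl.le
  have h0' : 0 ≤ (conj l).im := by rw [conj_im]; linarith
  have hl' : dist (conj l) (z i) = r i := by rw [dist_conj_left, hl]
  have h1 : ∀ᶠ v in 𝓝 l, ∀ j, j ≠ i → r j < dist v (conj (z j)) :=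
    eventually_lt_dist fun j hj => by
      rw [← dist_conj_left]; exact lt_dist_of_dist_le hd hj hl'.le
  have h2 : ∀ᶠ v in 𝓝 l, v.im < 0 := (isOpen_lt continuous_im continuous_const).mem_nhds h0
  have hm : ∀ᶠ v in 𝓝[minusSide z r] l, ∀ j, r j < dist v (conj (z j)) := by
    filter_upwards [self_mem_nhdsWithin, mem_nhdsWithin_of_mem_nhds h2] with v hv hv2
    rcases mem_minusSide.1 hv with h | ⟨i, hi⟩
    · exact h.2
    · exact absurd (im_pos_of_dist_le hz hi.le) hv2.not_gt
  have hp : ∀ᶠ v in 𝓝[plusSide z r] l, dist v (conj (z i)) < r i := by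
    filter_upwards [self_mem_nhdsWithin, mem_nhdsWithin_of_mem_nhds h1,
      mem_nhdsWithin_of_mem_nhds h2] with v hv hv1 hv2
    rcases mem_plusSide.1 hv with h | ⟨j, hj⟩
    · exact absurd h.1 hv2.not_gt
    · rcases eq_or_ne j i with rfl | hji
      · exact hj
      · exact absurd hj (hv1 j hji).not_gt
  have hle : ∀ j, r j ≤ dist (conj l) (z j) := fun j => by
    rcases eq_or_ne j i with rfl | hji
    · exact hl'.ge
    · exact (lt_dist_of_dist_le hd hji hl'.le).le
  have key : ∀ S : Set ℂ, ∀ p : Fin n → ℂ, (∀ j, Tendsto (dressPole x (z j) (r j))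
      (map (fun v => conj v) (𝓝[S] l)) (𝓝 (p j))) →
      Tendsto (dress x z r C A B) (𝓝[S] l)
        (𝓝 (B l * upperUnip fun k => -conj (comb C p k))) := fun S p hS => by
    have h3 := h2.filter_mono (nhdsWithin_le_nhds (s := S))
    exact tendsto_dress_lower h3 (tendsto_lower hB nhdsWithin_le_nhds h0.le h3) hS
  have hF : ∀ S : Set ℂ, map (fun v => conj v) (𝓝[S] l) ≤ 𝓝 (conj l) := fun S =>
    map_conj_le nhdsWithin_le_nhds
  constructor
  · refine key _ _ fun j => ?_
    refine tendsto_dressPole_outer x (hF _) (hr j) (hzi j) h0' (hle j)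
      (eventually_map.2 (hm.mono fun v hv => ?_))
    rw [dist_conj_left]
    exact hv j
  · refine key _ _ fun j => ?_
    split_ifs with hji
    · subst hji
      refine tendsto_dressPole_inner x (hF _) (hzi j) h0' (eventually_map.2 (hp.mono fun v hv => ?_))
      rwa [dist_conj_left]
    · refine tendsto_dressPole_outer x (hF _) (hr j) (hzi j) h0' (hle j)
        (eventually_map.2 (mem_nhdsWithin_of_mem_nhds (h1.mono fun v hv => ?_)))
      rw [dist_conj_left]
      exact hv j hji

lemma comb_outerPole (x : ℝ) {l : ℂ} {i : Fin n} (hl : l ≠ z i) :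
    comb C (fun j => outerPole x (z j) l) =
      comb C (fun j => if j = i then innerPole x (z j) l else outerPole x (z j) l) +
        fun k => Complex.exp (2 * I * x * l) * (C i k / (l - z i)) := by
  ext k
  have h : ∀ j, C j k * outerPole x (z j) l =
      C j k * (if j = i then innerPole x (z j) l else outerPole x (z j) l) +
        if j = i then Complex.exp (2 * I * x * l) * (C i k / (l - z i)) else 0 := fun j => by
    split_ifs with hji
    · subst hji
      rw [outerPole_eq_innerPole_add x hl]
      ring
    · simp
  simp only [comb, Pi.add_apply, h, Finset.sum_add_distrib, Finset.sum_ite_eq', Finset.mem_univ,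
    if_true]

/-- The reflection coefficient of the problem on the line obtained by removing the circles. -/
noncomputable def dressedReflection (x : ℝ) (z : Fin n → ℂ) (C : Fin n → Fin 2 → ℂ) (ρ : ℝ → ℂ)
    (k : Fin 2) (t : ℝ) : ℂ :=
  Complex.exp (2 * I * x * t) * ρ t - comb C (fun i => outerPole x (z i) t) k

/-- With `c` the pole sum and `ρ' = e^{2ixt}ρ - c` the dressed coefficient, the lower factors
combine to `ρ' + c = e^{2ixt}ρ`; the upper factor of `conj ρ'` splits as `-conj c` plus the
conjugate of `e^{2ixt}ρ`. -/
lemma jump_real {ρ₁ ρ₂ : ℝ → ℂ} (hAB : ∀ t : ℝ, A t = B t * jumpReal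
    (dressedReflection x z C ρ₁ 0 t) (dressedReflection x z C ρ₂ 1 t)) (t : ℝ) :
    A t * lowerUnip (comb C fun i => outerPole x (z i) t) =
      B t * upperUnip (fun k => -conj (comb C (fun i => outerPole x (z i) t) k)) *
        expAd x t (jumpReal (ρ₁ t) (ρ₂ t)) := by
  rw [hAB, expAd_jumpReal, jumpReal_eq, jumpReal_eq, Matrix.mul_assoc, Matrix.mul_assoc,
    Matrix.mul_assoc, lowerUnip_mul, ← Matrix.mul_assoc (upperUnip _), upperUnip_mul]
  congr 2
  · congr 1
    ext k
    fin_cases k <;> simp [dressedReflection] <;> ring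
  · congr 1
    ext k
    fin_cases k <;> simp [dressedReflection]

lemma jump_sphere {i : Fin n} {l : ℂ} (hl : l ≠ z i) :
    A l * lowerUnip (comb C fun i => outerPole x (z i) l) =
      A l * lowerUnip (comb C fun j => if j = i then innerPole x (z j) l
        else outerPole x (z j) l) * expAd x l (jumpUp (z i) (C i) l) := by
  rw [expAd_jumpUp, Matrix.mul_assoc, lowerUnip_mul, comb_outerPole x hl]

/-- Here the interior is the positive side. Solving for the inner function reverses the sign of the
pole term, which compensates the minus sign in `dress`. -/
lemma jump_sphere_conj {i : Fin n} {l : ℂ} (hl : conj l ≠ z i) :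
    B l * upperUnip (fun k => -conj (comb C (fun j => if j = i then
        innerPole x (z j) (conj l) else outerPole x (z j) (conj l)) k)) =
      B l * upperUnip (fun k => -conj (comb C (fun i => outerPole x (z i) (conj l)) k)) *
        expAd x l (jumpDown (z i) (C i) l) := by
  rw [expAd_jumpDown, Matrix.mul_assoc, upperUnip_mul, comb_outerPole x hl]
  congr 2
  ext k
  have e : conj (Complex.exp (2 * I * x * conj l)) = Complex.exp (-(2 * I * x * l)) := by
    rw [← Complex.exp_conj]
    simp [conj_ofNat]
  simp only [Pi.add_apply, map_add, map_mul, map_div₀, map_sub, conj_conj, e]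
  ring

lemma isRegular_dressedReflection (hz : ∀ i, 0 < (z i).im) {ρ : ℝ → ℂ} (h : IsRegular ρ)
    (k : Fin 2) : IsRegular (dressedReflection x z C ρ k) := by
  have h1 := IsRegular.sum Finset.univ fun i _ =>
    ((isRegular_pole (hz i)).const_mul (C i k * Complex.exp (2 * I * x * z i)))
  have h2 := (h.modulate x).add (h1.const_mul (-1))
  convert h2 using 2 with t
  simp only [dressedReflection, comb, outerPole, sub_eq_add_neg, neg_one_mul, mul_assoc]

theorem exists_isSolution {ρ₁ ρ₂ : ℝ → ℂ} (h₁ : IsRegular ρ₁) (h₂ : IsRegular ρ₂)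
    (hr : ∀ i, 0 < r i) (hz : ∀ i, r i < (z i).im)
    (hd : ∀ i j, i ≠ j → r i + r j < dist (z i) (z j)) :
    ∃ M : ℂ → Matrix (Fin 3) (Fin 3) ℂ, IsSolution x ρ₁ ρ₂ z r C M := by
  have hzi : ∀ i, 0 < (z i).im := fun i => (hr i).trans (hz i)
  obtain ⟨A, B, hA, hB, hAB⟩ := exists_real_line
    (isRegular_dressedReflection (x := x) (C := C) hzi h₁ 0)
    (isRegular_dressedReflection (x := x) (C := C) hzi h₂ 1)
  set M := dress x z r C A B with hM
  have hR := tendsto_dress_real (x := x) (C := C) hr hz hA hB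
  have hU := fun i (l : ℂ) => tendsto_dress_sphere (x := x) (C := C) (B := B) hr hz hd hA
    (i := i) (l := l)
  have hD := fun i (l : ℂ) => tendsto_dress_sphere_conj (x := x) (C := C) (A := A) hr hz hd hB
    (i := i) (l := l)
  have hcp := contour_subset_closure_plusSide hr hz hd
  have hcm := contour_subset_closure_minusSide hr hz hd
  -- Existence of both limits at every point of Γ is all that continuity requires: the extension by
  -- limits is automatically continuous in a regular space, so the pieces of Γ need not be matched.
  have hlim : ∀ l ∈ contour z r, (∃ a, Tendsto M (𝓝[plusSide z r] l) (𝓝 a)) ∧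
      ∃ b, Tendsto M (𝓝[minusSide z r] l) (𝓝 b) := fun l hl => by
    rcases mem_contour.1 hl with h0 | ⟨i, hi⟩ | ⟨i, hi⟩
    · obtain ⟨t, rfl⟩ : ∃ t : ℝ, (t : ℂ) = l := ⟨l.re, Complex.ext (by simp) (by simp [h0])⟩
      exact ⟨⟨_, (hR t).1⟩, _, (hR t).2⟩
    · exact ⟨⟨_, (hU i l hi).1⟩, _, (hU i l hi).2⟩
    · exact ⟨⟨_, (hD i l hi).2⟩, _, (hD i l hi).1⟩
  have hP : ∀ l ∈ contour z r, Tendsto M (𝓝[plusSide z r] l) (𝓝 (extendFrom (plusSide z r) M l)) :=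
    fun l hl => tendsto_extendFrom (hlim l hl).1
  have hN : ∀ l ∈ contour z r,
      Tendsto M (𝓝[minusSide z r] l) (𝓝 (extendFrom (minusSide z r) M l)) :=
    fun l hl => tendsto_extendFrom (hlim l hl).2
  have heq : ∀ {l : ℂ} {a b J : Matrix (Fin 3) (Fin 3) ℂ}, l ∈ contour z r →
      Tendsto M (𝓝[plusSide z r] l) (𝓝 a) → Tendsto M (𝓝[minusSide z r] l) (𝓝 b) →
      a = b * J → extendFrom (plusSide z r) M l = extendFrom (minusSide z r) M l * J :=
    fun hl ha hb h => by
      rw [extendFrom_eq (hcp hl) ha, extendFrom_eq (hcm hl) hb, h]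
  have hreg : RegularSpace (Matrix (Fin 3) (Fin 3) ℂ) :=
    inferInstanceAs (RegularSpace (Fin 3 → Fin 3 → ℂ))
  refine ⟨M, differentiableOn_dress hr hz hA hB, tendsto_dress_one hA hB,
    fun δ hδ => isBigO_dress hA hB hδ, extendFrom (plusSide z r) M, extendFrom (minusSide z r) M,
    continuousOn_extendFrom hcp fun l hl => (hlim l hl).1,
    continuousOn_extendFrom hcm fun l hl => (hlim l hl).2, hP, hN, fun t => ?_, fun i l hl => ?_,
    fun i l hl => ?_⟩
  · exact heq (mem_contour.2 (Or.inl (ofReal_im t))) (hR t).1 (hR t).2 (jump_real hAB t)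
  · have hl' : dist l (z i) = r i := hl
    refine heq (mem_contour.2 (Or.inr (Or.inl ⟨i, hl'⟩))) (hU i l hl').1 (hU i l hl').2
      (jump_sphere fun h => ?_)
    rw [h, dist_self] at hl'
    exact (hr i).ne hl'
  · have hl' : dist l (conj (z i)) = r i := hl
    refine heq (mem_contour.2 (Or.inr (Or.inr ⟨i, hl'⟩))) (hD i l hl').2 (hD i l hl').1
      (jump_sphere_conj fun h => ?_)
    rw [← dist_conj_left, h, dist_self] at hl'
    exact (hr i).ne hl'

end

end ManakovRHP

theorem mainTheorem7 (x : ℝ) (ρ₁ ρ₂ : ℝ → ℂ)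
    (hρ₁ : ManakovRHP.MemH11 ρ₁) (hρ₂ : ManakovRHP.MemH11 ρ₂)
    (n : ℕ) (z : Fin n → ℂ) (r : Fin n → ℝ) (C : Fin n → Fin 2 → ℂ)
    (hr : ∀ i, 0 < r i) (hz : ∀ i, r i < (z i).im)
    (hd : ∀ i j, i ≠ j → r i + r j < dist (z i) (z j)) :
    ∃ M : ℂ → Matrix (Fin 3) (Fin 3) ℂ,
      ManakovRHP.IsSolution x ρ₁ ρ₂ z r C M ∧
        ∀ M' : ℂ → Matrix (Fin 3) (Fin 3) ℂ, ManakovRHP.IsSolution x ρ₁ ρ₂ z r C M' →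
          Set.EqOn M' M (ManakovRHP.contour z r)ᶜ := by
  obtain ⟨M, hM⟩ := ManakovRHP.exists_isSolution (x := x) (C := C) hρ₁.isRegular hρ₂.isRegular
    hr hz hd
  exact ⟨M, hM, fun M' hM' => ManakovRHP.IsSolution.unique hr hz hd hM hM'⟩
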